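/- Let $k$ be a field, let $K$ be a finite extension of the rational function field $k(q)$, let $\mathcal O_K$ be the integral closure of $k[q]$ in $K$, let $0\neq P\in\mathcal O_K[x]$ and $$\mathcal A=\mathcal O_K\Big[x,\tfrac1{P(x)},\tfrac1{P(qx)},\tfrac1{P(q^2x)},\dots\Big]\subset K(x),$$ with $\sigma_q f(x)=f(qx)$, $\delta_q=\frac{\sigma_q-1}{q-1}$ and $\partial=x\frac{d}{dx}$. For a maximal ideal $v$ of $\mathcal O_K$ with $q\notin v$ and $P\not\equiv 0 \bmod v$ put $k_v=\mathcal O_K/v$, $q_v=q\bmod v$, and $\mathcal A_v=\mathcal A\otimes_{\mathcal O_K}k_v$, whose fraction field is $k_v(x)$; it carries the induced operators $\sigma_{q_v}$, $\delta_{q_v}$ (equal to $x\frac{d}{dx}$ if $q_v=1$) and $\partial$. Let $B$ be one of the rings $\mathcal A$, $\mathcal A_v$, $K(x)$, $k_v(x)$. A *$q$-difference module* over $B$ is a finitely generated projective $B$-module $M$ with a $\sigma$-semilinear operator $\Sigma$ which is invertible in the sense that its linearization $B\otimes_{\sigma,B}M\to M$ is an isomorphism. A *module with connection* over $(B,\delta)$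 is a finitely generated projective $B$-module $M$ with an additive operator $\Delta$ such that $\Delta(bm)=\delta(b)m+\sigma(b)\Delta(m)$ and such that the $\sigma$-semilinear operator $\Sigma=1+(q-1)\Delta$ (with $q_v$ in place of $q$ over $\mathcal A_v$ and $k_v(x)$) is invertible in the same sense; for $q_v=1$ this is a differential module. Morphisms are the $B$-linear maps that commute with $\Sigma$ (resp. $\Delta$). The prolongation $F_\partial(M)=B[\partial]_{\le 1}\otimes_B M$ consists of the elements $m_0+\partial(m_1)$, with $b\,\partial(m)=\partial(bm)-\partial(b)m$, and $\Sigma$ (resp. $\Delta$) acts by $\partial^i(m)\mapsto\partial^i(\Sigma m)$ (resp. $\partial^i(\Delta m)$). In either category let $\langle M\rangle^{\otimes}$ (resp. $\langle M\rangle^{\otimes,\partial}$) be the smallest full subcategory that contains $M$ and the unit object and is stable under direct sums, tensor products, duals, subobjects and quotients (resp. and under $F_\partial$). The generic Galois group $Gal(M,\eta_B)$ is the group functor that maps a $B$-algebra $R$ to the group of tensor automorphisms of the functor $N\mapsto R\otimes_B N$ on $\langle M\rangle^{\otimes}$. The parameterized generic Galois group $Gal^\partial(M,\eta_B)$ is the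 group functor that maps a differential $B$-algebra $(R,\partial)$ to the group of those tensor automorphisms $g$ of $N\mapsto R\otimes_B N$ on $\langle M\rangle^{\otimes,\partial}$ for which $g_{F_\partial(N)}=F_\partial(g_N)$ for all $N$. The base change of such a functor to a (differential) $B$-algebra $F$ is its restriction to (differential) $F$-algebras. Let $M$ be a $q$-difference module over $\mathcal A$ and let $v$ be as above with $q_v\neq1$; or let $M$ be a module with connection over $(\mathcal A,\delta_q)$ and let $v$ be any place as above, $q_v=1$ allowed. Let $M_{K(x)}$, $M\otimes_{\mathcal A}\mathcal A_v$ and $M_{k_v(x)}=(M\otimes_{\mathcal A}\mathcal A_v)\otimes_{\mathcal A_v}k_v(x)$ be the modules obtained by base change. Then there are isomorphisms of group functors 1. $Gal(M,\eta_{\mathcal A})\otimes K(x)\simeq Gal(M_{K(x)},\eta_{K(x)})$, 2. $Gal^{\partial}(M,\eta_{\mathcal A})\otimes K(x)\simeq Gal^{\partial}(M_{K(x)},\eta_{K(x)})$, 3. $Gal(M\otimes_{\mathcal A}\mathcal A_v,\eta_{\mathcal A_v})\otimes k_v(x)\simeq Gal(M_{k_v(x)},\eta_{k_v(x)})$, 4.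 $Gal^{\partial}(M\otimes_{\mathcal A}\mathcal A_v,\eta_{\mathcal A_v})\otimes k_v(x)\simeq Gal^{\partial}(M_{k_v(x)},\eta_{k_v(x)})$, compatible with the actions on $M_{K(x)}$ and on $M_{k_v(x)}$, respectively. -/

import Mathlib

open Polynomial TensorProduct

universe u v w

namespace QDiff

noncomputable section

/-! ### Generalized differential rings of rank one -/

/-- A commutative ring `B` with a generalized differential `b ↦ dx · δ b` with values in the
bimodule `Ω¹ = dx · B`, where `b · dx = dx · σ b` and `σ = 1 + h δ`, together with a derivation
`∂` that commutes with everything.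

* `h = 1`, `δ = σ - 1`: a difference ring `(B, σ)`;
* `h = q - 1`, `δ = (σ_q - 1) / (q - 1)`: the ring `(B, δ_q)`;
* `h = 0`, `σ = 1`: the differential ring `(B, δ)`. -/
structure GenDiffRing (B : Type u) [CommRing B] where
  sig : B →+* B
  del : B →+ B
  h : B
  der : Derivation ℤ B B
  sig_eq : ∀ b, sig b = b + h * del b
  del_mul : ∀ a b, del (a * b) = del a * b + sig a * del b
  der_sig : ∀ b, der (sig b) = sig (der b)
  der_del : ∀ b, der (del b) = del (der b)
  der_h : der h = 0

namespace GenDiffRing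

variable {B : Type u} [CommRing B]

theorem del_one (D : GenDiffRing B) : D.del 1 = 0 := by
  have := D.del_mul 1 1
  simpa using this

/-- The difference ring `(B, σ)`: `h = 1` and `δ = σ - 1`. -/
def ofSig (sig : B →+* B) (der : Derivation ℤ B B) (comm : ∀ b, der (sig b) = sig (der b)) :
    GenDiffRing B where
  sig := sig
  del := sig.toAddMonoidHom - AddMonoidHom.id B
  h := 1
  der := der
  sig_eq b := by simp
  del_mul a b := by simp; ring
  der_sig := comm
  der_del b := by simp [comm]
  der_h := by simp

/-- The structure map `B → F` is a morphism of generalized differential rings that is compatible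
with the derivations `∂`. -/
structure IsMor {F : Type v} [CommRing F] [Algebra B F] (D : GenDiffRing B) (E : GenDiffRing F) :
    Prop where
  sig : ∀ b, algebraMap B F (D.sig b) = E.sig (algebraMap B F b)
  del : ∀ b, algebraMap B F (D.del b) = E.del (algebraMap B F b)
  h : algebraMap B F D.h = E.h
  der : ∀ b, algebraMap B F (D.der b) = E.der (algebraMap B F b)

end GenDiffRing

/-! ### The prolongation of a module -/

/-- `F_∂(V) = B[∂]_{≤ 1} ⊗ V`. The pair `(v₀, v₁)` stands for `v₀ + ∂(v₁)`, and the left module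
structure is given by the rule `b ∂(v) = ∂(b v) - ∂(b) v`. -/
def Prol {B : Type u} [CommRing B] (_d : Derivation ℤ B B) (V : Type v) : Type v := V × V

namespace Prol

variable {B : Type u} [CommRing B] (d : Derivation ℤ B B)
variable (V : Type v) [AddCommGroup V] [Module B V]
variable {W : Type w} [AddCommGroup W] [Module B W]

instance : AddCommGroup (Prol d V) := inferInstanceAs (AddCommGroup (V × V))

instance : Module B (Prol d V) where
  smul b x := (b • x.1 - d b • x.2, b • x.2)
  one_smul x := by
    change ((1 : B) • x.1 - d 1 • x.2, (1 : B) • x.2) = x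
    simp only [one_smul, Derivation.map_one_eq_zero, zero_smul, sub_zero]
    rfl
  mul_smul a b x := by
    change ((a * b) • x.1 - d (a * b) • x.2, (a * b) • x.2) =
      (a • (b • x.1 - d b • x.2) - d a • b • x.2, a • b • x.2)
    refine Prod.ext ?_ (mul_smul _ _ _)
    simp only [Derivation.leibniz, smul_sub, add_smul, mul_smul, smul_eq_mul]
    rw [smul_comm b (d a)]
    abel
  smul_zero a := by
    change (a • (0 : V) - d a • (0 : V), a • (0 : V)) = (0, 0)
    simp
  smul_add a x y := by
    change (a • (x.1 + y.1) - d a • (x.2 + y.2), a • (x.2 + y.2)) =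
      (a • x.1 - d a • x.2 + (a • y.1 - d a • y.2), a • x.2 + a • y.2)
    refine Prod.ext ?_ (smul_add _ _ _)
    simp only [smul_add]; abel
  add_smul a b x := by
    change ((a + b) • x.1 - d (a + b) • x.2, (a + b) • x.2) =
      (a • x.1 - d a • x.2 + (b • x.1 - d b • x.2), a • x.2 + b • x.2)
    refine Prod.ext ?_ (add_smul _ _ _)
    simp only [map_add, add_smul]; abel
  zero_smul x := by
    change ((0 : B) • x.1 - d 0 • x.2, (0 : B) • x.2) = (0, 0)
    simp

variable {V}

theorem smul_def (b : B) (x : Prol d V) :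
    b • x = ((b • x.1 - d b • x.2, b • x.2) : V × V) := rfl

/-- `F_∂(f)` for a linear map `f`. -/
def map (f : V →ₗ[B] W) : Prol d V →ₗ[B] Prol d W where
  toFun x := ((f x.1, f x.2) : W × W)
  map_add' x y := Prod.ext (map_add f x.1 y.1) (map_add f x.2 y.2)
  map_smul' b x := by
    change ((f (b • x.1 - d b • x.2), f (b • x.2)) : W × W) =
      (b • f x.1 - d b • f x.2, b • f x.2)
    simp

/-- The canonical map `R ⊗ F_∂(V) → F_∂(R ⊗ V)`, `r ⊗ ∂^k(v) ↦ r ∂^k(1 ⊗ v)`, for a differential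
`B`-algebra `R`. -/
def comparison {R : Type w} [CommRing R] [Algebra B R] (dR : Derivation ℤ R R)
    (hd : ∀ b, dR (algebraMap B R b) = algebraMap B R (d b)) :
    R ⊗[B] Prol d V →ₗ[R] Prol dR (R ⊗[B] V) :=
  letI : Module B (Prol dR (R ⊗[B] V)) := Module.compHom _ (algebraMap B R)
  haveI : IsScalarTower B R (Prol dR (R ⊗[B] V)) :=
    ⟨fun b r x => by rw [Algebra.smul_def, mul_smul]; rfl⟩
  LinearMap.liftBaseChange R
    { toFun := fun x => ((1 ⊗ₜ x.1, 1 ⊗ₜ x.2) : (R ⊗[B] V) × (R ⊗[B] V))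
      map_add' := fun x y =>
        Prod.ext (TensorProduct.tmul_add _ x.1 y.1) (TensorProduct.tmul_add _ x.2 y.2)
      map_smul' := fun b x => by
        change (((1 : R) ⊗ₜ[B] (b • x.1 - d b • x.2), (1 : R) ⊗ₜ[B] (b • x.2)) :
            (R ⊗[B] V) × (R ⊗[B] V)) =
          (algebraMap B R b • ((1 : R) ⊗ₜ[B] x.1) - dR (algebraMap B R b) • ((1 : R) ⊗ₜ[B] x.2),
            algebraMap B R b • ((1 : R) ⊗ₜ[B] x.2))
        rw [hd]
        simp only [TensorProduct.tmul_sub, TensorProduct.tmul_smul, algebraMap_smul] }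

variable (V)

/-- The projection `v₀ + ∂(v₁) ↦ v₁`. -/
def snd : Prol d V →ₗ[B] V where
  toFun x := x.2
  map_add' _ _ := rfl
  map_smul' _ _ := rfl

/-- The inclusion `v ↦ v`. -/
def inl : V →ₗ[B] Prol d V where
  toFun x := ((x, 0) : V × V)
  map_add' x y := Prod.ext rfl (by change (0 : V) = 0 + 0; simp)
  map_smul' b x := by
    change ((b • x, 0) : V × V) = (b • x - d b • (0 : V), b • (0 : V))
    simp

theorem exists_equiv [Module.Projective B V] : Nonempty (Prol d V ≃ₗ[B] V × V) := by
  obtain ⟨s, hs⟩ := Module.projective_lifting_property (Prol.snd d V) LinearMap.id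
    (fun v => ⟨((0, v) : V × V), rfl⟩)
  have hs' : ∀ v, (s v).2 = v := fun v => LinearMap.congr_fun hs v
  refine ⟨LinearEquiv.symm (LinearEquiv.ofBijective ((Prol.inl d V).coprod s) ⟨?_, ?_⟩)⟩
  · rw [← LinearMap.ker_eq_bot, LinearMap.ker_eq_bot']
    rintro ⟨a, b⟩ hab
    have h2 : (0 : V) + (s b).2 = 0 := congrArg Prod.snd hab
    have hb : b = 0 := by simpa [hs'] using h2
    subst hb
    have h1 : a + (s 0).1 = 0 := congrArg Prod.fst hab
    rw [map_zero] at h1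
    have h1' : a + (0 : V) = 0 := h1
    simpa using h1'
  · intro x
    refine ⟨(x.1 - (s x.2).1, x.2), ?_⟩
    refine Prod.ext ?_ ?_
    · change x.1 - (s x.2).1 + (s x.2).1 = x.1
      simp
    · change (0 : V) + (s x.2).2 = x.2
      simp [hs']

instance [Module.Projective B V] : Module.Projective B (Prol d V) :=
  Module.Projective.of_equiv (exists_equiv d V).some.symm

instance [Module.Projective B V] [Module.Finite B V] : Module.Finite B (Prol d V) :=
  Module.Finite.equiv (exists_equiv d V).some.symm

end Prol

/-! ### Modules with connection -/

/-- An object of `Diff_B`: a finitely generated projective `B`-module with a connection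
`m ↦ dx · Δ m`, such that the `σ`-semilinear operator `Σ = 1 + h Δ` is invertible, in the sense
that `Σ(N)` generates `N` (over a domain this says that the linearization `B ⊗_{σ, B} N → N` of
`Σ` is an isomorphism; if `N` is free, that the matrix of `Σ` in a basis is invertible). -/
structure Obj {B : Type u} [CommRing B] (D : GenDiffRing B) where
  carrier : Type u
  [addCommGroup : AddCommGroup carrier]
  [module : Module B carrier]
  [finite : Module.Finite B carrier]
  [projective : Module.Projective B carrier]
  del : carrier →+ carrier
  leibniz : ∀ (b : B) (n : carrier), del (b • n) = D.del b • n + D.sig b • del n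
  span_eq_top : Submodule.span B (Set.range fun n => n + D.h • del n) = ⊤

attribute [instance] Obj.addCommGroup Obj.module Obj.finite Obj.projective

namespace Obj

variable {B : Type u} [CommRing B] {D : GenDiffRing B}

instance : CoeSort (Obj D) (Type u) := ⟨Obj.carrier⟩

/-- The operator `Σ = 1 + h Δ`. -/
def sig (N : Obj D) : N →+ N where
  toFun n := n + D.h • N.del n
  map_zero' := by simp
  map_add' x y := by simp only [map_add, smul_add]; abel

theorem sig_apply (N : Obj D) (n : N) : N.sig n = n + D.h • N.del n := rfl

theorem sig_smul (N : Obj D) (b : B) (n : N) : N.sig (b • n) = D.sig b • N.sig n := by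
  simp only [sig_apply, N.leibniz, D.sig_eq, smul_add, add_smul, mul_smul]
  rw [smul_comm b D.h, smul_comm (D.del b) D.h, add_assoc]

/-- Morphisms of `Diff_B`: the linear maps that commute with the connections. -/
def IsHom (N N' : Obj D) (f : N →ₗ[B] N') : Prop := ∀ n, f (N.del n) = N'.del (f n)

variable (D) in
/-- The unit object. -/
def unit : Obj D where
  carrier := B
  del := D.del
  leibniz := D.del_mul
  span_eq_top := by
    refine (Ideal.eq_top_iff_one _).2 (Submodule.subset_span ⟨1, ?_⟩)
    simp [D.del_one]

/-- Direct sum. -/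
def prod (N N' : Obj D) : Obj D where
  carrier := N × N'
  del := N.del.prodMap N'.del
  leibniz b n := by ext <;> simp [leibniz]
  span_eq_top := by
    rw [eq_top_iff]
    have h1 : (⊤ : Submodule B N) ≤ Submodule.comap (LinearMap.inl B N N')
        (Submodule.span B (Set.range fun n : N × N' =>
          n + D.h • (N.del.prodMap N'.del) n)) := by
      rw [← N.span_eq_top, Submodule.span_le]
      rintro _ ⟨n, rfl⟩
      exact Submodule.subset_span ⟨(n, 0), by ext <;> simp⟩
    have h2 : (⊤ : Submodule B N') ≤ Submodule.comap (LinearMap.inr B N N')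
        (Submodule.span B (Set.range fun n : N × N' =>
          n + D.h • (N.del.prodMap N'.del) n)) := by
      rw [← N'.span_eq_top, Submodule.span_le]
      rintro _ ⟨n, rfl⟩
      exact Submodule.subset_span ⟨(0, n), by ext <;> simp⟩
    rintro ⟨a, b⟩ -
    have ha := h1 (Submodule.mem_top (x := a))
    have hb := h2 (Submodule.mem_top (x := b))
    rw [Submodule.mem_comap] at ha hb
    simpa using Submodule.add_mem _ ha hb

/-- `Δ(n ⊗ n') = Δ n ⊗ n' + Σ n ⊗ Δ n'` on a tensor product. -/
def tensorDel (N N' : Obj D) : N ⊗[B] N' →+ N ⊗[B] N' :=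
  TensorProduct.liftAddHom (R := B)
    (AddMonoidHom.mk' (fun n => AddMonoidHom.mk' (fun n' => N.del n ⊗ₜ[B] n' + N.sig n ⊗ₜ[B] N'.del n')
      (fun x y => by rw [map_add, TensorProduct.tmul_add, TensorProduct.tmul_add]; abel))
      (fun x y => by
        ext n'
        simp only [map_add, TensorProduct.add_tmul, AddMonoidHom.mk'_apply,
          AddMonoidHom.add_apply]
        abel))
    (fun b n n' => by
      simp only [AddMonoidHom.mk'_apply, N.leibniz, N'.leibniz, N.sig_smul,
        TensorProduct.tmul_add, TensorProduct.add_tmul, TensorProduct.tmul_smul]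
      simp only [sig_apply, ← TensorProduct.smul_tmul', TensorProduct.add_tmul, smul_add,
        smul_smul, D.sig_eq, add_smul]
      rw [mul_comm (D.del b) D.h]
      abel)

@[simp] theorem tensorDel_tmul (N N' : Obj D) (n : N) (n' : N') :
    tensorDel N N' (n ⊗ₜ n') = N.del n ⊗ₜ n' + N.sig n ⊗ₜ N'.del n' := rfl

theorem tensor_sig_aux (N N' : Obj D) (n : N) (n' : N') :
    n ⊗ₜ[B] n' + D.h • tensorDel N N' (n ⊗ₜ n') = N.sig n ⊗ₜ N'.sig n' := by
  simp only [tensorDel_tmul, sig_apply, TensorProduct.add_tmul, TensorProduct.tmul_add, smul_add,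
    TensorProduct.tmul_smul, ← TensorProduct.smul_tmul']
  abel

/-- Tensor product. -/
def tensor (N N' : Obj D) : Obj D where
  carrier := N ⊗[B] N'
  del := tensorDel N N'
  leibniz b t := by
    induction t using TensorProduct.induction_on with
    | zero => simp
    | tmul n n' =>
      rw [TensorProduct.smul_tmul', tensorDel_tmul, tensorDel_tmul, N.leibniz, N.sig_smul]
      simp only [TensorProduct.add_tmul, ← TensorProduct.smul_tmul', smul_add]
      abel
    | add x y hx hy => simp only [smul_add, map_add, hx, hy]; abel
  span_eq_top := by
    rw [eq_top_iff, ← TensorProduct.span_tmul_eq_top, Submodule.span_le]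
    rintro _ ⟨n, n', rfl⟩
    have hn : n ∈ Submodule.span B (Set.range fun n => n + D.h • N.del n) := by
      rw [N.span_eq_top]; trivial
    have hn' : n' ∈ Submodule.span B (Set.range fun n => n + D.h • N'.del n) := by
      rw [N'.span_eq_top]; trivial
    have := Submodule.apply_mem_map₂ (TensorProduct.mk B N N') hn hn'
    rw [Submodule.map₂_span_span] at this
    refine Submodule.span_mono ?_ this
    rintro _ ⟨_, ⟨m, rfl⟩, _, ⟨m', rfl⟩, rfl⟩
    exact ⟨m ⊗ₜ m', tensor_sig_aux N N' m m'⟩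

/-- `N'` is a dual of `N`: there is a perfect pairing `N' × N → B` that induces a morphism
`N' ⊗ N → B` of modules with connection. -/
def IsDual (N N' : Obj D) : Prop :=
  ∃ p : N' →ₗ[B] N →ₗ[B] B, p.IsPerfPair ∧
    ∀ (f : N') (n : N), D.del (p f n) = p (N'.del f) n + p (N'.sig f) (N.del n)

/-- `Δ(∂^k(n)) = ∂^k(Δ n)` on `F_∂(N)`. -/
def prolDel (N : Obj D) : Prol D.der N →+ Prol D.der N := N.del.prodMap N.del

/-- The prolongation `F_∂(N)`. -/
def prol (N : Obj D) : Obj D where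
  carrier := Prol D.der N
  del := prolDel N
  leibniz b n := by
    refine Prod.ext ?_ (N.leibniz b n.2)
    change N.del (b • n.1 - D.der b • n.2) =
      (D.del b • n.1 - D.der (D.del b) • n.2) + (D.sig b • N.del n.1 - D.der (D.sig b) • N.del n.2)
    rw [map_sub, N.leibniz, N.leibniz, D.der_del, D.der_sig]
    abel
  span_eq_top := by
    have key : ∀ a c : N, ((N.sig a, N.sig c) : N × N) ∈ (Submodule.span B (Set.range
        fun n : Prol D.der N => n + D.h • prolDel N n) :
          Submodule B (Prol D.der N)) := by
      intro a c
      refine Submodule.subset_span ⟨((a, c) : N × N), ?_⟩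
      refine Prod.ext ?_ rfl
      change a + (D.h • N.del a - D.der D.h • N.del c) = a + D.h • N.del a
      simp [D.der_h]
    have h1 : (⊤ : Submodule B N) ≤ Submodule.comap (Prol.inl D.der N) (Submodule.span B (Set.range
        fun n : Prol D.der N => n + D.h • prolDel N n)) := by
      rw [← N.span_eq_top, Submodule.span_le]
      rintro _ ⟨n, rfl⟩
      have := key n 0
      rw [map_zero] at this
      exact this
    have h2 : (⊤ : Submodule B N) ≤ Submodule.map (Prol.snd D.der N) (Submodule.span B (Set.range
        fun n : Prol D.der N => n + D.h • prolDel N n)) := by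
      rw [← N.span_eq_top, Submodule.span_le]
      rintro _ ⟨n, rfl⟩
      exact ⟨_, key 0 n, rfl⟩
    rw [eq_top_iff]
    rintro x -
    obtain ⟨y, hy, hyx⟩ := h2 (Submodule.mem_top (x := x.2))
    have hxy : x = y + Prol.inl D.der N (x.1 - y.1) := by
      refine Prod.ext ?_ ?_
      · change x.1 = y.1 + (x.1 - y.1)
        abel
      · change x.2 = y.2 + 0
        rw [add_zero]; exact hyx.symm
    rw [hxy]
    exact Submodule.add_mem _ hy (h1 Submodule.mem_top)

/-! #### Base change -/

section BaseChange

variable {F : Type u} [CommRing F] [Algebra B F] {E : GenDiffRing F}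

/-- `Δ(c ⊗ n) = δ(c) ⊗ n + σ(c) ⊗ Δ n` on `F ⊗ N`. -/
def baseChangeDel (hDE : D.IsMor E) (N : Obj D) : F ⊗[B] N →+ F ⊗[B] N :=
  TensorProduct.liftAddHom
    (AddMonoidHom.mk' (fun c => AddMonoidHom.mk' (fun n => E.del c ⊗ₜ n + E.sig c ⊗ₜ N.del n)
      (fun x y => by simp only [map_add, TensorProduct.tmul_add]; abel))
      (fun x y => by
        ext n
        simp only [map_add, TensorProduct.add_tmul, AddMonoidHom.mk'_apply,
          AddMonoidHom.add_apply]
        abel))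
    (fun b c n => by
      simp only [AddMonoidHom.mk'_apply, N.leibniz, TensorProduct.tmul_add]
      rw [Algebra.smul_def, mul_comm, E.del_mul, map_mul, ← hDE.del, ← hDE.sig, mul_comm _ (algebraMap B F b),
        mul_comm _ (algebraMap B F (D.del b)), mul_comm _ (algebraMap B F (D.sig b))]
      simp only [← Algebra.smul_def, TensorProduct.add_tmul, TensorProduct.tmul_smul,
        TensorProduct.smul_tmul']
      abel)

@[simp] theorem baseChangeDel_tmul (hDE : D.IsMor E) (N : Obj D) (c : F) (n : N) :
    baseChangeDel hDE N (c ⊗ₜ n) = E.del c ⊗ₜ n + E.sig c ⊗ₜ N.del n := rfl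

/-- The module with connection `F ⊗_B N`. -/
def baseChange (hDE : D.IsMor E) (N : Obj D) : Obj E where
  carrier := F ⊗[B] N
  del := baseChangeDel hDE N
  leibniz c t := by
    induction t using TensorProduct.induction_on with
    | zero => simp
    | tmul a n =>
      rw [TensorProduct.smul_tmul', baseChangeDel_tmul, baseChangeDel_tmul, smul_eq_mul,
        E.del_mul, map_mul]
      simp only [TensorProduct.add_tmul, TensorProduct.smul_tmul', smul_add, smul_eq_mul]
      abel
    | add x y hx hy => simp only [smul_add, map_add, hx, hy]; abel
  span_eq_top := by
    have h1 : (⊤ : Submodule B N) ≤ Submodule.comap (TensorProduct.mk B F N 1)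
        ((Submodule.span F (Set.range fun t => t + E.h • baseChangeDel hDE N t)).restrictScalars
          B) := by
      rw [← N.span_eq_top, Submodule.span_le]
      rintro _ ⟨n, rfl⟩
      refine Submodule.subset_span ⟨1 ⊗ₜ n, ?_⟩
      simp only [baseChangeDel_tmul, E.del_one, map_one, TensorProduct.zero_tmul, zero_add,
        TensorProduct.mk_apply, TensorProduct.tmul_add, TensorProduct.tmul_smul, ← hDE.h,
        algebraMap_smul]
    rw [eq_top_iff]
    rintro t -
    induction t using TensorProduct.induction_on with
    | zero => exact Submodule.zero_mem _
    | tmul c n =>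
      have := Submodule.smul_mem
        (Submodule.span F (Set.range fun t => t + E.h • baseChangeDel hDE N t)) c
        (h1 (Submodule.mem_top (x := n)))
      simpa [TensorProduct.smul_tmul'] using this
    | add x y hx hy => exact Submodule.add_mem _ hx hy

end BaseChange

/-- A difference module `(M, Σ)` over a difference ring `(B, σ)`, as a module with connection. -/
def ofSemilinear (sig : B →+* B) (der : Derivation ℤ B B) (comm : ∀ b, der (sig b) = sig (der b))
    (M : Type u) [AddCommGroup M] [Module B M] [Module.Finite B M] [Module.Projective B M]
    (S : M →ₛₗ[sig] M) (hS : Submodule.span B (Set.range S) = ⊤) :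
    Obj (GenDiffRing.ofSig sig der comm) where
  carrier := M
  del := S.toAddMonoidHom - AddMonoidHom.id M
  leibniz b m := by
    change S (b • m) - b • m = (sig b - b) • m + sig b • (S m - m)
    rw [map_smulₛₗ, smul_sub, sub_smul]
    abel
  span_eq_top := by
    convert hS using 3
    ext m
    change m + (1 : B) • (S m - m) = S m
    simp

end Obj

/-! ### Generated tannakian subcategories -/

section Generated

variable {B : Type u} [CommRing B] {D : GenDiffRing B}

/-- `C` is (the class of objects of) a full subcategory of `Diff_B` that contains the unit object
and is stable under direct sums, tensor products, duals, subobjects and quotients. -/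
structure IsTannakian (C : Obj D → Prop) : Prop where
  unit : C (Obj.unit D)
  prod : ∀ N N', C N → C N' → C (N.prod N')
  tensor : ∀ N N', C N → C N' → C (N.tensor N')
  dual : ∀ N N', C N → N.IsDual N' → C N'
  sub : ∀ (N N' : Obj D) (f : N' →ₗ[B] N), C N → Obj.IsHom N' N f → Function.Injective f → C N'
  quot : ∀ (N N' : Obj D) (f : N →ₗ[B] N'), C N → Obj.IsHom N N' f → Function.Surjective f → C N'

/-- Moreover, `C` is stable under the prolongation functor. -/
structure IsDiffTannakian (C : Obj D → Prop) : Prop extends IsTannakian C where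
  prol : ∀ N, C N → C N.prol

/-- `⟨M⟩^⊗`. -/
def Gen (M N : Obj D) : Prop := ∀ C : Obj D → Prop, IsTannakian C → C M → C N

/-- `⟨M⟩^{⊗,∂}`. -/
def GenDiff (M N : Obj D) : Prop := ∀ C : Obj D → Prop, IsDiffTannakian C → C M → C N

theorem Gen.self (M : Obj D) : Gen M M := fun _ _ h => h

theorem GenDiff.self (M : Obj D) : GenDiff M M := fun _ _ h => h

/-! ### Galois groups -/

/-- `R ⊗ (N ⊗ N') = (R ⊗ N) ⊗_R (R ⊗ N')`. -/
def tensorComparison (N N' : Obj D) (R : Type w) [CommRing R] [Algebra B R] :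
    R ⊗[B] (N.tensor N') ≃ₗ[R] (R ⊗[B] N) ⊗[R] (R ⊗[B] N') :=
  AlgebraTensorModule.distribBaseChange B R N N'

/-- `R ⊗ F_∂(N) → F_∂(R ⊗ N)`. -/
def prolComparison (N : Obj D) (R : Type w) [CommRing R] [Algebra B R] (dR : Derivation ℤ R R)
    (hd : ∀ b, dR (algebraMap B R b) = algebraMap B R (D.der b)) :
    R ⊗[B] N.prol →ₗ[R] Prol dR (R ⊗[B] N) :=
  Prol.comparison D.der dR hd

/-- The families of `R`-linear automorphisms of the `R ⊗ η(N)`, for `N` in `C`. -/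
abbrev AutFamily (C : Obj D → Prop) (R : Type w) [CommRing R] [Algebra B R] :=
  ∀ N : {N : Obj D // C N}, (R ⊗[B] N.1) ≃ₗ[R] (R ⊗[B] N.1)

/-- `Aut^⊗(η|_C)(R)`: the tensor automorphisms of the forgetful functor `N ↦ R ⊗ N` on `C`. -/
def TensorAut (C : Obj D → Prop) (R : Type w) [CommRing R] [Algebra B R] :
    Subgroup (AutFamily C R) where
  carrier := {g |
    (∀ (N N' : Obj D) (hN : C N) (hN' : C N') (f : N →ₗ[B] N'), Obj.IsHom N N' f →
      ∀ t, f.baseChange R (g ⟨N, hN⟩ t) = g ⟨N', hN'⟩ (f.baseChange R t)) ∧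
    (∀ (h : C (Obj.unit D)) t, g ⟨Obj.unit D, h⟩ t = t) ∧
    (∀ (N N' : Obj D) (hN : C N) (hN' : C N') (h : C (N.tensor N')) (t : R ⊗[B] (N.tensor N')),
      tensorComparison N N' R (g ⟨N.tensor N', h⟩ t) =
        TensorProduct.congr (g ⟨N, hN⟩) (g ⟨N', hN'⟩) (tensorComparison N N' R t))}
  one_mem' := by
    refine ⟨fun _ _ _ _ _ _ _ => rfl, fun _ _ => rfl, fun N N' _ _ _ t => ?_⟩
    change _ = TensorProduct.congr (LinearEquiv.refl R _) (LinearEquiv.refl R _) _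
    rw [TensorProduct.congr_refl_refl]
    rfl
  mul_mem' := by
    rintro a b ⟨ha1, ha2, ha3⟩ ⟨hb1, hb2, hb3⟩
    refine ⟨fun N N' hN hN' f hf t => ?_, fun h t => ?_, fun N N' hN hN' h t => ?_⟩
    · change f.baseChange R (a ⟨N, hN⟩ (b ⟨N, hN⟩ t)) =
        a ⟨N', hN'⟩ (b ⟨N', hN'⟩ (f.baseChange R t))
      rw [ha1 N N' hN hN' f hf, hb1 N N' hN hN' f hf]
    · change a ⟨_, h⟩ (b ⟨_, h⟩ t) = t
      rw [hb2, ha2]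
    · change tensorComparison N N' R (a ⟨_, h⟩ (b ⟨_, h⟩ t)) =
        TensorProduct.congr (b ⟨N, hN⟩ ≪≫ₗ a ⟨N, hN⟩) (b ⟨N', hN'⟩ ≪≫ₗ a ⟨N', hN'⟩) _
      rw [ha3 N N' hN hN' h, hb3 N N' hN hN' h, TensorProduct.congr_trans]
      rfl
  inv_mem' := by
    rintro a ⟨ha1, ha2, ha3⟩
    refine ⟨fun N N' hN hN' f hf t => ?_, fun h t => ?_, fun N N' hN hN' h t => ?_⟩
    · change f.baseChange R ((a ⟨N, hN⟩).symm t) = (a ⟨N', hN'⟩).symm (f.baseChange R t)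
      rw [LinearEquiv.eq_symm_apply, ← ha1 N N' hN hN' f hf, LinearEquiv.apply_symm_apply]
    · change (a ⟨_, h⟩).symm t = t
      rw [LinearEquiv.symm_apply_eq, ha2]
    · change tensorComparison N N' R ((a ⟨_, h⟩).symm t) =
        TensorProduct.congr (a ⟨N, hN⟩).symm (a ⟨N', hN'⟩).symm _
      rw [← TensorProduct.congr_symm, LinearEquiv.eq_symm_apply, ← ha3 N N' hN hN' h,
        LinearEquiv.apply_symm_apply]

/-- `Aut^{⊗,∂}(η|_C)(R)` for a differential `B`-algebra `(R, ∂)`: the tensor automorphisms `g` with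
`g_{F_∂(N)} = F_∂(g_N)` for all `N`. -/
def DiffTensorAut (C : Obj D → Prop) (R : Type w) [CommRing R] [Algebra B R]
    (dR : Derivation ℤ R R) (hd : ∀ b, dR (algebraMap B R b) = algebraMap B R (D.der b)) :
    Subgroup (AutFamily C R) :=
  TensorAut C R ⊓
  { carrier := {g | ∀ (N : Obj D) (hN : C N) (h : C N.prol) (t : R ⊗[B] N.prol),
      prolComparison N R dR hd (g ⟨N.prol, h⟩ t) =
        Prol.map dR (g ⟨N, hN⟩).toLinearMap (prolComparison N R dR hd t)}
    one_mem' := fun _ _ _ _ => rfl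
    mul_mem' := by
      intro a b ha hb N hN h t
      change prolComparison N R dR hd (a ⟨N.prol, h⟩ (b ⟨N.prol, h⟩ t)) =
        Prol.map dR (a ⟨N, hN⟩).toLinearMap (Prol.map dR (b ⟨N, hN⟩).toLinearMap _)
      rw [ha N hN h, hb N hN h]
    inv_mem' := by
      intro a ha N hN h t
      have key := ha N hN h ((a ⟨N.prol, h⟩).symm t)
      rw [LinearEquiv.apply_symm_apply] at key
      rw [key]
      refine Prod.ext ?_ ?_
      · exact ((a ⟨N, hN⟩).symm_apply_apply _).symm
      · exact ((a ⟨N, hN⟩).symm_apply_apply _).symm }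

/-- The generic Galois group `Gal(M, η_B)`, through its group of `R`-points. -/
abbrev Gal (M : Obj D) (R : Type w) [CommRing R] [Algebra B R] : Subgroup (AutFamily (Gen M) R) :=
  TensorAut (Gen M) R

/-- The parameterized generic Galois group `Gal^∂(M, η_B)`, through its group of `R`-points for a
differential `B`-algebra `R`. -/
abbrev GalDiff (M : Obj D) (R : Type w) [CommRing R] [Algebra B R]
    (dR : Derivation ℤ R R) (hd : ∀ b, dR (algebraMap B R b) = algebraMap B R (D.der b)) :
    Subgroup (AutFamily (GenDiff M) R) :=
  DiffTensorAut (GenDiff M) R dR hd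

/-- The family `g'` over `R'` is the image of the family `g` over `R` under `f : R → R'`. -/
def IsImage {C : Obj D → Prop} {R R' : Type w} [CommRing R] [Algebra B R] [CommRing R']
    [Algebra B R'] (f : R →ₐ[B] R') (g : AutFamily C R) (g' : AutFamily C R') : Prop :=
  ∀ (N : Obj D) (hN : C N) (t : R ⊗[B] N),
    g' ⟨N, hN⟩ (f.toLinearMap.rTensor N t) = f.toLinearMap.rTensor N (g ⟨N, hN⟩ t)

end Generated

/-! ### Localization of Galois groups -/

section Localization

variable {B : Type u} [CommRing B] {D : GenDiffRing B}
variable {F : Type u} [CommRing F] [Algebra B F] {E : GenDiffRing F}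

/-- `Gal(M, η_B) ⊗ F ≃ Gal(M_F, η_F)`: an isomorphism of group-valued functors on the category of
`F`-algebras, which is the canonical identification `R ⊗_F (F ⊗_B M) = R ⊗_B M` on the action on
the module `M`. The base change to `F` of a group functor over `B` is its restriction to
`F`-algebras. -/
def GalLoc (hDE : D.IsMor E) (M : Obj D) : Prop :=
  ∃ e : ∀ (R : Type w) [CommRing R] [Algebra B R] [Algebra F R] [IsScalarTower B F R],
      Gal M R ≃* Gal (M.baseChange hDE) R,
    (∀ (R R' : Type w) [CommRing R] [Algebra B R] [Algebra F R] [IsScalarTower B F R]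
      [CommRing R'] [Algebra B R'] [Algebra F R'] [IsScalarTower B F R']
      (f : R →ₐ[F] R') (g : Gal M R) (g' : Gal M R'),
      IsImage (f.restrictScalars B) g.1 g'.1 → IsImage f (e R g).1 (e R' g').1) ∧
    ∀ (R : Type w) [CommRing R] [Algebra B R] [Algebra F R] [IsScalarTower B F R]
      (g : Gal M R) (t : R ⊗[F] (F ⊗[B] M)),
      AlgebraTensorModule.cancelBaseChange B F R R M
          ((e R g).1 ⟨M.baseChange hDE, Gen.self _⟩ t) =
        g.1 ⟨M, Gen.self M⟩ (AlgebraTensorModule.cancelBaseChange B F R R M t)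

theorem der_compat (hDE : D.IsMor E) {R : Type w} [CommRing R] [Algebra B R] [Algebra F R]
    [IsScalarTower B F R] {dR : Derivation ℤ R R}
    (hd : ∀ c, dR (algebraMap F R c) = algebraMap F R (E.der c)) (b : B) :
    dR (algebraMap B R b) = algebraMap B R (D.der b) := by
  rw [IsScalarTower.algebraMap_apply B F R, hd, ← hDE.der, ← IsScalarTower.algebraMap_apply]

/-- `Gal^∂(M, η_B) ⊗ F ≃ Gal^∂(M_F, η_F)`: an isomorphism of group-valued functors on the category
of differential `F`-algebras, which is the canonical identification `R ⊗_F (F ⊗_B M) = R ⊗_B M` on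
the action on the module `M`. -/
def GalDiffLoc (hDE : D.IsMor E) (M : Obj D) : Prop :=
  ∃ e : ∀ (R : Type w) [CommRing R] [Algebra B R] [Algebra F R] [IsScalarTower B F R]
      (dR : Derivation ℤ R R) (hd : ∀ c, dR (algebraMap F R c) = algebraMap F R (E.der c)),
      GalDiff M R dR (der_compat hDE hd) ≃* GalDiff (M.baseChange hDE) R dR hd,
    (∀ (R R' : Type w) [CommRing R] [Algebra B R] [Algebra F R] [IsScalarTower B F R]
      [CommRing R'] [Algebra B R'] [Algebra F R'] [IsScalarTower B F R']
      (dR : Derivation ℤ R R) (hd : ∀ c, dR (algebraMap F R c) = algebraMap F R (E.der c))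
      (dR' : Derivation ℤ R' R') (hd' : ∀ c, dR' (algebraMap F R' c) = algebraMap F R' (E.der c))
      (f : R →ₐ[F] R') (_ : ∀ r, f (dR r) = dR' (f r))
      (g : GalDiff M R dR (der_compat hDE hd)) (g' : GalDiff M R' dR' (der_compat hDE hd')),
      IsImage (f.restrictScalars B) g.1 g'.1 → IsImage f (e R dR hd g).1 (e R' dR' hd' g').1) ∧
    ∀ (R : Type w) [CommRing R] [Algebra B R] [Algebra F R] [IsScalarTower B F R]
      (dR : Derivation ℤ R R) (hd : ∀ c, dR (algebraMap F R c) = algebraMap F R (E.der c))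
      (g : GalDiff M R dR (der_compat hDE hd)) (t : R ⊗[F] (F ⊗[B] M)),
      AlgebraTensorModule.cancelBaseChange B F R R M
          ((e R dR hd g).1 ⟨M.baseChange hDE, GenDiff.self _⟩ t) =
        g.1 ⟨M, GenDiff.self M⟩ (AlgebraTensorModule.cancelBaseChange B F R R M t)

end Localization

/-! ### The operators `σ_q`, `δ_q` and `x d/dx` on localizations of `O[x]` -/

section Operators

variable {O : Type u} [CommRing O]

/-- `p(x) ↦ p(q x)`. -/
def shift (q : O) : O[X] →+* O[X] := Polynomial.compRingHom (C q * X)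

theorem shift_C (q a : O) : shift q (C a) = C a := by simp [shift]

theorem shift_X (q : O) : shift q X = C q * X := by simp [shift]

/-- A submonoid of `O[x]` that is stable under `σ_q`. -/
def IsStable (q : O) (S : Submonoid O[X]) : Prop := S ≤ S.comap (shift q)

theorem shift_one : shift (1 : O) = RingHom.id O[X] := by
  ext <;> simp [shift_C, shift_X]

theorem isStable_one (S : Submonoid O[X]) : IsStable 1 S := by
  intro s hs
  rw [Submonoid.mem_comap, shift_one]
  exact hs

variable (q : O) (S : Submonoid O[X]) (hS : IsStable q S)
variable (L : Type v) [CommRing L] [Algebra O[X] L] [IsLocalization S L]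

/-- `σ_q : f(x) ↦ f(q x)` on the localization `L` of `O[x]`. -/
def sigQ : L →+* L := IsLocalization.map (M := S) (T := S) L (shift q) hS

theorem sigQ_algebraMap (p : O[X]) :
    sigQ q S hS L (algebraMap O[X] L p) = algebraMap O[X] L (shift q p) :=
  IsLocalization.map_eq hS p

/-- The ring homomorphism `f ↦ f + δ_q(f) ω`, `ω² = (q - 1) ω`, on `O[x]`; it maps `x` to
`x + x ω`. -/
def delHomPoly : O[X] →+* QuadraticAlgebra L 0 (algebraMap O[X] L (C (q - 1))) :=
  Polynomial.eval₂RingHom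
    ((algebraMap L (QuadraticAlgebra L 0 (algebraMap O[X] L (C (q - 1))))).comp
      ((algebraMap O[X] L).comp C))
    ⟨algebraMap O[X] L X, algebraMap O[X] L X⟩

/-- The evaluation `ω ↦ 0`. -/
def evalZero (h : L) : QuadraticAlgebra L 0 h →+* L where
  toFun z := z.re
  map_zero' := rfl
  map_one' := rfl
  map_add' _ _ := rfl
  map_mul' x y := by simp

/-- The evaluation `ω ↦ h`. -/
def evalH (h : L) : QuadraticAlgebra L 0 h →+* L where
  toFun z := z.re + h * z.im
  map_zero' := by simp
  map_one' := by change (1 : L) + h * 0 = 1; simp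
  map_add' x y := by simp; ring
  map_mul' x y := by simp; ring

theorem evalZero_delHomPoly (p : O[X]) : (delHomPoly q L p).re = algebraMap O[X] L p := by
  have : (evalZero L _).comp (delHomPoly q L) = algebraMap O[X] L := by
    ext a
    · simp [delHomPoly, evalZero, QuadraticAlgebra.algebraMap_re]
    · simp [delHomPoly, evalZero]
  exact RingHom.congr_fun this p

theorem evalH_delHomPoly (p : O[X]) :
    (delHomPoly q L p).re + algebraMap O[X] L (C (q - 1)) * (delHomPoly q L p).im =
      algebraMap O[X] L (shift q p) := by
  have : (evalH L _).comp (delHomPoly q L) = (algebraMap O[X] L).comp (shift q) := by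
    ext a
    · simp [delHomPoly, evalH, shift_C]
    · simp [delHomPoly, evalH, shift_X]
      ring
  exact RingHom.congr_fun this p

theorem isUnit_delHomPoly (hq : IsStable q S) (s : S) : IsUnit (delHomPoly q L s) := by
  rw [QuadraticAlgebra.isUnit_iff_norm_isUnit]
  have h : (delHomPoly q L s).norm =
      algebraMap O[X] L s * algebraMap O[X] L (shift q s) := by
    rw [← evalH_delHomPoly, QuadraticAlgebra.norm_def, evalZero_delHomPoly]
    ring
  rw [h]
  exact (IsLocalization.map_units L s).mul (IsLocalization.map_units L (⟨_, hq s.2⟩ : S))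

/-- The ring homomorphism `f ↦ f + δ_q(f) ω`, `ω² = (q - 1) ω`, on `L`. -/
def delHom : L →+* QuadraticAlgebra L 0 (algebraMap O[X] L (C (q - 1))) :=
  IsLocalization.lift (M := S) (isUnit_delHomPoly q S L hS)

theorem re_delHom (f : L) : (delHom q S hS L f).re = f := by
  have : (evalZero L _).comp (delHom q S hS L) = RingHom.id L := by
    refine IsLocalization.ringHom_ext S ?_
    refine RingHom.ext fun p => ?_
    simp [delHom, evalZero, evalZero_delHomPoly]
  exact RingHom.congr_fun this f

/-- The operator `δ_q` on `L`: the additive map that vanishes on `O`, maps `x` to `x` and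
satisfies `δ_q(f g) = δ_q(f) g + σ_q(f) δ_q(g)`, so that `(q - 1) δ_q = σ_q - 1`. For `q = 1` it is
the derivation `x d/dx`. -/
def delQ : L →+ L where
  toFun f := (delHom q S hS L f).im
  map_zero' := by simp
  map_add' _ _ := by simp

theorem sigQ_eq (f : L) :
    sigQ q S hS L f = f + algebraMap O[X] L (C (q - 1)) * delQ q S hS L f := by
  have : (evalH L _).comp (delHom q S hS L) = sigQ q S hS L := by
    refine IsLocalization.ringHom_ext S ?_
    refine RingHom.ext fun p => ?_
    rw [RingHom.comp_apply, RingHom.comp_apply, RingHom.comp_apply, sigQ_algebraMap,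
      ← evalH_delHomPoly, delHom, IsLocalization.lift_eq]
    rfl
  rw [← this]
  change (delHom q S hS L f).re + _ = _
  rw [re_delHom]
  rfl

theorem delQ_mul (f g : L) :
    delQ q S hS L (f * g) = delQ q S hS L f * g + sigQ q S hS L f * delQ q S hS L g := by
  rw [sigQ_eq]
  change (delHom q S hS L (f * g)).im = _
  rw [map_mul, QuadraticAlgebra.im_mul, re_delHom, re_delHom]
  change f * delQ q S hS L g + delQ q S hS L f * g + _ * delQ q S hS L f * delQ q S hS L g = _
  ring

theorem delQ_C (a : O) : delQ q S hS L (algebraMap O[X] L (C a)) = 0 := by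
  change (delHom q S hS L (algebraMap O[X] L (C a))).im = 0
  simp [delHom, delHomPoly]

theorem delQ_X : delQ q S hS L (algebraMap O[X] L X) = algebraMap O[X] L X := by
  change (delHom q S hS L (algebraMap O[X] L X)).im = _
  simp [delHom, delHomPoly]

/-- The derivation `∂ = x d/dx` on `L`. -/
def derQ : Derivation ℤ L L :=
  Derivation.mk' (delQ 1 S (isStable_one S) L).toIntLinearMap (fun a b => by
    have h := delQ_mul 1 S (isStable_one S) L a b
    rw [sigQ_eq] at h
    simp only [sub_self, map_zero, zero_mul, add_zero] at h
    simp only [AddMonoidHom.coe_toIntLinearMap, smul_eq_mul, h]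
    ring)

theorem derQ_apply (f : L) : derQ S L f = delQ 1 S (isStable_one S) L f := rfl

theorem derQ_mul (a b : L) : derQ S L (a * b) = derQ S L a * b + a * derQ S L b := by
  rw [Derivation.leibniz, smul_eq_mul, smul_eq_mul]
  ring

theorem derQ_C (a : O) : derQ S L (algebraMap O[X] L (C a)) = 0 :=
  delQ_C 1 S (isStable_one S) L a

theorem derQ_X : derQ S L (algebraMap O[X] L X) = algebraMap O[X] L X :=
  delQ_X 1 S (isStable_one S) L

theorem derQ_algebraMap (p : O[X]) :
    derQ S L (algebraMap O[X] L p) = algebraMap O[X] L (X * derivative p) := by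
  induction p using Polynomial.induction_on' with
  | add p r hp hr => simp only [map_add, hp, hr, mul_add]
  | monomial n a =>
    rw [← C_mul_X_pow_eq_monomial, map_mul, map_pow, Derivation.leibniz, Derivation.leibniz_pow,
      derQ_apply, derQ_apply, delQ_C, delQ_X]
    simp only [derivative_C_mul, derivative_X_pow, map_mul, map_pow, smul_eq_mul, mul_zero,
      add_zero, nsmul_eq_mul, map_natCast]
    rcases n with _ | n
    · simp
    · simp; ring

/-- An additive map out of `L` that satisfies a twisted Leibniz rule and vanishes on `O` and at
`x` is zero. -/
theorem vanish {L' : Type w} [CommRing L'] (g s : L →+* L') (f : L →+ L')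
    (hmul : ∀ a b, f (a * b) = f a * g b + s a * f b)
    (hs : ∀ t : S, IsUnit (s (algebraMap O[X] L t)))
    (hC : ∀ a, f (algebraMap O[X] L (C a)) = 0) (hX : f (algebraMap O[X] L X) = 0) (z : L) :
    f z = 0 := by
  have hp : ∀ p : O[X], f (algebraMap O[X] L p) = 0 := by
    intro p
    induction p using Polynomial.induction_on' with
    | add p r hp hr => simp [hp, hr]
    | monomial n a =>
      rw [← C_mul_X_pow_eq_monomial]
      have hpow : ∀ n : ℕ, f (algebraMap O[X] L (X ^ n)) = 0 := by
        intro n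
        induction n with
        | zero => simpa using hC 1
        | succ n ih => rw [pow_succ, map_mul, hmul, ih, hX]; simp
      rw [map_mul, hmul, hC, hpow]; simp
  obtain ⟨p, t, rfl⟩ := IsLocalization.exists_mk'_eq S z
  have h := hmul (algebraMap O[X] L t) (IsLocalization.mk' L p t)
  rw [mul_comm, IsLocalization.mk'_spec, hp, hp, zero_mul, zero_add] at h
  exact ((hs t).mul_right_eq_zero).1 h.symm

theorem der_sigQ (f : L) : derQ S L (sigQ q S hS L f) = sigQ q S hS L (derQ S L f) := by
  have key := vanish S L (sigQ q S hS L) (sigQ q S hS L)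
    ((derQ S L).toLinearMap.toAddMonoidHom.comp (sigQ q S hS L).toAddMonoidHom -
      (sigQ q S hS L).toAddMonoidHom.comp (derQ S L).toLinearMap.toAddMonoidHom)
    (fun a b => by simp; ring)
    (fun t => by
      rw [sigQ_algebraMap]
      exact IsLocalization.map_units L (⟨_, hS t.2⟩ : S))
    (fun a => by
      simp [sigQ_algebraMap, shift_C, derQ_C])
    (by
      simp [sigQ_algebraMap, shift_X, derQ_C, derQ_X])
    f
  exact sub_eq_zero.1 key

theorem der_delQ (f : L) : derQ S L (delQ q S hS L f) = delQ q S hS L (derQ S L f) := by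
  have key := vanish S L (RingHom.id L) (sigQ q S hS L)
    ((derQ S L).toLinearMap.toAddMonoidHom.comp (delQ q S hS L) -
      (delQ q S hS L).comp (derQ S L).toLinearMap.toAddMonoidHom)
    (fun a b => by
      simp [delQ_mul, derQ_mul, der_sigQ, -Derivation.leibniz]; ring)
    (fun t => by
      rw [sigQ_algebraMap]
      exact IsLocalization.map_units L (⟨_, hS t.2⟩ : S))
    (fun a => by simp [derQ_C, delQ_C])
    (by simp [derQ_X, delQ_X])
    f
  exact sub_eq_zero.1 key

/-- The `q`-difference ring `(L, σ_q)`, with `∂ = x d/dx`. -/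
def qDiffRing : GenDiffRing L := GenDiffRing.ofSig (sigQ q S hS L) (derQ S L) (der_sigQ q S hS L)

/-- The generalized differential ring `(L, δ_q)`, with `∂ = x d/dx`. For `q = 1` it is the
differential ring `(L, x d/dx)`. -/
def qConnRing : GenDiffRing L where
  sig := sigQ q S hS L
  del := delQ q S hS L
  h := algebraMap O[X] L (C (q - 1))
  der := derQ S L
  sig_eq := sigQ_eq q S hS L
  del_mul := delQ_mul q S hS L
  der_sig := der_sigQ q S hS L
  der_del := der_delQ q S hS L
  der_h := by rw [derQ_apply, delQ_C]

section Functoriality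

variable {O' : Type u} [CommRing O'] (φ : O →+* O') (S' : Submonoid O'[X])
variable (hS' : IsStable (φ q) S')
variable (L' : Type w) [CommRing L'] [Algebra O'[X] L'] [IsLocalization S' L']
variable (hφ : S ≤ S'.comap (Polynomial.mapRingHom φ))

/-- The ring homomorphism between localizations of `O[x]` and `O'[x]` induced by `φ : O → O'`. -/
def locMap : L →+* L' := IsLocalization.map (M := S) (T := S') L' (Polynomial.mapRingHom φ) hφ

theorem locMap_algebraMap (p : O[X]) :
    locMap S L φ S' L' hφ (algebraMap O[X] L p) = algebraMap O'[X] L' (p.map φ) :=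
  IsLocalization.map_eq hφ p

theorem locMap_sigQ (f : L) :
    locMap S L φ S' L' hφ (sigQ q S hS L f) = sigQ (φ q) S' hS' L' (locMap S L φ S' L' hφ f) := by
  have : (locMap S L φ S' L' hφ).comp (sigQ q S hS L) =
      (sigQ (φ q) S' hS' L').comp (locMap S L φ S' L' hφ) := by
    refine IsLocalization.ringHom_ext S ?_
    ext <;> simp [sigQ_algebraMap, locMap_algebraMap, shift_C, shift_X]
  exact RingHom.congr_fun this f

theorem locMap_delQ (f : L) :
    locMap S L φ S' L' hφ (delQ q S hS L f) = delQ (φ q) S' hS' L' (locMap S L φ S' L' hφ f) := by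
  have key := vanish S L (locMap S L φ S' L' hφ)
    ((locMap S L φ S' L' hφ).comp (sigQ q S hS L))
    ((locMap S L φ S' L' hφ).toAddMonoidHom.comp (delQ q S hS L) -
      (delQ (φ q) S' hS' L').comp (locMap S L φ S' L' hφ).toAddMonoidHom)
    (fun a b => by
      simp [delQ_mul, locMap_sigQ q S hS L φ S' hS' L' hφ]; ring)
    (fun t => by
      rw [RingHom.comp_apply, sigQ_algebraMap, locMap_algebraMap]
      exact IsLocalization.map_units L' (⟨_, hφ (hS t.2)⟩ : S'))
    (fun a => by simp [locMap_algebraMap, delQ_C])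
    (by simp [locMap_algebraMap, delQ_X])
    f
  exact sub_eq_zero.1 key

theorem locMap_derQ (f : L) :
    locMap S L φ S' L' hφ (derQ S L f) = derQ S' L' (locMap S L φ S' L' hφ f) := by
  have key := vanish S L (locMap S L φ S' L' hφ) (locMap S L φ S' L' hφ)
    ((locMap S L φ S' L' hφ).toAddMonoidHom.comp (derQ S L).toLinearMap.toAddMonoidHom -
      (derQ S' L').toLinearMap.toAddMonoidHom.comp (locMap S L φ S' L' hφ).toAddMonoidHom)
    (fun a b => by simp; ring)
    (fun t => by
      rw [locMap_algebraMap]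
      exact IsLocalization.map_units L' (⟨_, hφ t.2⟩ : S'))
    (fun a => by simp [locMap_algebraMap, derQ_C])
    (by simp [locMap_algebraMap, derQ_X])
    f
  exact sub_eq_zero.1 key

theorem qDiffRing_isMor :
    letI := (locMap S L φ S' L' hφ).toAlgebra
    (qDiffRing q S hS L).IsMor (qDiffRing (φ q) S' hS' L') := by
  let _ := (locMap S L φ S' L' hφ).toAlgebra
  refine ⟨locMap_sigQ q S hS L φ S' hS' L' hφ, fun f => ?_, map_one _,
    locMap_derQ S L φ S' L' hφ⟩
  change locMap S L φ S' L' hφ (sigQ q S hS L f - f) =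
    sigQ (φ q) S' hS' L' (locMap S L φ S' L' hφ f) - locMap S L φ S' L' hφ f
  rw [map_sub, locMap_sigQ q S hS L φ S' hS' L' hφ]

theorem qConnRing_isMor :
    letI := (locMap S L φ S' L' hφ).toAlgebra
    (qConnRing q S hS L).IsMor (qConnRing (φ q) S' hS' L') := by
  let _ := (locMap S L φ S' L' hφ).toAlgebra
  refine ⟨locMap_sigQ q S hS L φ S' hS' L' hφ, locMap_delQ q S hS L φ S' hS' L' hφ, ?_,
    locMap_derQ S L φ S' L' hφ⟩
  change locMap S L φ S' L' hφ (algebraMap O[X] L (C (q - 1))) =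
    algebraMap O'[X] L' (C (φ q - 1))
  rw [locMap_algebraMap]
  simp

end Functoriality

end Operators

/-! ### The algebras `O[x, 1/P(x), 1/P(qx), …]` and their fraction fields -/

section Algebras

variable {O : Type u} [CommRing O]

/-- The multiplicative set generated by the polynomials `P(x), P(qx), P(q²x), …`. -/
def denoms (q : O) (P : O[X]) : Submonoid O[X] :=
  Submonoid.closure (Set.range fun i : ℕ => shift (q ^ i) P)

theorem shift_shift (q r : O) (p : O[X]) : shift q (shift r p) = shift (q * r) p := by
  have : (shift q).comp (shift r) = shift (q * r) := by
    ext
    · simp [shift_C]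
    · simp [shift_C, shift_X, mul_assoc, mul_left_comm]
  exact RingHom.congr_fun this p

theorem isStable_denoms (q : O) (P : O[X]) : IsStable q (denoms q P) := by
  refine (Submonoid.closure_le).2 ?_
  rintro _ ⟨i, rfl⟩
  refine Submonoid.subset_closure ⟨i + 1, ?_⟩
  simp only [shift_shift, pow_succ']

/-- The algebra `O[x, 1/P(x), 1/P(qx), …]`. -/
def QAlg (q : O) (P : O[X]) : Type u := Localization (denoms q P)

namespace QAlg

variable (q : O) (P : O[X])

instance : CommRing (QAlg q P) := inferInstanceAs (CommRing (Localization (denoms q P)))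

instance : Algebra O[X] (QAlg q P) := inferInstanceAs (Algebra O[X] (Localization (denoms q P)))

instance : IsLocalization (denoms q P) (QAlg q P) :=
  inferInstanceAs (IsLocalization (denoms q P) (Localization (denoms q P)))

/-- `σ_q` on `O[x, 1/P(x), 1/P(qx), …]`. -/
def sig : QAlg q P →+* QAlg q P := sigQ q (denoms q P) (isStable_denoms q P) (QAlg q P)

/-- The `q`-difference algebra `(O[x, 1/P(x), 1/P(qx), …], σ_q)`, with `∂ = x d/dx`. -/
def diffRing : GenDiffRing (QAlg q P) := qDiffRing q (denoms q P) (isStable_denoms q P) (QAlg q P)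

/-- The generalized differential ring `(O[x, 1/P(x), 1/P(qx), …], δ_q)`, with `∂ = x d/dx`. -/
def connRing : GenDiffRing (QAlg q P) := qConnRing q (denoms q P) (isStable_denoms q P) (QAlg q P)

/-- The `q`-difference module `(M, Σ)` over `O[x, 1/P(x), 1/P(qx), …]`. -/
def ofSemilinear (M : Type u) [AddCommGroup M] [Module (QAlg q P) M] [Module.Finite (QAlg q P) M]
    [Module.Projective (QAlg q P) M] (S : M →ₛₗ[sig q P] M)
    (hS : Submodule.span (QAlg q P) (Set.range S) = ⊤) : Obj (diffRing q P) :=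
  Obj.ofSemilinear (sig q P) (derQ (denoms q P) (QAlg q P))
    (der_sigQ q (denoms q P) (isStable_denoms q P) (QAlg q P)) M S hS

end QAlg

/-! #### Specialization -/

section Specialization

variable {O' : Type u} [CommRing O'] (φ : O →+* O') (q : O) (P : O[X])

theorem map_shift (p : O[X]) : (shift q p).map φ = shift (φ q) (p.map φ) := by
  have : (Polynomial.mapRingHom φ).comp (shift q) = (shift (φ q)).comp (Polynomial.mapRingHom φ) := by
    ext <;> simp [shift_C, shift_X]
  exact RingHom.congr_fun this p

theorem map_denoms : (denoms q P).map (Polynomial.mapRingHom φ) = denoms (φ q) (P.map φ) := by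
  rw [denoms, denoms, MonoidHom.map_mclosure, ← Set.range_comp]
  congr 2
  ext1 i
  simp [map_shift]

theorem denoms_le_comap :
    denoms q P ≤ (denoms (φ q) (P.map φ)).comap (Polynomial.mapRingHom φ) := by
  rw [← Submonoid.map_le_iff_le_comap, map_denoms]

/-- The canonical map from `A = O[x, 1/P(x), 1/P(qx), …]` to the corresponding algebra over `O'`,
which is `A ⊗_O O'`. -/
def specMap : QAlg q P →+* QAlg (φ q) (P.map φ) :=
  locMap (denoms q P) (QAlg q P) φ (denoms (φ q) (P.map φ)) (QAlg (φ q) (P.map φ))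
    (denoms_le_comap φ q P)

/-- The specialization `M ⊗_A A_v` of a module with connection over `(A, σ_q)`. -/
def specDiff (M : Obj (QAlg.diffRing q P)) : Obj (QAlg.diffRing (φ q) (P.map φ)) :=
  letI := (specMap φ q P).toAlgebra
  M.baseChange (qDiffRing_isMor q (denoms q P) (isStable_denoms q P) (QAlg q P) φ
    (denoms (φ q) (P.map φ)) (isStable_denoms (φ q) (P.map φ)) (QAlg (φ q) (P.map φ))
    (denoms_le_comap φ q P))

/-- The specialization `M ⊗_A A_v` of a module with connection over `(A, δ_q)`. -/
def specConn (M : Obj (QAlg.connRing q P)) : Obj (QAlg.connRing (φ q) (P.map φ)) :=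
  letI := (specMap φ q P).toAlgebra
  M.baseChange (qConnRing_isMor q (denoms q P) (isStable_denoms q P) (QAlg q P) φ
    (denoms (φ q) (P.map φ)) (isStable_denoms (φ q) (P.map φ)) (QAlg (φ q) (P.map φ))
    (denoms_le_comap φ q P))

/-- `specMap` identifies the algebra over `O'` with `O' ⊗_O A`. -/
theorem specMap_isPushout :
    letI := φ.toAlgebra
    letI := (specMap φ q P).toAlgebra
    letI : Algebra O (QAlg q P) := ((algebraMap O[X] (QAlg q P)).comp C).toAlgebra
    letI : Algebra O' (QAlg (φ q) (P.map φ)) :=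
      ((algebraMap O'[X] (QAlg (φ q) (P.map φ))).comp C).toAlgebra
    letI : Algebra O (QAlg (φ q) (P.map φ)) :=
      (((algebraMap O'[X] (QAlg (φ q) (P.map φ))).comp C).comp φ).toAlgebra
    ∃ (_ : IsScalarTower O O' (QAlg (φ q) (P.map φ)))
      (_ : IsScalarTower O (QAlg q P) (QAlg (φ q) (P.map φ))),
      Algebra.IsPushout O O' (QAlg q P) (QAlg (φ q) (P.map φ)) := by
  let _ := φ.toAlgebra
  let _ := (specMap φ q P).toAlgebra
  let _ : Algebra O (QAlg q P) := ((algebraMap O[X] (QAlg q P)).comp C).toAlgebra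
  let _ : Algebra O' (QAlg (φ q) (P.map φ)) :=
    ((algebraMap O'[X] (QAlg (φ q) (P.map φ))).comp C).toAlgebra
  let _ : Algebra O (QAlg (φ q) (P.map φ)) :=
    (((algebraMap O'[X] (QAlg (φ q) (P.map φ))).comp C).comp φ).toAlgebra
  let _ : Algebra O[X] O'[X] := (Polynomial.mapRingHom φ).toAlgebra
  let _ : Algebra O[X] (QAlg (φ q) (P.map φ)) :=
    ((algebraMap O'[X] (QAlg (φ q) (P.map φ))).comp (Polynomial.mapRingHom φ)).toAlgebra
  have h1 : IsScalarTower O O' (QAlg (φ q) (P.map φ)) := .of_algebraMap_eq fun _ => rfl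
  have hl : ∀ p : O[X], specMap φ q P (algebraMap O[X] (QAlg q P) p) =
      algebraMap O'[X] (QAlg (φ q) (P.map φ)) (p.map φ) := fun p => locMap_algebraMap _ _ _ _ _ _ p
  have h2 : IsScalarTower O (QAlg q P) (QAlg (φ q) (P.map φ)) := .of_algebraMap_eq fun a => by
    change _ = specMap φ q P (algebraMap O[X] (QAlg q P) (C a))
    rw [hl, Polynomial.map_C]
    rfl
  have h3 : IsScalarTower O O[X] (QAlg q P) := .of_algebraMap_eq fun _ => rfl
  have h4 : IsScalarTower O' O'[X] (QAlg (φ q) (P.map φ)) := .of_algebraMap_eq fun _ => rfl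
  have h5 : IsScalarTower O[X] O'[X] (QAlg (φ q) (P.map φ)) := .of_algebraMap_eq fun _ => rfl
  have h6 : IsScalarTower O[X] (QAlg q P) (QAlg (φ q) (P.map φ)) :=
    .of_algebraMap_eq fun p => (hl p).symm
  have h7 : IsScalarTower O O[X] O'[X] := .of_algebraMap_eq fun a => (Polynomial.map_C φ).symm
  have h8 : IsScalarTower O O[X] (QAlg (φ q) (P.map φ)) := .of_algebraMap_eq fun a => by
    change _ = algebraMap O'[X] (QAlg (φ q) (P.map φ)) ((C a).map φ)
    rw [Polynomial.map_C]
    rfl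
  have h9 : IsScalarTower O O' O'[X] := inferInstance
  have h10 : IsScalarTower O O'[X] (QAlg (φ q) (P.map φ)) := .of_algebraMap_eq fun _ => rfl
  have hloc : IsLocalization (Algebra.algebraMapSubmonoid O'[X] (denoms q P))
      (QAlg (φ q) (P.map φ)) := by
    have : Algebra.algebraMapSubmonoid O'[X] (denoms q P) = denoms (φ q) (P.map φ) :=
      map_denoms φ q P
    rw [this]
    infer_instance
  have p2 : Algebra.IsPushout O[X] O'[X] (QAlg q P) (QAlg (φ q) (P.map φ)) :=
    (Algebra.isLocalization_iff_isPushout (denoms q P) (QAlg q P)).1 hloc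
  have p1 : Algebra.IsPushout O O' O[X] O'[X] := inferInstance
  refine ⟨h1, h2, ?_⟩
  have := (Algebra.IsPushout.comp_iff O O[X] O' O'[X] (T := QAlg q P)
    (T' := QAlg (φ q) (P.map φ))).2 p2.symm
  exact this.symm

end Specialization

/-! #### Localization -/

section FractionField

variable {κ : Type u} [CommRing κ] [IsDomain κ]

theorem shift_ne_zero {q : κ} (hq : q ≠ 0) {p : κ[X]} (hp : p ≠ 0) : shift q p ≠ 0 := by
  intro h
  apply hp
  ext n
  have hc : (shift q p).coeff n = p.coeff n * q ^ n := by
    simp [shift, Polynomial.comp_C_mul_X_coeff]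
  rw [h] at hc
  have := mul_eq_zero.1 hc.symm
  simpa [pow_ne_zero n hq] using this

theorem isStable_nonZeroDivisors {q : κ} (hq : q ≠ 0) : IsStable q (nonZeroDivisors κ[X]) := by
  intro p hp
  rw [Submonoid.mem_comap]
  rw [mem_nonZeroDivisors_iff_ne_zero] at hp ⊢
  exact shift_ne_zero hq hp

/-- The `q`-difference field `(κ(x), σ_q)`, with `∂ = x d/dx`. -/
def ratDiffRing {q : κ} (hq : q ≠ 0) : GenDiffRing (RatFunc κ) :=
  qDiffRing q (nonZeroDivisors κ[X]) (isStable_nonZeroDivisors hq) (RatFunc κ)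

/-- The generalized differential field `(κ(x), δ_q)`, with `∂ = x d/dx`. -/
def ratConnRing {q : κ} (hq : q ≠ 0) : GenDiffRing (RatFunc κ) :=
  qConnRing q (nonZeroDivisors κ[X]) (isStable_nonZeroDivisors hq) (RatFunc κ)

variable (φ : O →+* κ) (q : O) (P : O[X]) (hq : φ q ≠ 0) (hP : P.map φ ≠ 0)

theorem denoms_le_comap_nonZeroDivisors (hq : φ q ≠ 0) (hP : P.map φ ≠ 0) :
    denoms q P ≤ (nonZeroDivisors κ[X]).comap (Polynomial.mapRingHom φ) := by
  refine (Submonoid.closure_le).2 ?_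
  rintro _ ⟨i, rfl⟩
  change (shift (q ^ i) P).map φ ∈ nonZeroDivisors κ[X]
  rw [map_shift, mem_nonZeroDivisors_iff_ne_zero, map_pow]
  exact shift_ne_zero (pow_ne_zero i hq) hP

/-- The canonical map `O[x, 1/P(x), 1/P(qx), …] → κ(x)` induced by `φ : O → κ`. -/
def toRat : QAlg q P →+* RatFunc κ :=
  locMap (denoms q P) (QAlg q P) φ (nonZeroDivisors κ[X]) (RatFunc κ)
    (denoms_le_comap_nonZeroDivisors φ q P hq hP)

theorem toRat_isMor_diff :
    letI := (toRat φ q P hq hP).toAlgebra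
    (QAlg.diffRing q P).IsMor (ratDiffRing hq) :=
  qDiffRing_isMor q (denoms q P) (isStable_denoms q P) (QAlg q P) φ (nonZeroDivisors κ[X])
    (isStable_nonZeroDivisors hq) (RatFunc κ) (denoms_le_comap_nonZeroDivisors φ q P hq hP)

theorem toRat_isMor_conn :
    letI := (toRat φ q P hq hP).toAlgebra
    (QAlg.connRing q P).IsMor (ratConnRing hq) :=
  qConnRing_isMor q (denoms q P) (isStable_denoms q P) (QAlg q P) φ (nonZeroDivisors κ[X])
    (isStable_nonZeroDivisors hq) (RatFunc κ) (denoms_le_comap_nonZeroDivisors φ q P hq hP)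

/-- `Gal(M, η_A) ⊗ κ(x) ≃ Gal(M_{κ(x)}, η_{κ(x)})` for a `q`-difference module `M` over
`A = O[x, 1/P(x), 1/P(qx), …]`. -/
def DiffGalLoc (M : Obj (QAlg.diffRing q P)) : Prop :=
  letI := (toRat φ q P hq hP).toAlgebra
  GalLoc.{u, w} (toRat_isMor_diff φ q P hq hP) M

/-- `Gal^∂(M, η_A) ⊗ κ(x) ≃ Gal^∂(M_{κ(x)}, η_{κ(x)})` for a `q`-difference module `M` over
`A = O[x, 1/P(x), 1/P(qx), …]`. -/
def DiffGalDiffLoc (M : Obj (QAlg.diffRing q P)) : Prop :=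
  letI := (toRat φ q P hq hP).toAlgebra
  GalDiffLoc.{u, w} (toRat_isMor_diff φ q P hq hP) M

/-- `Gal(M, η_A) ⊗ κ(x) ≃ Gal(M_{κ(x)}, η_{κ(x)})` for a module with connection `M` over `(A, δ_q)`,
`A = O[x, 1/P(x), 1/P(qx), …]`. -/
def ConnGalLoc (M : Obj (QAlg.connRing q P)) : Prop :=
  letI := (toRat φ q P hq hP).toAlgebra
  GalLoc.{u, w} (toRat_isMor_conn φ q P hq hP) M

/-- `Gal^∂(M, η_A) ⊗ κ(x) ≃ Gal^∂(M_{κ(x)}, η_{κ(x)})` for a module with connection `M` over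
`(A, δ_q)`, `A = O[x, 1/P(x), 1/P(qx), …]`. -/
def ConnGalDiffLoc (M : Obj (QAlg.connRing q P)) : Prop :=
  letI := (toRat φ q P hq hP).toAlgebra
  GalDiffLoc.{u, w} (toRat_isMor_conn φ q P hq hP) M

end FractionField

/-! #### Localization of the specializations -/

section SpecLoc

theorem id_ne_zero {κ : Type u} [CommRing κ] {a : κ} (ha : a ≠ 0) : RingHom.id κ a ≠ 0 := ha

theorem map_id_ne_zero {κ : Type u} [CommRing κ] {P : κ[X]} (hP : P ≠ 0) :
    P.map (RingHom.id κ) ≠ 0 := by rwa [Polynomial.map_id]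

variable (q : O) (P : O[X]) (v : Ideal O) [v.IsPrime]
variable (hq : Ideal.Quotient.mk v q ≠ 0) (hP : P.map (Ideal.Quotient.mk v) ≠ 0)

/-- `Gal(M ⊗_A A_v, η_{A_v}) ⊗ k_v(x) ≃ Gal(M_{k_v(x)}, η_{k_v(x)})` for a `q`-difference module
`M` over `A = O[x, 1/P(x), 1/P(qx), …]`, with `k_v = O / v` and `A_v = A ⊗_O k_v`. -/
def SpecDiffGalLoc (M : Obj (QAlg.diffRing q P)) : Prop :=
  DiffGalLoc.{u, w} (RingHom.id (O ⧸ v)) (Ideal.Quotient.mk v q) (P.map (Ideal.Quotient.mk v))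
    (id_ne_zero hq) (map_id_ne_zero hP) (specDiff (Ideal.Quotient.mk v) q P M)

/-- `Gal^∂(M ⊗_A A_v, η_{A_v}) ⊗ k_v(x) ≃ Gal^∂(M_{k_v(x)}, η_{k_v(x)})` for a `q`-difference
module `M` over `A`. -/
def SpecDiffGalDiffLoc (M : Obj (QAlg.diffRing q P)) : Prop :=
  DiffGalDiffLoc.{u, w} (RingHom.id (O ⧸ v)) (Ideal.Quotient.mk v q)
    (P.map (Ideal.Quotient.mk v)) (id_ne_zero hq) (map_id_ne_zero hP)
    (specDiff (Ideal.Quotient.mk v) q P M)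

/-- `Gal(M ⊗_A A_v, η_{A_v}) ⊗ k_v(x) ≃ Gal(M_{k_v(x)}, η_{k_v(x)})` for a module with connection
`M` over `(A, δ_q)`. If `q_v = 1`, then `M ⊗_A A_v` is a differential module over
`(A_v, x d/dx)`. -/
def SpecConnGalLoc (M : Obj (QAlg.connRing q P)) : Prop :=
  ConnGalLoc.{u, w} (RingHom.id (O ⧸ v)) (Ideal.Quotient.mk v q) (P.map (Ideal.Quotient.mk v))
    (id_ne_zero hq) (map_id_ne_zero hP) (specConn (Ideal.Quotient.mk v) q P M)

/-- `Gal^∂(M ⊗_A A_v, η_{A_v}) ⊗ k_v(x) ≃ Gal^∂(M_{k_v(x)}, η_{k_v(x)})` for a module with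
connection `M` over `(A, δ_q)`. -/
def SpecConnGalDiffLoc (M : Obj (QAlg.connRing q P)) : Prop :=
  ConnGalDiffLoc.{u, w} (RingHom.id (O ⧸ v)) (Ideal.Quotient.mk v q)
    (P.map (Ideal.Quotient.mk v)) (id_ne_zero hq) (map_id_ne_zero hP)
    (specConn (Ideal.Quotient.mk v) q P M)

end SpecLoc

end Algebras

/-! ### The function field `K / k(q)` -/

section FunctionField

open FunctionField

variable (k : Type v) (K : Type u) [Field k] [Field K] [Algebra k[X] K]

/-- The integral closure `O_K` of `k[q]` in `K`. -/
abbrev OK : Type u := ringOfIntegers k K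

/-- The element `q` of `O_K`. -/
def qOK : OK k K := algebraMap k[X] (OK k K) X

theorem qOK_ne_zero [Algebra (RatFunc k) K] [IsScalarTower k[X] (RatFunc k) K] :
    algebraMap (OK k K) K (qOK k K) ≠ 0 := by
  rw [qOK, ← IsScalarTower.algebraMap_apply]
  exact (map_ne_zero_iff _ (FunctionField.algebraMap_injective k K)).2 X_ne_zero

theorem map_ne_zero_of_ne_zero {P : (OK k K)[X]} (hP : P ≠ 0) :
    P.map (algebraMap (OK k K) K) ≠ 0 :=
  (Polynomial.map_ne_zero_iff Subtype.val_injective).2 hP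

end FunctionField

end

end QDiff

/-!
Let `B` be `A` or `A_v`, with fraction field `F`. The point is to control base change along
`B → F`. If `T` is an object over `B` and `W` is a `Δ`-stable subspace of `F ⊗ T`, then the
saturated submodule `L = W ∩ T` is a `Δ`-stable lattice of `W`, and it is again an object. It is
projective because over a polynomial ring over a Dedekind domain, hence over its localization `B`,
saturated submodules of projective modules are flat. It is generated by `Σ(L)`: each element of `L`
is multiplied into the span of `Σ(L)` by a power of `q`, because every `t` in `T` has a multiple
`q ^ n s t` in `Σ(T)` with `s` a unit; and `L` is multiplied into it by some `1 + x c`, by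
Nakayama's lemma, because `Σ` is linear modulo `x`, hence surjective on the image of `L` in
`T / x T` by noetherianity. As `1 + x c` is a nonzerodivisor modulo `q ^ n`, this suffices.

Consequently each object of `⟨M_F⟩` is the base change of an object of `⟨M⟩`, and each morphism
`F ⊗ N → F ⊗ N'`, through the lattice in its graph, is given by a correspondence `N ← L → N'` over
`B` whose left arrow becomes an isomorphism over `F`. For every `F`-algebra `R`, a tensor
automorphism of `N ↦ R ⊗ N` on `⟨M⟩` is compatible with such correspondences and therefore extends
uniquely to `⟨M_F⟩`.
-/

namespace QDiff

noncomputable section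

/-! ### Flatness over polynomial rings -/

section Flatness

section TwoOutOfThree

variable {R : Type*} [CommRing R] {M N P : Type*} [AddCommGroup M] [AddCommGroup N]
  [AddCommGroup P] [Module R M] [Module R N] [Module R P]

theorem flat_iff_flat_of_exact {g : M →ₗ[R] N} {f : N →ₗ[R] P} (hg : Function.Injective g)
    (hf : Function.Surjective f) (H : Function.Exact g f) [Module.Flat R P] :
    Module.Flat R N ↔ Module.Flat R M := by
  constructor <;> intro _ <;> rw [Module.Flat.iff_rTensor_preserves_injective_linearMap] <;>
    intro I X _ _ _ _ i hi
  · have hgI := LinearMap.lTensor_injective_of_exact_of_flat f hf g hg H I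
    have hN := (Module.Flat.rTensor_preserves_injective_linearMap (M := N) i hi).comp hgI
    rw [← LinearMap.coe_comp, LinearMap.rTensor_comp_lTensor, ← LinearMap.lTensor_comp_rTensor,
      LinearMap.coe_comp] at hN
    exact hN.of_comp
  · have hgX := LinearMap.lTensor_injective_of_exact_of_flat f hf g hg H X
    rw [injective_iff_map_eq_zero]
    intro z hz
    have hzP : f.lTensor I z = 0 := by
      refine Module.Flat.rTensor_preserves_injective_linearMap (M := P) i hi ?_
      rw [map_zero, ← LinearMap.comp_apply, LinearMap.rTensor_comp_lTensor,
        ← LinearMap.lTensor_comp_rTensor, LinearMap.comp_apply, hz, map_zero]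
    obtain ⟨y, rfl⟩ := (lTensor_exact I H hf z).1 hzP
    have hy : y = 0 := by
      refine Module.Flat.rTensor_preserves_injective_linearMap (M := M) i hi (hgX ?_)
      rw [map_zero, map_zero, ← LinearMap.comp_apply, LinearMap.lTensor_comp_rTensor,
        ← LinearMap.rTensor_comp_lTensor, LinearMap.comp_apply, hz]
    rw [hy, map_zero]

theorem flat_ker_coprod_iff (f : M →ₗ[R] P) {g : N →ₗ[R] P} (hg : Function.Surjective g)
    [Module.Flat R M] : Module.Flat R (LinearMap.ker (f.coprod g)) ↔
      Module.Flat R (LinearMap.ker g) := by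
  refine flat_iff_flat_of_exact
    (g := (LinearMap.inr R M N ∘ₗ (LinearMap.ker g).subtype).codRestrict _ fun z => by simp)
    (f := LinearMap.fst R M N ∘ₗ (LinearMap.ker (f.coprod g)).subtype) ?_ ?_ ?_
  · exact fun x y hxy => Subtype.ext (congrArg (fun w : LinearMap.ker (f.coprod g) => w.1.2) hxy)
  · intro m
    obtain ⟨n, hn⟩ := hg (-f m)
    exact ⟨⟨(m, n), by simp [hn]⟩, rfl⟩
  · rintro ⟨⟨m, n⟩, h⟩
    constructor
    · rintro (rfl : m = 0)
      exact ⟨⟨n, by simpa using h⟩, rfl⟩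
    · rintro ⟨z, hz⟩
      exact (congrArg (fun w : LinearMap.ker (f.coprod g) => w.1.1) hz).symm

/-- Schanuel's argument: both kernels are compared with the fibre product of `f` and `g`. -/
theorem flat_ker_iff_flat_ker {f : M →ₗ[R] P} {g : N →ₗ[R] P} (hf : Function.Surjective f)
    (hg : Function.Surjective g) [Module.Flat R M] [Module.Flat R N] :
    Module.Flat R (LinearMap.ker f) ↔ Module.Flat R (LinearMap.ker g) := by
  rw [← flat_ker_coprod_iff f hg, ← flat_ker_coprod_iff g hf]
  refine Module.Flat.equiv_iff ((LinearEquiv.prodComm R N M).submoduleMap _ ≪≫ₗ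
    LinearEquiv.ofEq _ _ ?_)
  ext ⟨m, n⟩
  simp [add_comm]

theorem flat_ker_of_exact {Q : Type*} [AddCommGroup Q] [Module R Q] [Module.Flat R Q]
    {d : Q →ₗ[R] M} {f : M →ₗ[R] P} (hd : Function.Injective d) (H : Function.Exact d f) :
    Module.Flat R (LinearMap.ker f) :=
  Module.Flat.of_linearEquiv
    ((LinearEquiv.ofInjective d hd).trans (LinearEquiv.ofEq _ _ H.linearMap_ker_eq.symm)).symm

end TwoOutOfThree

variable {O : Type*} [CommRing O] (N : Type*) [AddCommGroup N] [Module O N]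

/-- The `i`-th coefficient of an element of `O[X] ⊗ N = N[X]`. -/
def polyCoeff (i : ℕ) : O[X] ⊗[O] N →ₗ[O] N :=
  (TensorProduct.lid O N).toLinearMap ∘ₗ (Polynomial.lcoeff O i).rTensor N

@[simp] theorem polyCoeff_tmul (i : ℕ) (p : O[X]) (n : N) :
    polyCoeff N i (p ⊗ₜ[O] n) = p.coeff i • n := by
  simp [polyCoeff]

open PolynomialModule in
theorem polyCoeff_eq_coeff (i : ℕ) (z : O[X] ⊗[O] N) :
    polyCoeff N i z = (polynomialTensorProductLEquivPolynomialModule O N z).coeff i := by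
  induction z using TensorProduct.induction_on with
  | zero => simp
  | tmul p n =>
    rw [polyCoeff_tmul]
    exact (smul_single_apply 0 p n i).symm
  | add x y hx hy => rw [map_add, hx, hy, map_add, PolynomialModule.coeff_add, Finsupp.add_apply]

variable [Module O[X] N] [IsScalarTower O O[X] N]

/-- The action map `O[X] ⊗ N → N` of an `O[X]`-module `N`. -/
def polyAct : O[X] ⊗[O] N →ₗ[O[X]] N := LinearMap.liftBaseChange O[X] LinearMap.id

@[simp] theorem polyAct_tmul (p : O[X]) (n : N) : polyAct N (p ⊗ₜ[O] n) = p • n := by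
  simp [polyAct]

/-- The endomorphism `p ⊗ n ↦ X p ⊗ n - p ⊗ X n` of `O[X] ⊗ N`, which resolves `N` together with
`polyAct`. -/
def polyDiff : O[X] ⊗[O] N →ₗ[O[X]] O[X] ⊗[O] N :=
  LinearMap.lsmul O[X] _ (X : O[X]) -
    ((LinearMap.lsmul O[X] N (X : O[X])).restrictScalars O).baseChange O[X]

@[simp] theorem polyDiff_tmul (p : O[X]) (n : N) :
    polyDiff N (p ⊗ₜ[O] n) = (X * p) ⊗ₜ n - p ⊗ₜ ((X : O[X]) • n) := by
  simp [polyDiff, TensorProduct.smul_tmul']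

theorem polyCoeff_succ_polyDiff (z : O[X] ⊗[O] N) (i : ℕ) :
    polyCoeff N (i + 1) (polyDiff N z) =
      polyCoeff N i z - (X : O[X]) • polyCoeff N (i + 1) z := by
  induction z using TensorProduct.induction_on with
  | zero => simp
  | tmul p n =>
    simp only [polyDiff_tmul, map_sub, polyCoeff_tmul, coeff_X_mul]
    rw [smul_comm]
  | add x y hx hy => simp only [map_add, hx, hy, smul_add]; abel

theorem polyDiff_injective : Function.Injective (polyDiff (O := O) N) := by
  rw [injective_iff_map_eq_zero]
  intro z hz
  let f := (PolynomialModule.polynomialTensorProductLEquivPolynomialModule O N z).coeff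
  have coeff_eq (i : ℕ) : f i = (X : O[X]) • f (i + 1) := by
    have h := polyCoeff_succ_polyDiff N z i
    rw [hz, map_zero, polyCoeff_eq_coeff, polyCoeff_eq_coeff] at h
    exact sub_eq_zero.1 h.symm
  have coeff_eq_pow (i j : ℕ) : f i = (X : O[X]) ^ j • f (i + j) := by
    induction j with
    | zero => simp
    | succ j ih => rw [ih, coeff_eq, smul_smul, ← pow_succ, add_assoc]
  obtain ⟨m, hm⟩ := f.support.bddAbove
  have hf : f = 0 := by
    ext i
    have hlarge : f (i + (m + 1)) = 0 := Finsupp.notMem_support_iff.1 fun h => by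
      have := hm h
      omega
    rw [coeff_eq_pow i (m + 1), hlarge, smul_zero, Finsupp.zero_apply]
  simpa [f] using hf

theorem sub_one_tmul_polyAct_mem_range (z : O[X] ⊗[O] N) :
    z - 1 ⊗ₜ polyAct N z ∈ LinearMap.range (polyDiff (O := O) N) := by
  induction z using TensorProduct.induction_on with
  | zero => simp
  | add x y hx hy =>
    rw [map_add, TensorProduct.tmul_add, add_sub_add_comm]
    exact add_mem hx hy
  | tmul p n =>
    rw [polyAct_tmul]
    induction p using Polynomial.induction_on' generalizing n with
    | add p r hp hr =>
      rw [add_smul, TensorProduct.add_tmul, TensorProduct.tmul_add, add_sub_add_comm]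
      exact add_mem (hp n) (hr n)
    | monomial k a =>
      induction k generalizing n with
      | zero =>
        rw [monomial_zero_left, ← mul_one (C a), ← smul_eq_C_mul, smul_assoc, one_smul,
          TensorProduct.smul_tmul, sub_self]
        exact zero_mem _
      | succ k ih =>
        have h := add_mem (LinearMap.mem_range_self (polyDiff (O := O) N) (monomial k a ⊗ₜ n))
          (ih ((X : O[X]) • n))
        rwa [polyDiff_tmul, X_mul_monomial, smul_smul, monomial_mul_X, sub_add_sub_cancel] at h

theorem polyDiff_exact_polyAct : Function.Exact (polyDiff (O := O) N) (polyAct N) := by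
  refine fun z => ⟨fun hz => ?_, ?_⟩
  · simpa [hz] using sub_one_tmul_polyAct_mem_range N z
  · rintro ⟨y, rfl⟩
    induction y using TensorProduct.induction_on with
    | zero => simp
    | tmul p n => simp [smul_smul, mul_comm]
    | add x y hx hy => simp [hx, hy]

theorem flat_submodule_of_flat_quotient {T : Type*} [AddCommGroup T] [Module O[X] T] [Module O T]
    [IsScalarTower O O[X] T] [Module.Flat O[X] T] (L : Submodule O[X] T)
    [Module.Flat O (T ⧸ L)] : Module.Flat O[X] L := by
  have hact : Function.Surjective (polyAct (O := O) (T ⧸ L)) := fun n => ⟨1 ⊗ₜ n, by simp⟩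
  have hker := flat_ker_of_exact (polyDiff_injective (O := O) (T ⧸ L)) (polyDiff_exact_polyAct _)
  rw [flat_ker_iff_flat_ker hact L.mkQ_surjective, L.ker_mkQ] at hker
  exact hker

end Flatness

/-! ### Saturated submodules -/

/-- A submodule `L` of `T` is saturated if it contains every vector that has a nonzero multiple in
`L`; over a domain this says that `T ⧸ L` is torsion-free. -/
def IsSaturated {B : Type*} [CommRing B] {T : Type*} [AddCommGroup T] [Module B T]
    (L : Submodule B T) : Prop := ∀ (b : B) (t : T), b ≠ 0 → b • t ∈ L → t ∈ L

theorem IsSaturated.isTorsionFree_quotient {B : Type*} [CommRing B] [IsDomain B] {T : Type*}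
    [AddCommGroup T] [Module B T] {L : Submodule B T} (hL : IsSaturated L) :
    Module.IsTorsionFree B (T ⧸ L) := by
  refine Module.isTorsionFree_iff_smul_eq_zero.2 fun b m hm => or_iff_not_imp_left.2 fun hb => ?_
  obtain ⟨t, rfl⟩ := Submodule.Quotient.mk_surjective _ m
  rw [← Submodule.Quotient.mk_smul, Submodule.Quotient.mk_eq_zero] at hm
  exact (Submodule.Quotient.mk_eq_zero _).2 (hL b t hb hm)

theorem IsSaturated.projective {O : Type*} [CommRing O] [IsDedekindDomain O] {S : Submonoid O[X]}
    (hS : S ≤ nonZeroDivisors O[X]) (A : Type*) [CommRing A] [IsDomain A] [IsNoetherianRing A]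
    [Algebra O[X] A] [IsLocalization S A] {T : Type*} [AddCommGroup T] [Module A T]
    [Module.Finite A T] [Module.Projective A T] {L : Submodule A T} (hL : IsSaturated L) :
    Module.Projective A L := by
  let _ : Algebra O A := ((algebraMap O[X] A).comp C).toAlgebra
  have : IsScalarTower O O[X] A := IsScalarTower.of_algebraMap_eq fun _ => rfl
  let _ : Module O[X] T := Module.compHom T (algebraMap O[X] A)
  have : IsScalarTower O[X] A T := IsScalarTower.of_algebraMap_smul fun _ _ => rfl
  let _ : Module O T := Module.compHom T (C : O →+* O[X])
  have : IsScalarTower O O[X] T := IsScalarTower.of_algebraMap_smul fun _ _ => rfl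
  have : IsScalarTower O A T := IsScalarTower.of_algebraMap_smul fun _ _ => rfl
  have : FaithfulSMul O A := (faithfulSMul_iff_algebraMap_injective O A).2
    ((IsLocalization.injective A hS).comp C_injective)
  have : Module.Flat O[X] A := IsLocalization.flat A S
  have : Module.Flat O[X] T := Module.Flat.trans O[X] A T
  have : Module.IsTorsionFree A (T ⧸ L) := hL.isTorsionFree_quotient
  have : Module.IsTorsionFree O (T ⧸ L) := Module.IsTorsionFree.trans_faithfulSMul O A (T ⧸ L)
  have : Module.Flat O (T ⧸ L.restrictScalars O[X]) :=
    inferInstanceAs (Module.Flat O (T ⧸ L))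
  have hflat : Module.Flat O[X] L := flat_submodule_of_flat_quotient (L.restrictScalars O[X])
  have : Module.Flat A L := (Module.flat_iff_of_isLocalization A S L).2 hflat
  have : Module.FinitePresentation A L := Module.finitePresentation_of_finite A L
  exact Module.Flat.projective_of_finitePresentation

/-! ### Rings of integers of function fields -/

section Integers

variable {k : Type*} [Field k]

section RankBounds

variable {V : Type*} [AddCommGroup V] [Module k[X] V] [Module k V] [IsScalarTower k k[X] V]

theorem finite_and_finrank_span_le_of_smul_eq_zero {a : k[X]} (ha : a ≠ 0)
    (hV : ∀ v : V, a • v = 0) {r : ℕ} (e : Fin r → V) :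
    Module.Finite k (Submodule.span k[X] (Set.range e)) ∧
      Module.finrank k (Submodule.span k[X] (Set.range e)) ≤ r * a.natDegree := by
  have hle (v : V) : Ideal.span {a} ≤ LinearMap.ker (LinearMap.toSpanSingleton k[X] V v) := by
    simpa [Ideal.span_singleton_le_iff_mem] using hV v
  let φ : (Fin r → k[X] ⧸ Ideal.span {a}) →ₗ[k[X]] V :=
    LinearMap.lsum k[X] _ k[X] fun i =>
      (Ideal.span {a}).liftQ (LinearMap.toSpanSingleton k[X] V (e i)) (hle (e i))
  have hspan : Submodule.span k[X] (Set.range e) ≤ LinearMap.range φ := by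
    rw [Submodule.span_le]
    rintro _ ⟨i, rfl⟩
    refine ⟨Pi.single i (Submodule.Quotient.mk 1), ?_⟩
    rw [LinearMap.lsum_piSingle, Submodule.liftQ_apply, LinearMap.toSpanSingleton_apply, one_smul]
  have : Module.Finite k (k[X] ⧸ Ideal.span {a}) := (AdjoinRoot.powerBasis ha).finite
  have : Module.Finite k (LinearMap.range (φ.restrictScalars k)) := inferInstance
  have hspan_k : (Submodule.span k[X] (Set.range e)).restrictScalars k ≤
      LinearMap.range (φ.restrictScalars k) := hspan
  refine ⟨Submodule.finiteDimensional_of_le hspan_k, (Submodule.finrank_mono hspan_k).trans ?_⟩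
  refine (LinearMap.finrank_range_le (φ.restrictScalars k)).trans_eq ?_
  rw [Module.finrank_pi_fintype, Finset.sum_const, finrank_quotient_span_eq_natDegree,
    Finset.card_univ, Fintype.card_fin, smul_eq_mul]

theorem finite_of_surjective_of_smul_eq_zero {M : Type*} [AddCommGroup M] [Module k[X] M]
    [Module.IsTorsionFree k[X] M] (hM : Module.rank k[X] M < Cardinal.aleph0)
    {f : M →ₗ[k[X]] V} (hf : Function.Surjective f) {a : k[X]} (ha : a ≠ 0)
    (hV : ∀ v : V, a • v = 0) : Module.Finite k V := by
  obtain ⟨n, hn⟩ := Cardinal.lt_aleph0.1 hM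
  rw [← Module.rank_lt_aleph0_iff]
  refine (rank_le (n := n * a.natDegree) fun s hs => ?_).trans_lt Cardinal.natCast_lt_aleph0
  let N := Submodule.span k[X] (Function.surjInv hf '' (s : Set V))
  have : Module.Finite k[X] N := Module.Finite.span_of_finite _ (s.finite_toSet.image _)
  let e := Module.finBasis k[X] N
  have hr : Module.finrank k[X] N ≤ n := by
    have := Submodule.rank_le N
    rwa [hn, ← Module.finrank_eq_rank, Nat.cast_le] at this
  obtain ⟨hfin, hdim⟩ := finite_and_finrank_span_le_of_smul_eq_zero ha hV fun i => f (e i)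
  have : Module.Finite k ((Submodule.span k[X] (Set.range fun i => f (e i))).restrictScalars k) :=
    hfin
  have hs_le : Submodule.span k (s : Set V) ≤
      (Submodule.span k[X] (Set.range fun i => f (e i))).restrictScalars k := by
    refine Submodule.span_le.2 fun v hv => ?_
    have hmem : (⟨Function.surjInv hf v, Submodule.subset_span ⟨v, hv, rfl⟩⟩ : N) ∈
        Submodule.span k[X] (Set.range e) := e.span_eq.symm ▸ Submodule.mem_top
    have hmap := Submodule.mem_map_of_mem (f := f ∘ₗ N.subtype) hmem
    rw [Submodule.map_span, ← Set.range_comp] at hmap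
    rw [LinearMap.comp_apply, Submodule.subtype_apply, Function.surjInv_eq hf v] at hmap
    exact hmap
  calc s.card = Module.finrank k (Submodule.span k (s : Set V)) :=
        (finrank_span_finset_eq_card hs).symm
    _ ≤ _ := Submodule.finrank_mono (t := Submodule.restrictScalars k _) hs_le
    _ ≤ _ := hdim
    _ ≤ n * a.natDegree := Nat.mul_le_mul_right _ hr

end RankBounds

theorem isNoetherianRing_of_rank_lt_aleph0 {O : Type*} [CommRing O] [IsDomain O] [Algebra k[X] O]
    [Module.IsTorsionFree k[X] O] [Algebra.IsIntegral k[X] O]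
    (hO : Module.rank k[X] O < Cardinal.aleph0) : IsNoetherianRing O := by
  let _ : Algebra k O := ((algebraMap k[X] O).comp C).toAlgebra
  have : IsScalarTower k k[X] O := IsScalarTower.of_algebraMap_eq fun _ => rfl
  refine (isNoetherianRing_iff_ideal_fg _).2 fun I => ?_
  obtain rfl | hI := eq_or_ne I ⊥
  · exact Submodule.fg_bot
  obtain ⟨x, hxI, hx⟩ := Submodule.exists_mem_ne_zero_of_ne_bot hI
  obtain ⟨a, haI, ha⟩ := Submodule.exists_mem_ne_zero_of_ne_bot
    (Ideal.comap_ne_bot_of_integral_mem hx hxI (Algebra.IsIntegral.isIntegral (R := k[X]) x))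
  have hmk : Function.Surjective (IsScalarTower.toAlgHom k[X] O
      (O ⧸ Ideal.span {algebraMap k[X] O a})).toLinearMap := Ideal.Quotient.mk_surjective
  have hfin : Module.Finite k (O ⧸ Ideal.span {algebraMap k[X] O a}) := by
    refine finite_of_surjective_of_smul_eq_zero hO hmk ha fun v => ?_
    obtain ⟨b, rfl⟩ := Ideal.Quotient.mk_surjective v
    rw [Algebra.smul_def]
    exact mul_eq_zero_of_left (Ideal.Quotient.mk_singleton_self (algebraMap k[X] O a)) _
  refine Submodule.fg_of_fg_map_of_fg_inf_ker (Ideal.span {algebraMap k[X] O a}).mkQ ?_ ?_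
  · exact Submodule.FG.of_restrictScalars k (IsNoetherian.noetherian _)
  · rw [Submodule.ker_mkQ, inf_eq_right.2 ((Ideal.span_singleton_le_iff_mem I).2 haI)]
    exact ⟨{algebraMap k[X] O a}, by simp [Ideal.span]⟩

/-- The extension of function fields may be inseparable, so finiteness of `OK k K` over `k[X]` is
not available from the trace form; a Krull–Akizuki argument replaces it. -/
theorem isDedekindDomain_OK (k : Type v) (K : Type u) [Field k] [Field K]
    [Algebra k[X] K] [Algebra (RatFunc k) K] [IsScalarTower k[X] (RatFunc k) K]
    [FunctionField k K] : IsDedekindDomain (OK k K) := by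
  have : Module.IsTorsionFree k[X] (OK k K) :=
    Module.isTorsionFree_iff_algebraMap_injective.2
      (FunctionField.ringOfIntegers.algebraMap_injective k K)
  have : Algebra.IsIntegral k[X] (OK k K) := IsIntegralClosure.isIntegral_algebra k[X] K
  have hrank : Module.rank k[X] (OK k K) < Cardinal.aleph0 := by
    refine (LinearMap.rank_le_of_injective
      (IsScalarTower.toAlgHom k[X] (OK k K) K).toLinearMap Subtype.val_injective).trans_lt ?_
    rw [← IsLocalization.rank_eq (RatFunc k) (nonZeroDivisors k[X]) le_rfl]
    exact Module.rank_lt_aleph0_iff.2 inferInstance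
  have := isNoetherianRing_of_rank_lt_aleph0 hrank
  have : Ring.DimensionLEOne (OK k K) := Ring.DimensionLEOne.of_isIntegral k[X] (OK k K)
  exact { (inferInstance : IsIntegrallyClosed (OK k K)) with }

end Integers

/-! ### Semilinear operators -/

section Semilinear

theorem exists_dualBasis (R M : Type*) [CommRing R] [AddCommGroup M] [Module R M]
    [Module.Finite R M] [Module.Projective R M] :
    ∃ (m : ℕ) (e : Fin m → M) (g : Fin m → M →ₗ[R] R), ∀ x, x = ∑ i, g i x • e i := by
  obtain ⟨m, f, g, -, -, hfg⟩ := Module.Finite.exists_comp_eq_id_of_projective R M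
  refine ⟨m, fun i => f fun j => if i = j then 1 else 0, fun i => LinearMap.proj i ∘ₗ g,
    fun x => ?_⟩
  exact (LinearMap.congr_fun hfg x).symm.trans (LinearMap.pi_apply_eq_sum_univ f (g x))

section Field

variable {F V : Type*} [Field F] {s : F →+* F} [AddCommGroup V] [Module F V]
  [FiniteDimensional F V] {S : V →ₛₗ[s] V}

theorem exists_linearMap_comp_eq_of_field
    (hS : Submodule.span F (Set.range S) = ⊤) (ψ : V →ₛₗ[s] F) :
    ∃ φ : V →ₗ[F] F, ∀ v, φ (S v) = ψ v := by
  let b := Module.finBasis F V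
  have hspan : ⊤ ≤ Submodule.span F (Set.range (S ∘ b)) := by
    rw [← hS, Submodule.span_le]
    rintro _ ⟨v, rfl⟩
    rw [← b.sum_repr v, map_sum]
    refine Submodule.sum_mem _ fun i _ => ?_
    rw [map_smulₛₗ]
    exact Submodule.smul_mem _ _ (Submodule.subset_span ⟨i, rfl⟩)
  let b' := basisOfTopLeSpanOfCardEqFinrank (S ∘ b) hspan (Fintype.card_fin _)
  have hb' (i) : S (b i) = b' i := by simp [b']
  refine ⟨b'.constr F fun i => ψ (b i), fun v => ?_⟩
  conv_lhs => rw [← b.sum_repr v]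
  conv_rhs => rw [← b.sum_repr v]
  simp only [map_sum, map_smulₛₗ, hb', Module.Basis.constr_basis, RingHom.id_apply]

theorem injective_of_span_range_eq_top_of_field (hS : Submodule.span F (Set.range S) = ⊤) :
    Function.Injective S := by
  refine (injective_iff_map_eq_zero S).2 fun v hv => ?_
  refine (Module.forall_dual_apply_eq_zero_iff F v).1 fun g => s.injective ?_
  let ψ : V →ₛₗ[s] F := { toFun := fun v => s (g v), map_add' := by simp, map_smul' := by simp }
  obtain ⟨φ, hφ⟩ := exists_linearMap_comp_eq_of_field hS ψ
  simpa [hv, ψ] using (hφ v).symm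

end Field

variable {B : Type*} [CommRing B] {F : Type*} [Field F] [Algebra B F] {s : B →+* B} {N N' : Type*}
  [AddCommGroup N] [Module B N] [AddCommGroup N'] [Module B N']

/-- The semilinear extension `c ⊗ n ↦ s' c ⊗ S n` of a semilinear map `S` along `B → F`. -/
def semilinearBaseChange (s' : F →+* F) (hs : ∀ b, s' (algebraMap B F b) = algebraMap B F (s b))
    (S : N →ₛₗ[s] N') : F ⊗[B] N →ₛₗ[s'] F ⊗[B] N' where
  __ := (TensorProduct.map (σ₁₂ := s)
    { s' with map_smul' := fun b c => by simp [Algebra.smul_def, hs] } S).toAddHom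
  map_smul' c t := by
    induction t using TensorProduct.induction_on with
    | zero => simp
    | tmul a n => simp [TensorProduct.smul_tmul']
    | add x y hx hy =>
      simp only [smul_add, map_add, AddHom.toFun_eq_coe] at hx hy ⊢
      rw [hx, hy]

@[simp] theorem semilinearBaseChange_tmul (s' : F →+* F)
    (hs : ∀ b, s' (algebraMap B F b) = algebraMap B F (s b)) (S : N →ₛₗ[s] N') (c : F) (n : N) :
    semilinearBaseChange s' hs S (c ⊗ₜ n) = s' c ⊗ₜ S n := rfl

/-- The span of the image of `S` has full rank: every vector has a nonzero multiple in it. -/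
def HasFullRankImage (S : N →ₛₗ[s] N') : Prop :=
  ∀ n : N', ∃ b : B, b ≠ 0 ∧ b • n ∈ Submodule.span B (Set.range S)

variable [IsFractionRing B F]

theorem HasFullRankImage.span_range_semilinearBaseChange {s' : F →+* F}
    (hs : ∀ b, s' (algebraMap B F b) = algebraMap B F (s b)) {S : N →ₛₗ[s] N'}
    (hS : HasFullRankImage S) :
    Submodule.span F (Set.range (semilinearBaseChange s' hs S)) = ⊤ := by
  have hle : Submodule.span B (Set.range S) ≤ Submodule.comap (TensorProduct.mk B F N' 1)
      ((Submodule.span F (Set.range (semilinearBaseChange s' hs S))).restrictScalars B) := by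
    rw [Submodule.span_le]
    rintro _ ⟨n, rfl⟩
    exact Submodule.subset_span ⟨1 ⊗ₜ n, by simp⟩
  rw [eq_top_iff]
  rintro t -
  induction t using TensorProduct.induction_on with
  | zero => exact Submodule.zero_mem _
  | add x y hx hy => exact Submodule.add_mem _ hx hy
  | tmul c n =>
    obtain ⟨b, hb, hn⟩ := hS n
    have hb' : algebraMap B F b ≠ 0 := by
      rwa [Ne, map_eq_zero_iff _ (IsFractionRing.injective B F)]
    have hdiv : c ⊗ₜ[B] n = (c * (algebraMap B F b)⁻¹) • (1 ⊗ₜ[B] (b • n) : F ⊗[B] N') := by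
      rw [TensorProduct.tmul_smul, TensorProduct.smul_tmul', TensorProduct.smul_tmul',
        smul_eq_mul, Algebra.smul_def b, mul_one, mul_assoc, inv_mul_cancel₀ hb', mul_one]
    rw [hdiv]
    exact Submodule.smul_mem _ _ (hle hn)

variable [IsDomain B]

variable (F) in
theorem exists_fractionRing_extension (hs : Function.Injective s) :
    ∃ s' : F →+* F, ∀ b, s' (algebraMap B F b) = algebraMap B F (s b) :=
  ⟨IsLocalization.map (M := nonZeroDivisors B) (T := nonZeroDivisors B) F s
    (nonZeroDivisors_le_comap_nonZeroDivisors_of_injective s hs),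
    fun b => IsLocalization.map_eq _ b⟩

variable (F) in
theorem HasFullRankImage.exists_linearMap_comp_eq [Module.Finite B N]
    (hs : Function.Injective s) {S : N →ₛₗ[s] N} (hS : HasFullRankImage S) (ψ : N →ₛₗ[s] B) :
    ∃ φ : N →ₗ[B] F, ∀ n, φ (S n) = algebraMap B F (ψ n) := by
  obtain ⟨s', hs'⟩ := exists_fractionRing_extension F hs
  obtain ⟨φ, hφ⟩ := exists_linearMap_comp_eq_of_field
    (hS.span_range_semilinearBaseChange hs')
    ((TensorProduct.AlgebraTensorModule.rid B F F).toLinearMap.comp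
      (semilinearBaseChange s' hs' ψ))
  refine ⟨φ.restrictScalars B ∘ₗ TensorProduct.mk B F N 1, fun n => ?_⟩
  simpa [Algebra.smul_def] using hφ (1 ⊗ₜ n)

theorem exists_linearMap_comp_eq_of_span_range_eq_top [Module.Finite B N]
    (hs : Function.Injective s) {S : N →ₛₗ[s] N}
    (hS : Submodule.span B (Set.range S) = ⊤) (ψ : N →ₛₗ[s] B) :
    ∃ φ : N →ₗ[B] B, ∀ n, φ (S n) = ψ n := by
  let F := FractionRing B
  have hrank : HasFullRankImage S := fun n => ⟨1, one_ne_zero, by rw [hS]; trivial⟩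
  obtain ⟨φ, hφ⟩ := hrank.exists_linearMap_comp_eq F hs ψ
  have hinj : Function.Injective (Algebra.linearMap B F) := IsFractionRing.injective B F
  have hle : Submodule.span B (Set.range S) ≤
      (LinearMap.range (Algebra.linearMap B F)).comap φ := by
    rw [Submodule.span_le]
    rintro _ ⟨n, rfl⟩
    exact ⟨ψ n, (hφ n).symm⟩
  have hmem (n) : φ n ∈ LinearMap.range (Algebra.linearMap B F) := by
    rw [hS] at hle
    exact hle Submodule.mem_top
  let e := LinearEquiv.ofInjective _ hinj
  refine ⟨e.symm.toLinearMap ∘ₗ φ.codRestrict _ hmem, fun n => hinj ?_⟩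
  exact (congrArg Subtype.val (e.apply_symm_apply (φ.codRestrict _ hmem (S n)))).trans (hφ n)

theorem HasFullRankImage.injective [Module.Finite B N] [Module.IsTorsionFree B N]
    (hs : Function.Injective s) {S : N →ₛₗ[s] N} (hS : HasFullRankImage S) :
    Function.Injective S := by
  obtain ⟨s', hs'⟩ := exists_fractionRing_extension (FractionRing B) hs
  have hN : Function.Injective (TensorProduct.mk B (FractionRing B) N 1) := by
    refine (injective_iff_map_eq_zero _).2 fun n hn => ?_
    have : IsLocalizedModule (nonZeroDivisors B) (TensorProduct.mk B (FractionRing B) N 1) :=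
      (isLocalizedModule_iff_isBaseChange (nonZeroDivisors B) (FractionRing B) _).2
        (TensorProduct.isBaseChange B N (FractionRing B))
    obtain ⟨c, hc⟩ := (IsLocalizedModule.eq_zero_iff (nonZeroDivisors B)
      (TensorProduct.mk B (FractionRing B) N 1)).1 hn
    exact (smul_eq_zero.1 hc).resolve_left (nonZeroDivisors.ne_zero c.2)
  intro x y hxy
  exact hN (injective_of_span_range_eq_top_of_field (hS.span_range_semilinearBaseChange hs')
    (by simp [hxy]))

variable (F) in
theorem HasFullRankImage.exists_dualBasis_span_range [Module.Finite B N] [Module.Projective B N]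
    (hs : Function.Injective s) {S : N →ₛₗ[s] N} (hS : HasFullRankImage S) :
    ∃ (m : ℕ) (e : Fin m → N) (φ : Fin m → N →ₗ[B] F),
      ∀ n ∈ Submodule.span B (Set.range S), ∃ c : Fin m → B,
        (∀ i, φ i n = algebraMap B F (c i)) ∧ n = ∑ i, c i • S (e i) := by
  obtain ⟨m, e, g, hdual⟩ := exists_dualBasis B N
  let ψ (i : Fin m) : N →ₛₗ[s] B :=
    { toFun := fun n => s (g i n), map_add' := by simp, map_smul' := by simp }
  choose φ hφ using fun i => hS.exists_linearMap_comp_eq F hs (ψ i)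
  refine ⟨m, e, φ, fun n hn => ?_⟩
  induction hn using Submodule.span_induction with
  | mem y hy =>
    obtain ⟨n, rfl⟩ := hy
    refine ⟨fun i => ψ i n, fun i => hφ i n, ?_⟩
    conv_lhs => rw [hdual n, map_sum]
    exact Finset.sum_congr rfl fun i _ => map_smulₛₗ _ _ _
  | zero => exact ⟨0, by simp, by simp⟩
  | add y z _ _ hy hz =>
    obtain ⟨c, hc, hc'⟩ := hy
    obtain ⟨d, hd, hd'⟩ := hz
    refine ⟨c + d, fun i => by simp [hc, hd], ?_⟩
    conv_lhs => rw [hc', hd']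
    simp [add_smul, Finset.sum_add_distrib]
  | smul r y _ hy =>
    obtain ⟨c, hc, hc'⟩ := hy
    refine ⟨r • c, fun i => by simp [hc, Algebra.smul_def], ?_⟩
    conv_lhs => rw [hc']
    simp [Finset.smul_sum, smul_smul]

theorem HasFullRankImage.mem_span_range [Module.Finite B N] [Module.Projective B N]
    (hs : Function.Injective s) {S : N →ₛₗ[s] N} (hS : HasFullRankImage S) {a b : B} (ha : a ≠ 0)
    (hab : ∀ y, a ∣ b * y → a ∣ y) {n : N} (han : a • n ∈ Submodule.span B (Set.range S))
    (hbn : b • n ∈ Submodule.span B (Set.range S)) : n ∈ Submodule.span B (Set.range S) := by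
  let F := FractionRing B
  obtain ⟨m, e, φ, hφ⟩ := hS.exists_dualBasis_span_range F hs
  obtain ⟨c, hc, hac⟩ := hφ _ han
  obtain ⟨d, hd, -⟩ := hφ _ hbn
  have hdvd (i) : a ∣ c i := by
    refine hab _ ⟨d i, IsFractionRing.injective B F ?_⟩
    rw [map_mul, map_mul, ← hc, ← hd, map_smul, map_smul, Algebra.smul_def, Algebra.smul_def]
    ring
  choose r hr using hdvd
  have hn : n = ∑ i, r i • S (e i) := by
    refine smul_right_injective N ha (hac.trans ?_)
    simp only [hr, mul_smul, Finset.smul_sum]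
  rw [hn]
  exact Submodule.sum_mem _ fun i _ => Submodule.smul_mem _ _ (Submodule.subset_span ⟨_, rfl⟩)

end Semilinear

/-! ### Arithmetic of `O[x, 1/P(x), 1/P(qx), …]` -/

section Arithmetic

theorem coeff_zero_pow_mul_coeff_eq_zero {R : Type*} [CommRing R] {g f : R[X]} (h : g * f = 0)
    (n : ℕ) : g.coeff 0 ^ (n + 1) * f.coeff n = 0 := by
  induction n using Nat.strong_induction_on with
  | _ n ih =>
    have h1 := congrArg (fun p : R[X] => g.coeff 0 ^ n * p.coeff n) h
    simp only [coeff_mul, coeff_zero, mul_zero] at h1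
    rw [Finset.mul_sum, Finset.sum_eq_single (0, n)] at h1
    · rw [pow_succ, mul_assoc]; exact h1
    · rintro ⟨i, j⟩ hij hne
      have hij' := Finset.HasAntidiagonal.mem_antidiagonal.1 hij
      have hj : j < n := by
        by_contra hj
        exact hne (by ext <;> simp only at hij' ⊢ <;> omega)
      obtain ⟨r, hr⟩ : ∃ r, n = j + 1 + r := ⟨n - (j + 1), by omega⟩
      have := ih j hj
      calc g.coeff 0 ^ n * (g.coeff i * f.coeff j)
          = g.coeff 0 ^ r * g.coeff i * (g.coeff 0 ^ (j + 1) * f.coeff j) := by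
            rw [hr, pow_add]; ring
        _ = 0 := by rw [this, mul_zero]
    · intro h
      exact absurd (Finset.HasAntidiagonal.mem_antidiagonal.2 (zero_add n)) h

variable {O : Type u} [CommRing O] (q : O) (P : O[X])

theorem coeff_shift (p : O[X]) (n : ℕ) : (shift q p).coeff n = p.coeff n * q ^ n := by
  simp [shift, Polynomial.comp_C_mul_X_coeff]

theorem exists_pow_mul_eq_shift (p : O[X]) : ∃ (n : ℕ) (p' : O[X]), C (q ^ n) * p = shift q p' := by
  refine ⟨p.natDegree, ∑ i ∈ Finset.range (p.natDegree + 1),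
    monomial i (p.coeff i * q ^ (p.natDegree - i)), ?_⟩
  ext n
  rw [coeff_shift, finsetSum_coeff, coeff_C_mul]
  simp only [coeff_monomial]
  rw [Finset.sum_ite_eq']
  split_ifs with h
  · have : q ^ p.natDegree = q ^ (p.natDegree - n) * q ^ n := by
      rw [← pow_add]; congr 1; have := Finset.mem_range.1 h; omega
    rw [this]; ring
  · rw [coeff_eq_zero_of_natDegree_lt (by simpa using h)]; simp

variable {q P}

theorem QAlg.sig_algebraMap (p : O[X]) : QAlg.sig q P (algebraMap O[X] (QAlg q P) p) =
    algebraMap O[X] (QAlg q P) (shift q p) := sigQ_algebraMap _ _ _ _ p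

/-- The element `x` of `O[x, 1/P(x), 1/P(qx), …]`. -/
abbrev QAlg.varX (q : O) (P : O[X]) : QAlg q P := algebraMap O[X] (QAlg q P) X

/-- The element `q` of `O[x, 1/P(x), 1/P(qx), …]`. -/
abbrev QAlg.constQ (q : O) (P : O[X]) : QAlg q P := algebraMap O[X] (QAlg q P) (C q)

theorem QAlg.varX_dvd_sig_sub (a : QAlg q P) : QAlg.varX q P ∣ QAlg.sig q P a - a := by
  have hp : ∀ p : O[X], QAlg.varX q P ∣ algebraMap O[X] (QAlg q P) (shift q p) -
      algebraMap O[X] (QAlg q P) p := by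
    intro p
    rw [← map_sub]
    refine map_dvd _ (X_dvd_iff.2 ?_)
    rw [coeff_sub, coeff_shift]
    simp
  obtain ⟨p, s, rfl⟩ := IsLocalization.exists_mk'_eq (denoms q P) a
  set a := IsLocalization.mk' (QAlg q P) p s
  have hs : a * algebraMap O[X] (QAlg q P) s = algebraMap O[X] (QAlg q P) p :=
    IsLocalization.mk'_spec (QAlg q P) p s
  have hu : IsUnit (algebraMap O[X] (QAlg q P) (shift q s)) :=
    IsLocalization.map_units (QAlg q P) (⟨_, isStable_denoms q P s.2⟩ : denoms q P)
  have h1 : QAlg.sig q P a * algebraMap O[X] (QAlg q P) (shift q s) =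
      algebraMap O[X] (QAlg q P) (shift q p) := by
    rw [← QAlg.sig_algebraMap, ← QAlg.sig_algebraMap, ← map_mul, hs]
  refine hu.dvd_mul_right.1 ?_
  have : (QAlg.sig q P a - a) * algebraMap O[X] (QAlg q P) (shift q s) =
      (algebraMap O[X] (QAlg q P) (shift q p) - algebraMap O[X] (QAlg q P) p) -
      a * (algebraMap O[X] (QAlg q P) (shift q s) - algebraMap O[X] (QAlg q P) s) := by
    rw [sub_mul, h1, mul_sub, hs]; ring
  rw [this]
  exact dvd_sub (hp p) (Dvd.dvd.mul_left (hp s) a)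

theorem QAlg.isUnit_mk_coeff_zero {s : O[X]} (hs : s ∈ denoms q P) :
    IsUnit (Ideal.Quotient.mk (Ideal.span {QAlg.constQ q P})
      (algebraMap O[X] (QAlg q P) (C (s.coeff 0)))) := by
  induction hs using Submonoid.closure_induction with
  | mem y hy =>
    obtain ⟨i, rfl⟩ := hy
    simp only [coeff_shift, pow_zero, mul_one]
    have hu : IsUnit (algebraMap O[X] (QAlg q P) (shift q P)) :=
      IsLocalization.map_units (QAlg q P)
        (⟨_, Submonoid.subset_closure ⟨1, by simp⟩⟩ : denoms q P)
    have hmk : Ideal.Quotient.mk (Ideal.span {QAlg.constQ q P})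
        (algebraMap O[X] (QAlg q P) (C (P.coeff 0))) = Ideal.Quotient.mk
          (Ideal.span {QAlg.constQ q P}) (algebraMap O[X] (QAlg q P) (shift q P)) := by
      rw [eq_comm, Ideal.Quotient.mk_eq_mk_iff_sub_mem, Ideal.mem_span_singleton, ← map_sub]
      refine map_dvd _ ((C_dvd_iff_dvd_coeff _ _).2 fun n => ?_)
      rw [coeff_sub, coeff_shift, coeff_C]
      rcases n with _ | n
      · simp
      · simp only [Nat.succ_ne_zero, if_false, sub_zero]
        exact Dvd.dvd.mul_left (dvd_pow_self q (Nat.succ_ne_zero n)) _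
    rw [hmk]
    exact hu.map _
  | one => simp
  | mul a b _ _ ha hb =>
    rw [mul_coeff_zero, C_mul, map_mul, map_mul]
    exact ha.mul hb

theorem C_dvd_of_C_dvd_mul {g f : O[X]} (h : C q ∣ g * f) :
    C q ∣ C (g.coeff 0 ^ (f.natDegree + 1)) * f := by
  have hmod : (g.map (Ideal.Quotient.mk (Ideal.span {q}))) *
      (f.map (Ideal.Quotient.mk (Ideal.span {q}))) = 0 := by
    obtain ⟨r, hr⟩ := h
    rw [← Polynomial.map_mul, hr, Polynomial.map_mul, Polynomial.map_C,
      Ideal.Quotient.eq_zero_iff_mem.2 (Ideal.mem_span_singleton_self q), C_0, zero_mul]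
  rw [C_dvd_iff_dvd_coeff]
  intro n
  rw [coeff_C_mul]
  by_cases hn : n ≤ f.natDegree
  · have hdvd := coeff_zero_pow_mul_coeff_eq_zero hmod n
    rw [coeff_map, coeff_map, ← map_pow, ← map_mul, Ideal.Quotient.eq_zero_iff_mem,
      Ideal.mem_span_singleton] at hdvd
    exact hdvd.trans (mul_dvd_mul_right (pow_dvd_pow _ (by omega)) _)
  · rw [coeff_eq_zero_of_natDegree_lt (p := f) (by omega), mul_zero]
    exact dvd_zero _

variable (q P) in
theorem QAlg.isNoetherianRing [IsNoetherianRing O] : IsNoetherianRing (QAlg q P) :=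
  IsLocalization.isNoetherianRing (denoms q P) _ inferInstance

variable [IsDomain O]

variable (q P) in
theorem denoms_le_nonZeroDivisors (hq : q ≠ 0) (hP : P ≠ 0) :
    denoms q P ≤ nonZeroDivisors O[X] := by
  refine (Submonoid.closure_le).2 ?_
  rintro _ ⟨i, rfl⟩
  exact mem_nonZeroDivisors_of_ne_zero (shift_ne_zero (pow_ne_zero i hq) hP)

theorem QAlg.algebraMap_injective (hq : q ≠ 0) (hP : P ≠ 0) :
    Function.Injective (algebraMap O[X] (QAlg q P)) :=
  IsLocalization.injective _ (denoms_le_nonZeroDivisors q P hq hP)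

theorem QAlg.isDomain (hq : q ≠ 0) (hP : P ≠ 0) : IsDomain (QAlg q P) :=
  IsLocalization.isDomain_of_le_nonZeroDivisors _ (denoms_le_nonZeroDivisors q P hq hP)

theorem QAlg.sig_injective (hq : q ≠ 0) (hP : P ≠ 0) : Function.Injective (QAlg.sig q P) := by
  have := QAlg.isDomain hq hP
  rw [injective_iff_map_eq_zero]
  intro a ha
  obtain ⟨p, s, rfl⟩ := IsLocalization.exists_mk'_eq (denoms q P) a
  have h1 : QAlg.sig q P (algebraMap O[X] (QAlg q P) p) = 0 := by
    rw [← IsLocalization.mk'_spec (QAlg q P) p s, map_mul, ha, zero_mul]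
  rw [QAlg.sig_algebraMap, map_eq_zero_iff _ (QAlg.algebraMap_injective hq hP)] at h1
  have hp : p = 0 := by
    by_contra hp
    exact shift_ne_zero hq hp h1
  rw [hp, IsLocalization.mk'_zero]

theorem QAlg.constQ_dvd_of_dvd_mul (hq : q ≠ 0) (hP : P ≠ 0) {a c : QAlg q P}
    (h : QAlg.constQ q P ∣ (1 + QAlg.varX q P * c) * a) : QAlg.constQ q P ∣ a := by
  obtain ⟨⟨p, s⟩, hc⟩ := IsLocalization.surj (denoms q P) c
  obtain ⟨⟨f, t⟩, ha⟩ := IsLocalization.surj (denoms q P) a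
  obtain ⟨y, hy⟩ := h
  obtain ⟨⟨r, u⟩, hr⟩ := IsLocalization.surj (denoms q P) y
  simp only at hc ha hr
  let g := (u : O[X]) * ((s : O[X]) + X * p)
  have hg : C q ∣ g * f := by
    refine ⟨(s : O[X]) * t * r, QAlg.algebraMap_injective hq hP ?_⟩
    simp only [g, map_mul, map_add]
    rw [← hc, ← ha, ← hr]
    linear_combination (algebraMap O[X] (QAlg q P) s) * (algebraMap O[X] (QAlg q P) t) *
      (algebraMap O[X] (QAlg q P) u) * hy
  have hg0 : g.coeff 0 = ((u * s : denoms q P) : O[X]).coeff 0 := by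
    simp [g, mul_coeff_zero]
  have hunit : IsUnit (Ideal.Quotient.mk (Ideal.span {QAlg.constQ q P})
      (algebraMap O[X] (QAlg q P) (C (g.coeff 0 ^ (f.natDegree + 1))))) := by
    rw [C_pow, map_pow, map_pow, hg0]
    exact (QAlg.isUnit_mk_coeff_zero (u * s).2).pow _
  have hf : QAlg.constQ q P ∣ algebraMap O[X] (QAlg q P) f := by
    have hdvd := map_dvd (algebraMap O[X] (QAlg q P)) (C_dvd_of_C_dvd_mul hg)
    rw [map_mul, ← Ideal.mem_span_singleton, ← Ideal.Quotient.eq_zero_iff_mem, map_mul] at hdvd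
    rw [← Ideal.mem_span_singleton, ← Ideal.Quotient.eq_zero_iff_mem]
    exact hunit.mul_right_eq_zero.1 hdvd
  rw [← ha] at hf
  exact (IsLocalization.map_units (QAlg q P) t).dvd_mul_right.1 hf

theorem QAlg.constQ_pow_dvd_of_dvd_mul (hq : q ≠ 0) (hP : P ≠ 0) {a c : QAlg q P} (n : ℕ)
    (h : QAlg.constQ q P ^ n ∣ (1 + QAlg.varX q P * c) * a) : QAlg.constQ q P ^ n ∣ a := by
  have := QAlg.isDomain hq hP
  have hq0 : QAlg.constQ q P ≠ 0 := by
    rwa [Ne, map_eq_zero_iff _ (QAlg.algebraMap_injective hq hP), C_eq_zero]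
  induction n generalizing a with
  | zero => simp
  | succ n ih =>
    obtain ⟨b, rfl⟩ := QAlg.constQ_dvd_of_dvd_mul hq hP ((dvd_pow_self _ n.succ_ne_zero).trans h)
    rw [pow_succ'] at h ⊢
    rw [mul_left_comm] at h
    exact mul_dvd_mul_left _ (ih ((mul_dvd_mul_iff_left hq0).1 h))

end Arithmetic

/-! ### Lattices stable under the connection -/

theorem map_eq_of_map_le_of_surjective {R M : Type*} [Ring R] [AddCommGroup M] [Module R M]
    [IsNoetherian R M] {S : M →ₗ[R] M} (hS : Function.Surjective S) {L : Submodule R M}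
    (hL : L.map S ≤ L) : L.map S = L := by
  have hmono : Monotone fun n : ℕ => L.comap (S ^ n) := by
    refine monotone_nat_of_le_succ fun n x hx => ?_
    rw [Submodule.mem_comap, pow_succ']
    exact Submodule.map_le_iff_le_comap.1 hL hx
  obtain ⟨n, hn⟩ := monotone_stabilizes_iff_noetherian.2 ‹IsNoetherian R M› ⟨_, hmono⟩
  have hn' : L.comap (S ^ n) = L.comap (S ^ (n + 1)) := hn (n + 1) n.le_succ
  have hsurj (m : ℕ) : Function.Surjective (S ^ m) := by
    rw [Module.End.coe_pow]
    exact hS.iterate m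
  calc L.map S = ((L.comap (S ^ n)).map (S ^ n)).map S := by
        rw [Submodule.map_comap_eq_of_surjective (hsurj n)]
    _ = (L.comap (S ^ (n + 1))).map (S ^ (n + 1)) := by
        rw [← hn', ← Submodule.map_comp, pow_succ' S n]
        rfl
    _ = L := Submodule.map_comap_eq_of_surjective (hsurj (n + 1)) L

section Sig

variable {B : Type u} [CommRing B] {D : GenDiffRing B}

/-- The operator `Σ` as a semilinear map. -/
def Obj.sigLin (N : Obj D) : N →ₛₗ[D.sig] N where
  toFun := N.sig
  map_add' := map_add _
  map_smul' := N.sig_smul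

@[simp] theorem Obj.sigLin_apply (N : Obj D) (n : N) : N.sigLin n = N.sig n := rfl

theorem Obj.span_range_sigLin (N : Obj D) : Submodule.span B (Set.range N.sigLin) = ⊤ :=
  N.span_eq_top

theorem Obj.sig_mem_of_del_mem {T : Obj D} {L : Submodule B T} (hΔ : ∀ t ∈ L, T.del t ∈ L) {t : T}
    (ht : t ∈ L) : T.sig t ∈ L :=
  L.add_mem ht (L.smul_mem _ (hΔ t ht))

theorem Obj.mem_of_sig_mem [IsDomain B] (hs : Function.Injective D.sig) {T : Obj D}
    {L : Submodule B T} (hL : IsSaturated L) (hΔ : ∀ t ∈ L, T.del t ∈ L) {t : T}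
    (ht : T.sig t ∈ L) : t ∈ L := by
  have := hL.isTorsionFree_quotient
  let S := L.mapQ L T.sigLin fun t ht => Obj.sig_mem_of_del_mem hΔ ht
  have hS : Submodule.span B (Set.range S) = ⊤ := by
    have h1 : Submodule.map L.mkQ (Submodule.span B (Set.range T.sigLin)) ≤
        Submodule.span B (Set.range S) := by
      rw [Submodule.map_span, Submodule.span_le]
      rintro _ ⟨_, ⟨t, rfl⟩, rfl⟩
      exact Submodule.subset_span ⟨L.mkQ t, rfl⟩
    rwa [T.span_range_sigLin, Submodule.map_top, Submodule.range_mkQ, top_le_iff] at h1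
  have hrank : HasFullRankImage S := fun n => ⟨1, one_ne_zero, by rw [hS]; trivial⟩
  rw [← Submodule.Quotient.mk_eq_zero]
  exact (injective_iff_map_eq_zero S).1 (hrank.injective hs) _
    ((Submodule.Quotient.mk_eq_zero L).2 ht)

/-- The restriction of `Σ` to a submodule stable under `Δ`. -/
def Obj.sigRestrict {T : Obj D} {L : Submodule B T} (hΔ : ∀ t ∈ L, T.del t ∈ L) : L →ₛₗ[D.sig] L :=
  T.sigLin.restrict fun _ ht => Obj.sig_mem_of_del_mem hΔ ht

theorem Obj.mem_span_sig_image_iff {T : Obj D} {L : Submodule B T} (hΔ : ∀ t ∈ L, T.del t ∈ L)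
    {l : L} : (l : T) ∈ Submodule.span B (T.sig '' L) ↔
      l ∈ Submodule.span B (Set.range (Obj.sigRestrict hΔ)) := by
  have himage : T.sig '' L = L.subtype '' Set.range (Obj.sigRestrict hΔ) := by
    ext t
    constructor
    · rintro ⟨l, hl, rfl⟩
      exact ⟨_, ⟨⟨l, hl⟩, rfl⟩, rfl⟩
    · rintro ⟨_, ⟨l, rfl⟩, rfl⟩
      exact ⟨l, l.2, rfl⟩
  rw [himage, ← Submodule.map_span]
  exact Function.Injective.mem_set_image L.subtype_injective

/-- Saturated submodules stable under `Δ` are lattices: every such submodule `L` of a module with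
connection is projective and generated by `Σ(L)`, hence again a module with connection. -/
def HasLattices (D : GenDiffRing B) : Prop :=
  ∀ (T : Obj D) (L : Submodule B T), IsSaturated L → (∀ t ∈ L, T.del t ∈ L) →
    Module.Projective B L ∧ L ≤ Submodule.span B (T.sig '' L)

end Sig

section QAlg

variable {O : Type u} [CommRing O] {q : O} {P : O[X]} {D : GenDiffRing (QAlg q P)}

theorem exists_smul_sig_eq_sig (hD : D.sig = QAlg.sig q P) {T : Obj D} (p : O[X]) (t : T) :
    ∃ (n : ℕ) (t' : T),
      (QAlg.constQ q P ^ n * algebraMap O[X] (QAlg q P) p) • T.sig t = T.sig t' := by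
  obtain ⟨n, p', hp⟩ := exists_pow_mul_eq_shift q p
  refine ⟨n, algebraMap O[X] (QAlg q P) p' • t, ?_⟩
  rw [T.sig_smul, hD, QAlg.sig_algebraMap, ← hp, map_mul, C_pow, map_pow]

theorem exists_smul_eq_sig (hD : D.sig = QAlg.sig q P) (T : Obj D) (t : T) :
    ∃ (n : ℕ) (s : denoms q P) (t' : T),
      (QAlg.constQ q P ^ n * algebraMap O[X] (QAlg q P) s) • t = T.sig t' := by
  have ht : t ∈ Submodule.span (QAlg q P) (Set.range T.sigLin) := by
    rw [T.span_range_sigLin]; trivial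
  induction ht using Submodule.span_induction with
  | mem x hx =>
    obtain ⟨y, rfl⟩ := hx
    exact ⟨0, 1, y, by simp⟩
  | zero => exact ⟨0, 1, 0, by simp⟩
  | add x y _ _ hx hy =>
    obtain ⟨n, s, x', hx'⟩ := hx
    obtain ⟨m, r, y', hy'⟩ := hy
    obtain ⟨i, x'', hx''⟩ := exists_smul_sig_eq_sig hD r x'
    obtain ⟨j, y'', hy''⟩ := exists_smul_sig_eq_sig hD s y'
    refine ⟨n + m + i + j, s * r, QAlg.constQ q P ^ (m + j) • x'' +
      QAlg.constQ q P ^ (n + i) • y'', ?_⟩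
    have hqs : ∀ k, D.sig (QAlg.constQ q P ^ k) = QAlg.constQ q P ^ k := fun k => by
      rw [hD, map_pow, QAlg.sig_algebraMap, shift_C]
    rw [map_add, T.sig_smul, T.sig_smul, hqs, hqs, ← hx'', ← hy'', ← hx', ← hy', smul_add,
      smul_smul, smul_smul, smul_smul, smul_smul, Submonoid.coe_mul, map_mul]
    congr 2 <;> ring
  | smul a x _ hx =>
    obtain ⟨n, s, x', hx'⟩ := hx
    obtain ⟨⟨p, r⟩, ha⟩ := IsLocalization.surj (denoms q P) a
    obtain ⟨m, y, hy⟩ := exists_smul_sig_eq_sig hD p x'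
    refine ⟨n + m, s * r, y, ?_⟩
    rw [← hy, ← hx', smul_smul, smul_smul, Submonoid.coe_mul, map_mul, ← ha]
    congr 1
    ring

/-- The submodule `x T` of `T`. -/
abbrev Obj.varXSmul (T : Obj D) : Submodule (QAlg q P) T :=
  LinearMap.range (LinearMap.lsmul (QAlg q P) T (QAlg.varX q P))

theorem Obj.mk_sig_smul (hD : D.sig = QAlg.sig q P) (T : Obj D) (a : QAlg q P) (t : T) :
    T.varXSmul.mkQ (T.sig (a • t)) = a • T.varXSmul.mkQ (T.sig t) := by
  obtain ⟨c, hc⟩ := QAlg.varX_dvd_sig_sub a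
  rw [T.sig_smul, ← map_smul T.varXSmul.mkQ, ← sub_eq_zero, ← map_sub, ← sub_smul, hD, hc, mul_smul]
  exact (Submodule.Quotient.mk_eq_zero _).2 ⟨c • T.sig t, rfl⟩

/-- The operator induced by `Σ` on `T / x T`; it is linear because `σ(a) ≡ a` modulo `x`. -/
def Obj.sigModVarX (hD : D.sig = QAlg.sig q P) (T : Obj D) :
    (T ⧸ T.varXSmul) →ₗ[QAlg q P] (T ⧸ T.varXSmul) :=
  T.varXSmul.liftQ
    { toFun := fun t => T.varXSmul.mkQ (T.sig t)
      map_add' := by simp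
      map_smul' := T.mk_sig_smul hD } (by
    rintro _ ⟨t, rfl⟩
    exact (T.mk_sig_smul hD _ t).trans ((Submodule.Quotient.mk_eq_zero _).2 ⟨T.sig t, rfl⟩))

theorem Obj.sigModVarX_mkQ (hD : D.sig = QAlg.sig q P) (T : Obj D) (t : T) :
    T.sigModVarX hD (T.varXSmul.mkQ t) = T.varXSmul.mkQ (T.sig t) := rfl

theorem Obj.sigModVarX_surjective (hD : D.sig = QAlg.sig q P) (T : Obj D) :
    Function.Surjective (T.sigModVarX hD) := by
  have hle : Submodule.span (QAlg q P) (Set.range T.sigLin) ≤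
      (LinearMap.range (T.sigModVarX hD)).comap T.varXSmul.mkQ := by
    rw [Submodule.span_le]
    rintro _ ⟨t, rfl⟩
    exact ⟨_, T.sigModVarX_mkQ hD t⟩
  rw [T.span_range_sigLin] at hle
  intro y
  obtain ⟨t, rfl⟩ := T.varXSmul.mkQ_surjective y
  exact hle (Submodule.mem_top (x := t))

section Stable

variable {T : Obj D} {L : Submodule (QAlg q P) T}

theorem exists_sig_add_smul [IsNoetherianRing (QAlg q P)] (hD : D.sig = QAlg.sig q P)
    (hΔ : ∀ t ∈ L, T.del t ∈ L) {l : T} (hl : l ∈ L) :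
    ∃ l' ∈ L, ∃ t, l = T.sig l' + QAlg.varX q P • t := by
  have hstable : (L.map T.varXSmul.mkQ).map (T.sigModVarX hD) ≤ L.map T.varXSmul.mkQ := by
    rintro _ ⟨_, ⟨t, ht, rfl⟩, rfl⟩
    exact ⟨T.sig t, Obj.sig_mem_of_del_mem hΔ ht, rfl⟩
  obtain ⟨_, ⟨l', hl', rfl⟩, h⟩ :=
    (map_eq_of_map_le_of_surjective (T.sigModVarX_surjective hD) hstable).ge ⟨l, hl, rfl⟩
  rw [T.sigModVarX_mkQ, eq_comm, ← sub_eq_zero, ← map_sub] at h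
  obtain ⟨t, ht⟩ := (Submodule.Quotient.mk_eq_zero _).1 h
  exact ⟨l', hl', t, sub_eq_iff_eq_add'.1 ht.symm⟩

variable [IsDomain O]

theorem exists_constQ_pow_smul_mem_span (hD : D.sig = QAlg.sig q P) (hq : q ≠ 0) (hP : P ≠ 0)
    (hL : IsSaturated L) (hΔ : ∀ t ∈ L, T.del t ∈ L) {l : T} (hl : l ∈ L) :
    ∃ n : ℕ, QAlg.constQ q P ^ n • l ∈ Submodule.span (QAlg q P) (T.sig '' L) := by
  have := QAlg.isDomain hq hP
  obtain ⟨n, s, t, ht⟩ := exists_smul_eq_sig hD T l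
  have htL : t ∈ L := Obj.mem_of_sig_mem (hD ▸ QAlg.sig_injective hq hP) hL hΔ
    (ht ▸ L.smul_mem _ hl)
  refine ⟨n, ?_⟩
  rw [mul_comm, mul_smul] at ht
  have hs := IsLocalization.map_units (QAlg q P) s
  exact (Submodule.smul_mem_iff_of_isUnit _ hs).1
    (ht ▸ Submodule.subset_span ⟨t, htL, rfl⟩)

theorem exists_one_add_smul_mem_span [IsNoetherianRing (QAlg q P)] (hD : D.sig = QAlg.sig q P)
    (hq : q ≠ 0) (hP : P ≠ 0) (hL : IsSaturated L) (hΔ : ∀ t ∈ L, T.del t ∈ L) :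
    ∃ c : QAlg q P, ∀ l ∈ L,
      (1 + QAlg.varX q P * c) • l ∈ Submodule.span (QAlg q P) (T.sig '' L) := by
  set K := Submodule.span (QAlg q P) (T.sig '' L)
  have hx : QAlg.varX q P ≠ 0 := by
    rw [Ne, map_eq_zero_iff _ (QAlg.algebraMap_injective hq hP)]
    exact X_ne_zero
  have hle : L.map K.mkQ ≤ Ideal.span {QAlg.varX q P} • L.map K.mkQ := by
    rintro _ ⟨l, hl, rfl⟩
    obtain ⟨l', hl', t, rfl⟩ := exists_sig_add_smul hD hΔ hl
    have htL : t ∈ L := hL _ t hx ((L.add_mem_iff_right (Obj.sig_mem_of_del_mem hΔ hl')).1 hl)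
    rw [map_add, map_smul, Submodule.mkQ_apply _ (T.sig l'),
      (Submodule.Quotient.mk_eq_zero K).2 (Submodule.subset_span ⟨l', hl', rfl⟩), zero_add]
    exact Submodule.smul_mem_smul (Ideal.mem_span_singleton_self _) ⟨t, htL, rfl⟩
  obtain ⟨r, hr, hr'⟩ := Submodule.exists_sub_one_mem_and_smul_eq_zero_of_fg_of_le_smul
    _ (L.map K.mkQ) (IsNoetherian.noetherian _) hle
  obtain ⟨c, hc⟩ := Ideal.mem_span_singleton.1 hr
  refine ⟨c, fun l hl => ?_⟩
  rw [← hc, add_sub_cancel, ← Submodule.Quotient.mk_eq_zero]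
  exact hr' _ ⟨l, hl, rfl⟩

theorem le_span_sig_image [IsNoetherianRing (QAlg q P)] (hD : D.sig = QAlg.sig q P) (hq : q ≠ 0)
    (hP : P ≠ 0) (hL : IsSaturated L) (hΔ : ∀ t ∈ L, T.del t ∈ L)
    [Module.Projective (QAlg q P) L] : L ≤ Submodule.span (QAlg q P) (T.sig '' L) := by
  have := QAlg.isDomain hq hP
  have hq0 : QAlg.constQ q P ≠ 0 := by
    rwa [Ne, map_eq_zero_iff _ (QAlg.algebraMap_injective hq hP), C_eq_zero]
  have hrank : HasFullRankImage (Obj.sigRestrict hΔ) := fun l => by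
    obtain ⟨n, hn⟩ := exists_constQ_pow_smul_mem_span hD hq hP hL hΔ l.2
    exact ⟨_, pow_ne_zero n hq0, (Obj.mem_span_sig_image_iff hΔ).1 hn⟩
  intro l hl
  obtain ⟨n, hn⟩ := exists_constQ_pow_smul_mem_span hD hq hP hL hΔ hl
  obtain ⟨c, hc⟩ := exists_one_add_smul_mem_span hD hq hP hL hΔ
  exact (Obj.mem_span_sig_image_iff hΔ (l := ⟨l, hl⟩)).2 <|
    hrank.mem_span_range (hD ▸ QAlg.sig_injective hq hP) (pow_ne_zero n hq0)
      (fun _ => QAlg.constQ_pow_dvd_of_dvd_mul hq hP n)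
      ((Obj.mem_span_sig_image_iff hΔ).1 hn) ((Obj.mem_span_sig_image_iff hΔ).1 (hc l hl))

end Stable

theorem hasLattices_of_isDedekindDomain [IsDedekindDomain O] (hD : D.sig = QAlg.sig q P)
    (hq : q ≠ 0) (hP : P ≠ 0) : HasLattices D := by
  have := QAlg.isDomain hq hP
  have := QAlg.isNoetherianRing q P
  intro T L hL hΔ
  have := IsSaturated.projective (denoms_le_nonZeroDivisors q P hq hP) (QAlg q P) hL
  exact ⟨this, le_span_sig_image hD hq hP hL hΔ⟩

end QAlg

/-! ### Isomorphisms and duals -/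

namespace Obj

section Basic

variable {B : Type u} [CommRing B] {D : GenDiffRing B}

/-- The relation of being isomorphic in the category of modules with connection. -/
def IsIso (N N' : Obj D) : Prop := ∃ e : N ≃ₗ[B] N', IsHom N N' e.toLinearMap

theorem isHom_id (N : Obj D) : IsHom N N LinearMap.id := fun _ => rfl

theorem IsHom.comp {N N' N'' : Obj D} {g : N' →ₗ[B] N''} {f : N →ₗ[B] N'} (hg : IsHom N' N'' g)
    (hf : IsHom N N' f) : IsHom N N'' (g ∘ₗ f) := fun n => by
  rw [LinearMap.comp_apply, LinearMap.comp_apply, hf, hg]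

theorem IsHom.symm {N N' : Obj D} {e : N ≃ₗ[B] N'} (he : IsHom N N' e.toLinearMap) :
    IsHom N' N e.symm.toLinearMap := fun n => by
  apply e.injective
  have := he (e.symm n)
  simp only [LinearEquiv.coe_coe, LinearEquiv.apply_symm_apply] at this ⊢
  exact this.symm

theorem IsHom.sig {N N' : Obj D} {f : N →ₗ[B] N'} (hf : IsHom N N' f) (n : N) :
    f (N.sig n) = N'.sig (f n) := by
  rw [sig_apply, sig_apply, map_add, map_smul, hf]

theorem IsIso.refl (N : Obj D) : IsIso N N := ⟨LinearEquiv.refl B N, fun _ => rfl⟩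

theorem IsIso.symm {N N' : Obj D} (h : IsIso N N') : IsIso N' N :=
  let ⟨e, he⟩ := h
  ⟨e.symm, he.symm⟩

theorem IsIso.trans {N N' N'' : Obj D} (h : IsIso N N') (h' : IsIso N' N'') : IsIso N N'' :=
  let ⟨e, he⟩ := h
  let ⟨e', he'⟩ := h'
  ⟨e.trans e', he'.comp he⟩

theorem isHom_fst (N N' : Obj D) : IsHom (N.prod N') N (LinearMap.fst B N N') := fun _ => rfl

theorem isHom_snd (N N' : Obj D) : IsHom (N.prod N') N' (LinearMap.snd B N N') := fun _ => rfl

theorem IsIso.prod {N N' M M' : Obj D} (h : IsIso N M) (h' : IsIso N' M') :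
    IsIso (N.prod N') (M.prod M') := by
  obtain ⟨e, he⟩ := h
  obtain ⟨e', he'⟩ := h'
  exact ⟨LinearEquiv.prodCongr e e', fun n => Prod.ext (he n.1) (he' n.2)⟩

theorem IsHom.tensor {N N' M M' : Obj D} {f : N →ₗ[B] M} {f' : N' →ₗ[B] M'} (hf : IsHom N M f)
    (hf' : IsHom N' M' f') : IsHom (N.tensor N') (M.tensor M') (TensorProduct.map f f') := by
  intro t
  change TensorProduct.map f f' (tensorDel N N' t) = tensorDel M M' (TensorProduct.map f f' t)
  induction t using TensorProduct.induction_on with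
  | zero => simp
  | tmul n n' => simp only [tensorDel_tmul, map_add, TensorProduct.map_tmul, hf n, hf' n', hf.sig]
  | add x y hx hy => simp only [map_add, hx, hy]

theorem IsIso.tensor {N N' M M' : Obj D} (h : IsIso N M) (h' : IsIso N' M') :
    IsIso (N.tensor N') (M.tensor M') := by
  obtain ⟨e, he⟩ := h
  obtain ⟨e', he'⟩ := h'
  exact ⟨TensorProduct.congr e e', he.tensor he'⟩

theorem IsHom.prol {N M : Obj D} {f : N →ₗ[B] M} (hf : IsHom N M f) :
    IsHom N.prol M.prol (Prol.map D.der f) := fun n => Prod.ext (hf n.1) (hf n.2)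

theorem IsIso.prol {N M : Obj D} (h : IsIso N M) : IsIso N.prol M.prol := by
  obtain ⟨e, he⟩ := h
  refine ⟨LinearEquiv.ofLinearMap (Prol.map D.der e.toLinearMap)
    (Prol.map D.der e.symm.toLinearMap) ?_ ?_, he.prol⟩
  · ext x
    exact Prod.ext (e.apply_symm_apply x.1) (e.apply_symm_apply x.2)
  · ext x
    exact Prod.ext (e.symm_apply_apply x.1) (e.symm_apply_apply x.2)

theorem ext_sig {N : Obj D} {X : Type*} [AddCommGroup X] [Module B X] {f g : N →ₗ[B] X}
    (h : ∀ n, f (N.sig n) = g (N.sig n)) : f = g := by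
  refine LinearMap.ext_on_range (v := N.sig) N.span_eq_top h

/-- The Leibniz rule for a pairing of modules with connection, which makes it a morphism
`N' ⊗ N → B`. -/
def IsFlat {N N' : Obj D} (p : N' →ₗ[B] N →ₗ[B] B) : Prop :=
  ∀ (f : N') (n : N), D.del (p f n) = p (N'.del f) n + p (N'.sig f) (N.del n)

theorem isFlat_iff {N N' : Obj D} {p : N' →ₗ[B] N →ₗ[B] B} :
    IsFlat p ↔ ∀ (f : N') (n : N), p (N'.del f) (N.sig n) = D.del (p f n) - p f (N.del n) := by
  refine forall₂_congr fun f n => ?_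
  rw [sig_apply, sig_apply, map_add, map_add, LinearMap.add_apply, map_smul, map_smul,
    LinearMap.smul_apply, eq_sub_iff_add_eq, eq_comm (a := D.del _), ← add_assoc]
  constructor <;> intro h <;> rw [← h] <;> abel

theorem IsDual.symm {N N' : Obj D} (h : IsDual N N') : IsDual N' N := by
  obtain ⟨p, hp, hp'⟩ := h
  refine ⟨p.flip, hp.flip, fun n f => ?_⟩
  have := isFlat_iff.1 hp' f n
  rw [LinearMap.flip_apply, LinearMap.flip_apply, LinearMap.flip_apply, this]
  abel

theorem IsDual.of_isIso {N N' M : Obj D} (h : IsDual N N') (e : IsIso M N) : IsDual M N' := by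
  obtain ⟨p, hp, hp'⟩ := h
  obtain ⟨e, he⟩ := e
  refine ⟨p.compl₁₂ (LinearEquiv.refl B N').toLinearMap e.toLinearMap, inferInstance,
    fun f n => ?_⟩
  have := hp' f (e n)
  simp only [LinearMap.compl₁₂_apply, LinearEquiv.coe_coe, LinearEquiv.refl_apply]
  rw [this]
  congr 2
  exact (he n).symm

theorem exists_transpose {N N' M M' : Obj D} {p : N' →ₗ[B] N →ₗ[B] B} {r : M' →ₗ[B] M →ₗ[B] B}
    (hp : p.IsPerfPair) (hp' : IsFlat p) (hr' : IsFlat r) {f : N →ₗ[B] M} (hf : IsHom N M f) :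
    ∃ t : M' →ₗ[B] N', IsHom M' N' t ∧ ∀ m n, p (t m) n = r m (f n) := by
  let t : M' →ₗ[B] N' := p.toPerfPair.symm.toLinearMap ∘ₗ (LinearMap.lcomp B B f) ∘ₗ r
  have ht : ∀ m n, p (t m) n = r m (f n) := fun m n => by simp [t]
  refine ⟨t, fun m => ?_, ht⟩
  apply hp.bijective_left.1
  refine ext_sig fun n => ?_
  rw [ht, isFlat_iff.1 hp', ht, ht, hf.sig, isFlat_iff.1 hr', hf]

theorem IsDual.unique {N N' N'' : Obj D} (h : IsDual N N') (h' : IsDual N N'') : IsIso N' N'' := by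
  obtain ⟨p, hp, hp'⟩ := h
  obtain ⟨r, hr, hr'⟩ := h'
  obtain ⟨t, ht, hpt⟩ := exists_transpose hr hr' hp' (f := LinearMap.id) fun _ => rfl
  obtain ⟨t', _, hpt'⟩ := exists_transpose hp hp' hr' (f := LinearMap.id) fun _ => rfl
  refine ⟨LinearEquiv.ofLinearMap t t' ?_ ?_, ht⟩
  · ext x
    apply hr.bijective_left.1
    ext n
    simp [hpt, hpt']
  · ext x
    apply hp.bijective_left.1
    ext n
    simp [hpt, hpt']

end Basic

section Dual

variable {B : Type u} [CommRing B] [IsDomain B] {D : GenDiffRing B}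

theorem exists_dualDel (hσ : Function.Injective D.sig) (N : Obj D) :
    ∃ d : Module.Dual B N →+ Module.Dual B N,
      ∀ f n, d f (N.sig n) = D.del (f n) - f (N.del n) := by
  let ψ (f : Module.Dual B N) : N →ₛₗ[D.sig] B :=
    { toFun := fun n => D.del (f n) - f (N.del n)
      map_add' := fun x y => by simp only [map_add]; abel
      map_smul' := fun b n => by
        rw [map_smul, smul_eq_mul, D.del_mul, N.leibniz, map_add, map_smul, map_smul, smul_eq_mul,
          smul_eq_mul, smul_eq_mul]
        ring }
  choose d hd using fun f =>
    exists_linearMap_comp_eq_of_span_range_eq_top hσ N.span_range_sigLin (ψ f)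
  have hd (f n) : d f (N.sig n) = D.del (f n) - f (N.del n) := hd f n
  refine ⟨AddMonoidHom.mk' d fun f g => ext_sig fun n => ?_, hd⟩
  rw [LinearMap.add_apply, hd, hd, hd, LinearMap.add_apply, LinearMap.add_apply, map_add]
  abel

variable (hσ : Function.Injective D.sig) (N : Obj D)

/-- The dual connection on `Hom_B(N, B)`: the one for which evaluation is flat. -/
def dualDel : Module.Dual B N →+ Module.Dual B N :=
  (exists_dualDel hσ N).choose

theorem dualDel_apply_sig (f : Module.Dual B N) (n : N) :
    dualDel hσ N f (N.sig n) = D.del (f n) - f (N.del n) :=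
  (exists_dualDel hσ N).choose_spec f n

theorem dualDel_smul (b : B) (f : Module.Dual B N) :
    dualDel hσ N (b • f) = D.del b • f + D.sig b • dualDel hσ N f := ext_sig fun n => by
  rw [dualDel_apply_sig, LinearMap.add_apply, LinearMap.smul_apply, LinearMap.smul_apply,
    LinearMap.smul_apply, LinearMap.smul_apply, dualDel_apply_sig, sig_apply, map_add, map_smul f,
    D.sig_eq]
  simp only [smul_eq_mul, D.del_mul, D.sig_eq]
  ring

theorem add_smul_dualDel_apply_sig (f : Module.Dual B N) (n : N) :
    (f + D.h • dualDel hσ N f) (N.sig n) = D.sig (f n) := by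
  rw [LinearMap.add_apply, LinearMap.smul_apply, dualDel_apply_sig, sig_apply, map_add, map_smul,
    D.sig_eq]
  simp only [smul_eq_mul]
  ring

theorem span_range_add_smul_dualDel :
    Submodule.span B (Set.range fun f => f + D.h • dualDel hσ N f) = ⊤ := by
  refine eq_top_iff.2 fun f _ => ?_
  obtain ⟨m, e, g, hg⟩ := exists_dualBasis B N
  have hf : f = ∑ i, f (N.sig (e i)) • (g i + D.h • dualDel hσ N (g i)) := ext_sig fun n => by
    rw [LinearMap.sum_apply]
    simp only [LinearMap.smul_apply, add_smul_dualDel_apply_sig]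
    conv_lhs => rw [hg n, map_sum, map_sum]
    refine Finset.sum_congr rfl fun i _ => ?_
    rw [N.sig_smul, map_smul, smul_eq_mul, smul_eq_mul, mul_comm]
  rw [hf]
  exact Submodule.sum_mem _ fun i _ => Submodule.smul_mem _ _ (Submodule.subset_span ⟨g i, rfl⟩)

/-- The dual object, with underlying module `Hom_B(N, B)`. -/
def dual : Obj D where
  carrier := Module.Dual B N
  del := dualDel hσ N
  leibniz := dualDel_smul hσ N
  span_eq_top := span_range_add_smul_dualDel hσ N

theorem isDual_dual : IsDual N (dual hσ N) :=
  ⟨LinearMap.id, inferInstanceAs (LinearMap.id (R := B) (M := Module.Dual B N)).IsPerfPair,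
    isFlat_iff.2 (dualDel_apply_sig hσ N)⟩

end Dual

end Obj

/-! ### Base change -/

namespace Prol

section Basic

variable {B : Type u} [CommRing B] {d : Derivation ℤ B B} {V : Type v}

variable (d) in
/-- The element `a + ∂(b)` of the prolongation. -/
def mk (a b : V) : Prol d V := ((a, b) : V × V)

theorem ext {x y : Prol d V} (h1 : x.1 = y.1) (h2 : x.2 = y.2) : x = y := Prod.ext h1 h2

theorem mk_fst (a b : V) : (mk d a b).1 = a := rfl

theorem mk_snd (a b : V) : (mk d a b).2 = b := rfl

variable [AddCommGroup V]

theorem mk_add_mk (a b a' b' : V) : mk d a b + mk d a' b' = mk d (a + a') (b + b') := rfl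

variable [Module B V]

theorem smul_mk (r : B) (a b : V) : r • mk d a b = mk d (r • a - d r • b) (r • b) := rfl

theorem map_mk {W : Type w} [AddCommGroup W] [Module B W] (f : V →ₗ[B] W) (a b : V) :
    map d f (mk d a b) = mk d (f a) (f b) := rfl

theorem exact_inl_snd : Function.Exact (Prol.inl d V) (Prol.snd d V) := fun x =>
  ⟨fun hx => ⟨x.1, ext rfl hx.symm⟩, by rintro ⟨y, rfl⟩; rfl⟩

end Basic

variable {B : Type u} [CommRing B] {d : Derivation ℤ B B} {V : Type v} [AddCommGroup V]
  [Module B V] {R : Type w} [CommRing R] [Algebra B R] {dR : Derivation ℤ R R}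
  (hd : ∀ b, dR (algebraMap B R b) = algebraMap B R (d b))

theorem comparison_one_tmul (x : Prol d V) :
    comparison d dR hd ((1 : R) ⊗ₜ[B] x) = mk dR ((1 : R) ⊗ₜ[B] x.1) ((1 : R) ⊗ₜ[B] x.2) := by
  let _ : Module B (Prol dR (R ⊗[B] V)) := Module.compHom _ (algebraMap B R)
  have _ : IsScalarTower B R (Prol dR (R ⊗[B] V)) :=
    ⟨fun b r x => by rw [Algebra.smul_def, mul_smul]; rfl⟩
  have : comparison d dR hd ((1 : R) ⊗ₜ[B] x) =
      (1 : R) • mk dR ((1 : R) ⊗ₜ[B] x.1) ((1 : R) ⊗ₜ[B] x.2) :=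
    LinearMap.liftBaseChange_tmul _ _ _ _
  rw [this, one_smul]

theorem comparison_tmul (c : R) (x : Prol d V) :
    comparison d dR hd (c ⊗ₜ[B] x) = mk dR (c ⊗ₜ x.1 - dR c ⊗ₜ x.2) (c ⊗ₜ x.2) := by
  have : c ⊗ₜ[B] x = c • ((1 : R) ⊗ₜ[B] x) := by
    rw [TensorProduct.smul_tmul', smul_eq_mul, mul_one]
  rw [this, map_smul, comparison_one_tmul, smul_mk]
  simp only [TensorProduct.smul_tmul', smul_eq_mul, mul_one]

theorem comparison_snd (z : R ⊗[B] Prol d V) :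
    (comparison d dR hd z).2 = (Prol.snd d V).lTensor R z := by
  induction z using TensorProduct.induction_on with
  | zero => rw [map_zero, map_zero]; rfl
  | tmul c x => rw [comparison_tmul]; rfl
  | add x y hx hy => rw [map_add, map_add, ← hx, ← hy]; rfl

theorem comparison_lTensor_inl_fst (y : R ⊗[B] V) :
    (comparison d dR hd ((Prol.inl d V).lTensor R y)).1 = y := by
  induction y using TensorProduct.induction_on with
  | zero => rw [map_zero, map_zero]; rfl
  | tmul c x =>
    rw [LinearMap.lTensor_tmul, comparison_tmul, mk_fst]
    change c ⊗ₜ[B] x - dR c ⊗ₜ[B] (0 : V) = _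
    rw [TensorProduct.tmul_zero, sub_zero]
  | add x y hx hy =>
    rw [map_add, map_add]
    exact congrArg₂ (· + ·) hx hy

theorem comparison_injective : Function.Injective (comparison (V := V) d dR hd) := by
  rw [injective_iff_map_eq_zero]
  intro z hz
  obtain ⟨y, rfl⟩ := (lTensor_exact R exact_inl_snd (fun v => ⟨mk d 0 v, rfl⟩) z).1
    (by rw [← comparison_snd hd, hz]; rfl)
  have hy : y = 0 := by rw [← comparison_lTensor_inl_fst hd y, hz]; rfl
  rw [hy, map_zero]

theorem mk_zero_right_mem_range_comparison (y : R ⊗[B] V) :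
    mk dR y 0 ∈ LinearMap.range (comparison (V := V) d dR hd) := by
  induction y using TensorProduct.induction_on with
  | zero => exact zero_mem _
  | tmul c x =>
    refine ⟨c ⊗ₜ mk d x 0, ?_⟩
    rw [comparison_tmul, mk_fst, mk_snd, TensorProduct.tmul_zero, TensorProduct.tmul_zero,
      sub_zero]
  | add x y hx hy =>
    have := add_mem hx hy
    rwa [mk_add_mk, add_zero] at this

theorem mk_zero_left_mem_range_comparison (y : R ⊗[B] V) :
    mk dR 0 y ∈ LinearMap.range (comparison (V := V) d dR hd) := by
  induction y using TensorProduct.induction_on with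
  | zero => exact zero_mem _
  | tmul c x =>
    have h : comparison d dR hd (c ⊗ₜ mk d 0 x) ∈ LinearMap.range
      (comparison (V := V) d dR hd) := ⟨_, rfl⟩
    rw [comparison_tmul] at h
    have := add_mem h (mk_zero_right_mem_range_comparison hd (dR c ⊗ₜ x))
    rwa [mk_add_mk, mk_fst, mk_snd, TensorProduct.tmul_zero, add_zero, zero_sub,
      neg_add_cancel] at this
  | add x y hx hy =>
    have := add_mem hx hy
    rwa [mk_add_mk, add_zero] at this

theorem comparison_surjective : Function.Surjective (comparison (V := V) d dR hd) := fun x => by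
  have := add_mem (mk_zero_right_mem_range_comparison hd x.1)
    (mk_zero_left_mem_range_comparison hd x.2)
  rw [mk_add_mk, add_zero, zero_add] at this
  exact this

theorem comparison_bijective : Function.Bijective (comparison (V := V) d dR hd) :=
  ⟨comparison_injective hd, comparison_surjective hd⟩

end Prol

namespace Obj

variable {B : Type u} [CommRing B] {D : GenDiffRing B}

/-- The pure tensor `n ⊗ n'`, as an element of the object `N ⊗ N'`, on which elaboration finds the
connection. -/
def pureTensor {N N' : Obj D} (n : N) (n' : N') : N.tensor N' := (n ⊗ₜ[B] n' : N ⊗[B] N')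

theorem del_pureTensor {N N' : Obj D} (n : N) (n' : N') :
    (N.tensor N').del (pureTensor n n') =
      pureTensor (N.del n) n' + pureTensor (N.sig n) (N'.del n') := rfl

theorem tensor_induction {N N' : Obj D} {p : N.tensor N' → Prop} (t : N.tensor N')
    (zero : p 0) (tmul : ∀ n n', p (pureTensor n n')) (add : ∀ x y, p x → p y → p (x + y)) : p t :=
  TensorProduct.induction_on (motive := p) t zero tmul add

variable {F : Type u} [CommRing F] [Algebra B F] {E : GenDiffRing F} (hDE : D.IsMor E)

/-- The canonical map `N → F ⊗ N` from an object to its base change. -/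
def inc (N : Obj D) : N →+ N.baseChange hDE := (TensorProduct.mk B F N 1).toAddMonoidHom

theorem smul_inc {N : Obj D} (c : F) (n : N) : c • inc hDE N n = (c ⊗ₜ[B] n : F ⊗[B] N) := by
  change c • ((1 : F) ⊗ₜ[B] n) = _
  rw [TensorProduct.smul_tmul', smul_eq_mul, mul_one]

theorem inc_smul {N : Obj D} (b : B) (n : N) :
    inc hDE N (b • n) = algebraMap B F b • inc hDE N n := by
  rw [smul_inc]
  change (1 : F) ⊗ₜ[B] (b • n) = _
  rw [← TensorProduct.smul_tmul, Algebra.smul_def, mul_one]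

theorem del_inc {N : Obj D} (n : N) :
    (N.baseChange hDE).del (inc hDE N n) = inc hDE N (N.del n) := by
  change E.del 1 ⊗ₜ[B] n + E.sig 1 ⊗ₜ[B] N.del n = (1 : F) ⊗ₜ[B] N.del n
  rw [E.del_one, map_one, TensorProduct.zero_tmul, zero_add]

theorem sig_inc {N : Obj D} (n : N) :
    (N.baseChange hDE).sig (inc hDE N n) = inc hDE N (N.sig n) := by
  rw [sig_apply, sig_apply, del_inc, map_add, inc_smul, hDE.h]

theorem baseChange_induction {N : Obj D} {p : N.baseChange hDE → Prop} (t : N.baseChange hDE)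
    (zero : p 0) (smul : ∀ (c : F) n, p (c • inc hDE N n)) (add : ∀ x y, p x → p y → p (x + y)) :
    p t :=
  TensorProduct.induction_on (motive := p) t zero
    (fun c n => by rw [← smul_inc]; exact smul c n) add

theorem baseChange_ext {N : Obj D} {X : Type*} [AddCommGroup X] [Module F X]
    {f g : N.baseChange hDE →ₗ[F] X} (h : ∀ n, f (inc hDE N n) = g (inc hDE N n)) : f = g := by
  ext t
  induction t using baseChange_induction hDE with
  | zero => rw [map_zero, map_zero]
  | smul c n => rw [map_smul, map_smul, h]
  | add x y hx hy => rw [map_add, map_add, hx, hy]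

theorem isHom_of_inc {N : Obj D} {V : Obj E} (f : N.baseChange hDE →ₗ[F] V)
    (h : ∀ n, f (inc hDE N (N.del n)) = V.del (f (inc hDE N n))) :
    IsHom (N.baseChange hDE) V f := by
  intro t
  induction t using baseChange_induction hDE with
  | zero => simp only [map_zero]
  | smul c n =>
    rw [(N.baseChange hDE).leibniz, map_add, map_smul, map_smul, map_smul, V.leibniz, del_inc, h]
  | add x y hx hy => simp only [map_add, hx, hy]

/-- The base change of a morphism. -/
def baseChangeMap {N N' : Obj D} (f : N →ₗ[B] N') : N.baseChange hDE →ₗ[F] N'.baseChange hDE :=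
  f.baseChange F

theorem baseChangeMap_inc {N N' : Obj D} (f : N →ₗ[B] N') (n : N) :
    baseChangeMap hDE f (inc hDE N n) = inc hDE N' (f n) := LinearMap.baseChange_tmul ..

theorem isHom_baseChangeMap {N N' : Obj D} {f : N →ₗ[B] N'} (hf : IsHom N N' f) :
    IsHom (N.baseChange hDE) (N'.baseChange hDE) (baseChangeMap hDE f) :=
  isHom_of_inc hDE _ fun n => by rw [baseChangeMap_inc, baseChangeMap_inc, del_inc, hf]

/-- Base change preserves the unit object: `F ⊗ B ≃ F`. -/
def unitIso : (unit D).baseChange hDE ≃ₗ[F] unit E := AlgebraTensorModule.rid B F F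

theorem unitIso_inc (b : B) : unitIso hDE (inc hDE (unit D) b) = algebraMap B F b := by
  have : AlgebraTensorModule.rid B F F ((1 : F) ⊗ₜ[B] b) = algebraMap B F b := by
    simp [Algebra.smul_def]
  exact this

theorem isHom_unitIso : IsHom _ _ (unitIso hDE).toLinearMap :=
  isHom_of_inc hDE _ fun b => (unitIso_inc hDE (D.del b)).trans
    ((hDE.del b).trans (congrArg E.del (unitIso_inc hDE b)).symm)

/-- Base change preserves direct sums: `F ⊗ (N × N') ≃ (F ⊗ N) × (F ⊗ N')`. -/
def prodIso (N N' : Obj D) :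
    (N.prod N').baseChange hDE ≃ₗ[F] (N.baseChange hDE).prod (N'.baseChange hDE) :=
  TensorProduct.prodRight B F F N N'

theorem isHom_prodIso (N N' : Obj D) : IsHom _ _ (prodIso hDE N N').toLinearMap :=
  isHom_of_inc hDE _ fun n => Prod.ext (del_inc hDE n.1).symm (del_inc hDE n.2).symm

/-- Base change preserves tensor products: `F ⊗ (N ⊗ N') ≃ (F ⊗ N) ⊗ (F ⊗ N')`. -/
def tensorIso (N N' : Obj D) :
    (N.tensor N').baseChange hDE ≃ₗ[F] (N.baseChange hDE).tensor (N'.baseChange hDE) :=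
  AlgebraTensorModule.distribBaseChange B F N N'

theorem tensorIso_inc {N N' : Obj D} (n : N) (n' : N') :
    tensorIso hDE N N' (inc hDE _ (pureTensor n n')) = pureTensor (inc hDE N n) (inc hDE N' n') :=
  AlgebraTensorModule.distribBaseChange_tmul ..

theorem isHom_tensorIso (N N' : Obj D) : IsHom _ _ (tensorIso hDE N N').toLinearMap := by
  refine isHom_of_inc hDE _ fun t => ?_
  change tensorIso hDE N N' _ = Obj.del _ (tensorIso hDE N N' _)
  induction t using tensor_induction with
  | zero => simp only [map_zero]
  | tmul n n' =>
    rw [tensorIso_inc, del_pureTensor, del_pureTensor, map_add, map_add, tensorIso_inc,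
      tensorIso_inc, del_inc, del_inc, sig_inc]
  | add x y hx hy => simp only [map_add, hx, hy]

/-- Base change preserves prolongations: `F ⊗ F_∂(N) ≃ F_∂(F ⊗ N)`. -/
def prolIso (N : Obj D) : N.prol.baseChange hDE ≃ₗ[F] (N.baseChange hDE).prol :=
  LinearEquiv.ofBijective (Prol.comparison D.der E.der fun b => (hDE.der b).symm)
    (Prol.comparison_bijective _)

theorem prolIso_inc {N : Obj D} (a b : N) :
    prolIso hDE N (inc hDE N.prol (Prol.mk D.der a b)) =
      Prol.mk E.der (inc hDE N a) (inc hDE N b) :=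
  Prol.comparison_one_tmul (fun b => (hDE.der b).symm) _

theorem isHom_prolIso (N : Obj D) : IsHom _ _ (prolIso hDE N).toLinearMap := by
  refine isHom_of_inc hDE _ fun x => ?_
  refine (prolIso_inc hDE (N.del x.1) (N.del x.2)).trans ?_
  rw [← del_inc, ← del_inc]
  exact (congrArg (N.baseChange hDE).prol.del (prolIso_inc hDE x.1 x.2)).symm

end Obj

section Pairing

variable {B N N' : Type*} [CommRing B] [AddCommGroup N] [Module B N] [AddCommGroup N'] [Module B N']
  (F : Type*) [CommRing F] [Algebra B F]

theorem exists_dualBases_of_isPerfPair [Module.Finite B N] [Module.Projective B N]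
    (p : N' →ₗ[B] N →ₗ[B] B) [p.IsPerfPair] :
    ∃ (m : ℕ) (e : Fin m → N) (f : Fin m → N'),
      (∀ n, n = ∑ i, p (f i) n • e i) ∧ ∀ x, x = ∑ i, p x (e i) • f i := by
  obtain ⟨m, e, g, hg⟩ := exists_dualBasis B N
  let f (i : Fin m) : N' := p.toPerfPair.symm (g i)
  have hf (i n) : p (f i) n = g i n := by simp [f]
  refine ⟨m, e, f, fun n => by simpa only [hf] using hg n, fun x => ?_⟩
  apply (LinearMap.IsPerfPair.bijective_left p).1
  ext n
  simp only [map_sum, map_smul, LinearMap.sum_apply, LinearMap.smul_apply, hf, smul_eq_mul]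
  conv_lhs => rw [hg n, map_sum]
  simp only [map_smul, smul_eq_mul, mul_comm]

section DualBases

variable {p : N' →ₗ[B] N →ₗ[B] B} {m : ℕ} {e : Fin m → N} {f : Fin m → N'}

theorem bijective_of_dualBases (he : ∀ n, n = ∑ i, p (f i) n • e i)
    (hf : ∀ x, x = ∑ i, p x (e i) • f i) : Function.Bijective p := by
  constructor
  · rw [injective_iff_map_eq_zero]
    intro x hx
    rw [hf x, hx]
    simp
  · intro φ
    refine ⟨∑ i, φ (e i) • f i, LinearMap.ext fun n => ?_⟩
    conv_rhs => rw [he n, map_sum]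
    simp [mul_comm]

theorem isPerfPair_of_dualBases (he : ∀ n, n = ∑ i, p (f i) n • e i)
    (hf : ∀ x, x = ∑ i, p x (e i) • f i) : p.IsPerfPair :=
  ⟨bijective_of_dualBases he hf, bijective_of_dualBases (p := p.flip) hf he⟩

end DualBases

/-- The extension of scalars of a bilinear pairing. -/
def pairingBaseChange (p : N' →ₗ[B] N →ₗ[B] B) : F ⊗[B] N' →ₗ[F] F ⊗[B] N →ₗ[F] F :=
  LinearMap.liftBaseChange F
    { toFun := fun f => LinearMap.liftBaseChange F (Algebra.linearMap B F ∘ₗ p f)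
      map_add' := fun f f' => by ext; simp
      map_smul' := fun b f => by ext; simp [Algebra.smul_def] }

variable {F}

theorem pairingBaseChange_one_tmul (p : N' →ₗ[B] N →ₗ[B] B) (f : N') (n : N) :
    pairingBaseChange F p ((1 : F) ⊗ₜ[B] f) ((1 : F) ⊗ₜ[B] n) = algebraMap B F (p f n) := by
  simp [pairingBaseChange]

theorem pairingBaseChange_flip (p : N' →ₗ[B] N →ₗ[B] B) :
    pairingBaseChange F p.flip = (pairingBaseChange F p).flip := by
  ext n f
  simp [pairingBaseChange]

theorem eq_sum_pairingBaseChange_smul {p : N' →ₗ[B] N →ₗ[B] B} {m : ℕ} {e : Fin m → N}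
    {f : Fin m → N'} (he : ∀ n, n = ∑ i, p (f i) n • e i) (y : F ⊗[B] N) :
    y = ∑ i, pairingBaseChange F p ((1 : F) ⊗ₜ[B] f i) y • ((1 : F) ⊗ₜ[B] e i) := by
  have hid : LinearMap.id = ∑ i, (pairingBaseChange F p ((1 : F) ⊗ₜ[B] f i)).smulRight
      ((1 : F) ⊗ₜ[B] e i) := by
    ext n
    conv_lhs => rw [he n]
    simp [pairingBaseChange_one_tmul, algebraMap_smul]
  simpa using LinearMap.congr_fun hid y

theorem isPerfPair_pairingBaseChange [Module.Finite B N] [Module.Projective B N]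
    (p : N' →ₗ[B] N →ₗ[B] B) [p.IsPerfPair] : (pairingBaseChange F p).IsPerfPair := by
  obtain ⟨m, e, f, he, hf⟩ := exists_dualBases_of_isPerfPair p
  refine isPerfPair_of_dualBases (eq_sum_pairingBaseChange_smul he) fun z => ?_
  have hf : ∀ x, x = ∑ i, p.flip (e i) x • f i := hf
  simpa only [pairingBaseChange_flip, LinearMap.flip_apply] using eq_sum_pairingBaseChange_smul hf z

end Pairing

namespace Obj

variable {B : Type u} [CommRing B] {D : GenDiffRing B} {F : Type u} [CommRing F] [Algebra B F]
  {E : GenDiffRing F} (hDE : D.IsMor E)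

/-- The pairing of base changes induced by a pairing of objects. -/
def baseChangePairing {N N' : Obj D} (p : N' →ₗ[B] N →ₗ[B] B) :
    N'.baseChange hDE →ₗ[F] N.baseChange hDE →ₗ[F] F :=
  pairingBaseChange F p

theorem baseChangePairing_inc {N N' : Obj D} (p : N' →ₗ[B] N →ₗ[B] B) (f : N') (n : N) :
    baseChangePairing hDE p (inc hDE N' f) (inc hDE N n) = algebraMap B F (p f n) :=
  pairingBaseChange_one_tmul p f n

theorem isFlat_baseChangePairing {N N' : Obj D} {p : N' →ₗ[B] N →ₗ[B] B} (hp : IsFlat p)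
    (z : N'.baseChange hDE) (y : N.baseChange hDE) :
    E.del (baseChangePairing hDE p z y) = baseChangePairing hDE p ((N'.baseChange hDE).del z) y +
      baseChangePairing hDE p ((N'.baseChange hDE).sig z) ((N.baseChange hDE).del y) := by
  induction z using baseChange_induction hDE with
  | zero => simp only [map_zero, LinearMap.zero_apply, add_zero]
  | add x x' hx hx' => simp only [map_add, LinearMap.add_apply, hx, hx']; abel
  | smul c f =>
    induction y using baseChange_induction hDE with
    | zero => simp only [map_zero, add_zero]
    | add x x' hx hx' => simp only [map_add, hx, hx']; abel
    | smul c' n =>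
      have hdel := congrArg (algebraMap B F) (hp f n)
      have hsig : algebraMap B F (p (N'.sig f) n) = algebraMap B F (p f n) +
          E.h * algebraMap B F (p (N'.del f) n) := by
        rw [sig_apply, map_add, map_smul, LinearMap.add_apply, LinearMap.smul_apply, smul_eq_mul,
          map_add, map_mul, hDE.h]
      rw [map_add, hDE.del] at hdel
      simp only [Obj.leibniz, sig_smul, map_smul, map_add, LinearMap.add_apply,
        LinearMap.smul_apply, smul_eq_mul, del_inc, sig_inc, baseChangePairing_inc, E.del_mul,
        hdel, hsig, E.sig_eq c, E.sig_eq c']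
      ring

theorem IsDual.baseChange {N N' : Obj D} (h : IsDual N N') :
    IsDual (N.baseChange hDE) (N'.baseChange hDE) :=
  let ⟨p, _, hp'⟩ := h
  ⟨baseChangePairing hDE p, isPerfPair_pairingBaseChange p, isFlat_baseChangePairing hDE hp'⟩

theorem baseChangeMap_surjective {N N' : Obj D} {f : N →ₗ[B] N'} (hf : Function.Surjective f) :
    Function.Surjective (baseChangeMap hDE f) :=
  LinearMap.lTensor_surjective F hf

end Obj

/-! ### Lattices in base changes -/

theorem exists_linearEquiv_of_range_eq {R X Y Z : Type*} [CommRing R] [AddCommGroup X]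
    [AddCommGroup Y] [AddCommGroup Z] [Module R X] [Module R Y] [Module R Z] {f : X →ₗ[R] Z}
    {g : Y →ₗ[R] Z} (hf : Function.Injective f) (hg : Function.Injective g)
    (h : LinearMap.range f = LinearMap.range g) : ∃ e : X ≃ₗ[R] Y, ∀ x, g (e x) = f x := by
  refine ⟨(LinearEquiv.ofInjective f hf).trans
    ((LinearEquiv.ofEq _ _ h).trans (LinearEquiv.ofInjective g hg).symm), fun x => ?_⟩
  exact congrArg Subtype.val (LinearEquiv.apply_symm_apply (LinearEquiv.ofInjective g hg)
    (LinearEquiv.ofEq _ _ h (LinearEquiv.ofInjective f hf x)))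

namespace Obj

section Restrict

variable {B : Type u} [CommRing B] {D : GenDiffRing B} (N : Obj D) (L : Submodule B N)
  [Module.Finite B L] [Module.Projective B L]

/-- The object carried by a submodule `L` that is stable under `Δ` and generated by `Σ(L)`. -/
def restrict (hΔ : ∀ n ∈ L, N.del n ∈ L) (hspan : L ≤ Submodule.span B (N.sig '' L)) : Obj D where
  carrier := L
  del := AddMonoidHom.mk' (fun l => ⟨N.del l, hΔ l l.2⟩) fun _ _ => Subtype.ext (map_add _ _ _)
  leibniz b l := Subtype.ext (N.leibniz b l)
  span_eq_top := eq_top_iff.2 fun l _ => (mem_span_sig_image_iff hΔ).1 (hspan l.2)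

end Restrict

variable {B : Type u} [CommRing B] {D : GenDiffRing B} {F : Type u} [CommRing F] [Algebra B F]
  {E : GenDiffRing F} (hDE : D.IsMor E) {N : Obj D}

/-- The lattice `W ∩ N` in a subspace `W` of `F ⊗ N`. -/
def lattice (W : Submodule F (N.baseChange hDE)) : Submodule B N where
  carrier := {n | inc hDE N n ∈ W}
  add_mem' {a b} ha hb := by
    rw [Set.mem_ofPred_eq, map_add]
    exact add_mem ha hb
  zero_mem' := by
    rw [Set.mem_ofPred_eq, map_zero]
    exact zero_mem _
  smul_mem' c n hn := by
    rw [Set.mem_ofPred_eq, inc_smul]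
    exact Submodule.smul_mem _ _ hn

theorem mem_lattice {W : Submodule F (N.baseChange hDE)} {n : N} :
    n ∈ lattice hDE W ↔ inc hDE N n ∈ W := Iff.rfl

theorem del_mem_lattice {V : Obj E} {j : V →ₗ[F] N.baseChange hDE}
    (hj : IsHom V (N.baseChange hDE) j) :
    ∀ n ∈ lattice hDE (LinearMap.range j), N.del n ∈ lattice hDE (LinearMap.range j) := by
  rintro n ⟨v, hv⟩
  exact ⟨V.del v, by rw [hj, hv, del_inc]⟩

end Obj

namespace Obj

variable {B : Type u} [CommRing B] {D : GenDiffRing B} {F : Type u} [Field F] [Algebra B F]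
  [IsFractionRing B F] {E : GenDiffRing F} (hDE : D.IsMor E)

theorem baseChangeMap_injective {N N' : Obj D} {f : N →ₗ[B] N'} (hf : Function.Injective f) :
    Function.Injective (baseChangeMap hDE f) := by
  have : Module.Flat B F := IsLocalization.flat F (nonZeroDivisors B)
  exact Module.Flat.lTensor_preserves_injective_linearMap (M := F) f hf

theorem isSaturated_lattice {N : Obj D} (W : Submodule F (N.baseChange hDE)) :
    IsSaturated (lattice hDE W) := by
  intro b n hb hn
  rw [mem_lattice, inc_smul] at hn
  have hb' : algebraMap B F b ≠ 0 := by
    rwa [Ne, map_eq_zero_iff _ (IsFractionRing.injective B F)]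
  have := Submodule.smul_mem _ (algebraMap B F b)⁻¹ hn
  rwa [smul_smul, inv_mul_cancel₀ hb', one_smul] at this

variable [IsDomain B]

theorem exists_inc_eq_smul {N : Obj D} (z : N.baseChange hDE) :
    ∃ (b : B) (n : N), b ≠ 0 ∧ algebraMap B F b • z = inc hDE N n := by
  induction z using baseChange_induction hDE with
  | zero => exact ⟨1, 0, one_ne_zero, by simp⟩
  | smul c n =>
    obtain ⟨a, b, rfl⟩ := IsLocalization.exists_mk'_eq (nonZeroDivisors B) c
    refine ⟨b, a • n, nonZeroDivisors.ne_zero b.2, ?_⟩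
    rw [smul_smul, mul_comm, IsLocalization.mk'_spec, inc_smul]
  | add x y hx hy =>
    obtain ⟨a, n, ha, hn⟩ := hx
    obtain ⟨b, m, hb, hm⟩ := hy
    refine ⟨a * b, b • n + a • m, mul_ne_zero ha hb, ?_⟩
    rw [map_add, inc_smul, inc_smul, ← hn, ← hm, smul_add, smul_smul, smul_smul, map_mul, mul_comm]

theorem range_baseChangeMap_eq_of_range_eq_lattice {N L : Obj D}
    {W : Submodule F (N.baseChange hDE)} {i : L →ₗ[B] N} (hi : LinearMap.range i = lattice hDE W) :
    LinearMap.range (baseChangeMap hDE i) = W := by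
  apply le_antisymm
  · rintro _ ⟨z, rfl⟩
    induction z using baseChange_induction hDE with
    | zero => rw [map_zero]; exact zero_mem _
    | smul c l =>
      rw [map_smul, baseChangeMap_inc]
      exact Submodule.smul_mem _ _ ((mem_lattice hDE).1 (hi ▸ LinearMap.mem_range_self i l))
    | add x y hx hy => rw [map_add]; exact add_mem hx hy
  · intro y hy
    obtain ⟨b, n, hb, hn⟩ := exists_inc_eq_smul hDE y
    have hb' : algebraMap B F b ≠ 0 := by
      rwa [Ne, map_eq_zero_iff _ (IsFractionRing.injective B F)]
    have hnL : n ∈ LinearMap.range i := by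
      rw [hi, mem_lattice, ← hn]
      exact Submodule.smul_mem _ _ hy
    obtain ⟨l, rfl⟩ := hnL
    refine ⟨(algebraMap B F b)⁻¹ • inc hDE L l, ?_⟩
    rw [map_smul, baseChangeMap_inc, ← hn, smul_smul, inv_mul_cancel₀ hb', one_smul]

theorem exists_subobject_baseChange_equiv [IsNoetherianRing B] (hlat : HasLattices D)
    {N : Obj D} {V : Obj E} {j : V →ₗ[F] N.baseChange hDE} (hj : IsHom V (N.baseChange hDE) j)
    (hinj : Function.Injective j) :
    ∃ (L : Obj D) (i : L →ₗ[B] N) (e : L.baseChange hDE ≃ₗ[F] V), IsHom L N i ∧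
      Function.Injective i ∧ IsHom _ _ e.toLinearMap ∧ ∀ z, j (e z) = baseChangeMap hDE i z := by
  have hΔ := del_mem_lattice hDE hj
  obtain ⟨_, hspan⟩ := hlat N _ (isSaturated_lattice hDE _) hΔ
  let L : Obj D := N.restrict (lattice hDE (LinearMap.range j)) hΔ hspan
  let i : L →ₗ[B] N := (lattice hDE (LinearMap.range j)).subtype
  have hi : IsHom L N i := fun _ => rfl
  have hi_inj : Function.Injective i := Subtype.val_injective
  obtain ⟨e, he⟩ := exists_linearEquiv_of_range_eq (baseChangeMap_injective hDE hi_inj) hinj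
    (range_baseChangeMap_eq_of_range_eq_lattice hDE (Submodule.range_subtype _))
  refine ⟨L, i, e, hi, hi_inj, fun z => hinj ?_, he⟩
  change j (e _) = j (V.del (e z))
  rw [he, isHom_baseChangeMap hDE hi, hj, he]

end Obj

/-! ### Tannakian subcategories and base change -/

section Tannakian

section Closure

variable {B : Type u} [CommRing B] {D : GenDiffRing B}

theorem IsTannakian.of_isIso {C : Obj D → Prop} (hC : IsTannakian C) {N N' : Obj D} (hN : C N)
    (e : Obj.IsIso N N') : C N' := by
  obtain ⟨e, he⟩ := e
  exact hC.quot N N' e.toLinearMap hN he e.surjective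

theorem isTannakian_gen (M : Obj D) : IsTannakian (Gen M) where
  unit := fun _ hC _ => hC.unit
  prod N N' h h' := fun C hC hM => hC.prod N N' (h C hC hM) (h' C hC hM)
  tensor N N' h h' := fun C hC hM => hC.tensor N N' (h C hC hM) (h' C hC hM)
  dual N N' h h' := fun C hC hM => hC.dual N N' (h C hC hM) h'
  sub N N' f h hf hi := fun C hC hM => hC.sub N N' f (h C hC hM) hf hi
  quot N N' f h hf hi := fun C hC hM => hC.quot N N' f (h C hC hM) hf hi

theorem isDiffTannakian_genDiff (M : Obj D) : IsDiffTannakian (GenDiff M) where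
  unit := fun _ hC _ => hC.unit
  prod N N' h h' := fun C hC hM => hC.prod N N' (h C hC hM) (h' C hC hM)
  tensor N N' h h' := fun C hC hM => hC.tensor N N' (h C hC hM) (h' C hC hM)
  dual N N' h h' := fun C hC hM => hC.dual N N' (h C hC hM) h'
  sub N N' f h hf hi := fun C hC hM => hC.sub N N' f (h C hC hM) hf hi
  quot N N' f h hf hi := fun C hC hM => hC.quot N N' f (h C hC hM) hf hi
  prol N h := fun C hC hM => hC.prol N (h C hC hM)

end Closure

variable {B : Type u} [CommRing B] {D : GenDiffRing B} {F : Type u} [Field F] [Algebra B F]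
  [IsFractionRing B F] {E : GenDiffRing F} (hDE : D.IsMor E)

theorem isTannakian_preimage {C : Obj E → Prop} (hC : IsTannakian C) :
    IsTannakian fun N : Obj D => C (N.baseChange hDE) where
  unit := hC.of_isIso hC.unit (Obj.IsIso.symm ⟨_, Obj.isHom_unitIso hDE⟩)
  prod N N' h h' := hC.of_isIso (hC.prod _ _ h h') (Obj.IsIso.symm ⟨_, Obj.isHom_prodIso hDE N N'⟩)
  tensor N N' h h' :=
    hC.of_isIso (hC.tensor _ _ h h') (Obj.IsIso.symm ⟨_, Obj.isHom_tensorIso hDE N N'⟩)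
  dual _ _ h h' := hC.dual _ _ h (h'.baseChange hDE)
  sub _ _ f h hf hi := hC.sub _ _ (Obj.baseChangeMap hDE f) h (Obj.isHom_baseChangeMap hDE hf)
    (Obj.baseChangeMap_injective hDE hi)
  quot _ _ f h hf hi := hC.quot _ _ (Obj.baseChangeMap hDE f) h (Obj.isHom_baseChangeMap hDE hf)
    (Obj.baseChangeMap_surjective hDE hi)

theorem isDiffTannakian_preimage {C : Obj E → Prop} (hC : IsDiffTannakian C) :
    IsDiffTannakian fun N : Obj D => C (N.baseChange hDE) where
  toIsTannakian := isTannakian_preimage hDE hC.toIsTannakian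
  prol N h := hC.of_isIso (hC.prol _ h) (Obj.IsIso.symm ⟨_, Obj.isHom_prolIso hDE N⟩)

/-- The full subcategory of the objects that come from an object of `C` by base change, up to
isomorphism. -/
def baseChangeImage (C : Obj D → Prop) (V : Obj E) : Prop :=
  ∃ N : Obj D, C N ∧ Obj.IsIso (N.baseChange hDE) V

theorem GenDiffRing.IsMor.sig_injective (hDE : D.IsMor E) : Function.Injective D.sig := by
  refine Function.Injective.of_comp (f := algebraMap B F) ?_
  convert E.sig.injective.comp (IsFractionRing.injective B F) using 1
  ext b
  exact hDE.sig b

section Image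

variable [IsDomain B] {C : Obj D → Prop} {V V' : Obj E}

theorem baseChangeImage_of_isDual (hC : IsTannakian C) (hV : baseChangeImage hDE C V)
    (hdual : V.IsDual V') : baseChangeImage hDE C V' := by
  obtain ⟨N, hN, e⟩ := hV
  have hN' := Obj.isDual_dual (hDE.sig_injective (F := F)) N
  exact ⟨_, hC.dual _ _ hN hN', (hN'.baseChange hDE).unique (hdual.of_isIso e)⟩

variable [IsNoetherianRing B]

theorem baseChangeImage_of_injective (hlat : HasLattices D) (hC : IsTannakian C)
    (hV : baseChangeImage hDE C V) {f : V' →ₗ[F] V} (hf : Obj.IsHom V' V f)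
    (hinj : Function.Injective f) : baseChangeImage hDE C V' := by
  obtain ⟨N, hN, e, he⟩ := hV
  obtain ⟨L, i, e', hi, hi_inj, he', -⟩ := Obj.exists_subobject_baseChange_equiv hDE hlat
    (j := e.symm.toLinearMap ∘ₗ f) (he.symm.comp hf) (e.symm.injective.comp hinj)
  exact ⟨L, hC.sub _ _ i hN hi hi_inj, e', he'⟩

/-- A quotient is the dual of a subobject of the dual. -/
theorem baseChangeImage_of_surjective (hlat : HasLattices D) (hC : IsTannakian C)
    (hV : baseChangeImage hDE C V) {f : V →ₗ[F] V'} (hf : Obj.IsHom V V' f)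
    (hsurj : Function.Surjective f) : baseChangeImage hDE C V' := by
  have hW := Obj.isDual_dual E.sig.injective V
  have hW' := Obj.isDual_dual E.sig.injective V'
  have hWC := baseChangeImage_of_isDual hDE hC hV hW
  obtain ⟨p, hp, hp'⟩ := hW
  obtain ⟨r, hr, hr'⟩ := id hW'
  obtain ⟨t, ht, htp⟩ := Obj.exists_transpose hp hp' hr' hf
  have ht_inj : Function.Injective t := fun x y hxy => by
    apply hr.bijective_left.1
    ext v
    obtain ⟨v, rfl⟩ := hsurj v
    rw [← htp, ← htp, hxy]
  exact baseChangeImage_of_isDual hDE hC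
    (baseChangeImage_of_injective hDE hlat hC hWC ht ht_inj) hW'.symm

theorem isTannakian_baseChangeImage (hlat : HasLattices D) (hC : IsTannakian C) :
    IsTannakian (baseChangeImage hDE C) where
  unit := ⟨_, hC.unit, _, Obj.isHom_unitIso hDE⟩
  prod := by
    rintro V V' ⟨N, hN, e⟩ ⟨N', hN', e'⟩
    exact ⟨_, hC.prod _ _ hN hN', Obj.IsIso.trans ⟨_, Obj.isHom_prodIso hDE N N'⟩ (e.prod e')⟩
  tensor := by
    rintro V V' ⟨N, hN, e⟩ ⟨N', hN', e'⟩
    exact ⟨_, hC.tensor _ _ hN hN',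
      Obj.IsIso.trans ⟨_, Obj.isHom_tensorIso hDE N N'⟩ (e.tensor e')⟩
  dual _ _ hV hdual := baseChangeImage_of_isDual hDE hC hV hdual
  sub _ _ _ hV hf hinj := baseChangeImage_of_injective hDE hlat hC hV hf hinj
  quot _ _ _ hV hf hsurj := baseChangeImage_of_surjective hDE hlat hC hV hf hsurj

theorem isDiffTannakian_baseChangeImage (hlat : HasLattices D) (hC : IsDiffTannakian C) :
    IsDiffTannakian (baseChangeImage hDE C) where
  toIsTannakian := isTannakian_baseChangeImage hDE hlat hC.toIsTannakian
  prol := by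
    rintro V ⟨N, hN, e⟩
    exact ⟨_, hC.prol _ hN, Obj.IsIso.trans ⟨_, Obj.isHom_prolIso hDE N⟩ e.prol⟩

end Image

section Generated

variable {M N : Obj D} {V : Obj E}

theorem gen_baseChange (hN : Gen M N) : Gen (M.baseChange hDE) (N.baseChange hDE) :=
  hN _ (isTannakian_preimage hDE (isTannakian_gen _)) (Gen.self _)

theorem genDiff_baseChange (hN : GenDiff M N) : GenDiff (M.baseChange hDE) (N.baseChange hDE) :=
  hN _ (isDiffTannakian_preimage hDE (isDiffTannakian_genDiff _)) (GenDiff.self _)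

variable [IsDomain B] [IsNoetherianRing B]

theorem baseChangeImage_gen (hlat : HasLattices D) (hV : Gen (M.baseChange hDE) V) :
    baseChangeImage hDE (Gen M) V :=
  hV _ (isTannakian_baseChangeImage hDE hlat (isTannakian_gen M))
    ⟨M, Gen.self M, Obj.IsIso.refl _⟩

theorem baseChangeImage_genDiff (hlat : HasLattices D) (hV : GenDiff (M.baseChange hDE) V) :
    baseChangeImage hDE (GenDiff M) V :=
  hV _ (isDiffTannakian_baseChangeImage hDE hlat (isDiffTannakian_genDiff M))
    ⟨M, GenDiff.self M, Obj.IsIso.refl _⟩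

end Generated

end Tannakian

/-! ### Tensor automorphisms and base change -/

section Module

variable {B : Type u} [CommRing B] {F : Type u} [CommRing F] [Algebra B F]
  (R : Type w) [CommRing R] [Algebra B R] [Algebra F R] [IsScalarTower B F R]
  {N W : Type u} [AddCommGroup N] [Module B N] [AddCommGroup W] [Module F W]

/-- The map `R ⊗ N = R ⊗ (F ⊗ N) → R ⊗ W` induced by an `F`-linear map `F ⊗ N → W`. -/
def extendScalars (β : F ⊗[B] N →ₗ[F] W) : R ⊗[B] N →ₗ[R] R ⊗[F] W :=
  β.baseChange R ∘ₗ (AlgebraTensorModule.cancelBaseChange B F R R N).symm.toLinearMap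

theorem extendScalars_bijective {β : F ⊗[B] N →ₗ[F] W} (h : Function.Bijective β) :
    Function.Bijective (extendScalars R β) :=
  ((LinearEquiv.ofBijective β h).baseChange F R _ _).bijective.comp
    (AlgebraTensorModule.cancelBaseChange B F R R N).symm.bijective

end Module

namespace Obj

variable {B : Type u} [CommRing B] {D : GenDiffRing B} {F : Type u} [CommRing F] [Algebra B F]
  {E : GenDiffRing F} (hDE : D.IsMor E)
  (R : Type w) [CommRing R] [Algebra B R] [Algebra F R] [IsScalarTower B F R]

/-- The map `R ⊗ N → R ⊗ V` induced by an `F`-linear map `F ⊗ N → V`. -/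
def extend {N : Obj D} {V : Obj E} (β : N.baseChange hDE →ₗ[F] V) : R ⊗[B] N →ₗ[R] R ⊗[F] V :=
  extendScalars R β

theorem extend_tmul {N : Obj D} {V : Obj E} (β : N.baseChange hDE →ₗ[F] V) (r : R) (n : N) :
    extend hDE R β (r ⊗ₜ n) = r ⊗ₜ β (inc hDE N n) := rfl

theorem extend_bijective {N : Obj D} {V : Obj E} {β : N.baseChange hDE →ₗ[F] V}
    (h : Function.Bijective β) : Function.Bijective (extend hDE R β) :=
  extendScalars_bijective R h

theorem extend_baseChange {N N' : Obj D} {V : Obj E} (β : N'.baseChange hDE →ₗ[F] V)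
    (f : N →ₗ[B] N') (t : R ⊗[B] N) :
    extend hDE R β (f.baseChange R t) = extend hDE R (β ∘ₗ baseChangeMap hDE f) t := by
  induction t using TensorProduct.induction_on with
  | zero => simp only [map_zero]
  | tmul r n =>
    rw [LinearMap.baseChange_tmul, extend_tmul, extend_tmul, LinearMap.comp_apply,
      baseChangeMap_inc]
  | add x y hx hy => simp only [map_add, hx, hy]

theorem baseChange_extend {N : Obj D} {V V' : Obj E} (β : N.baseChange hDE →ₗ[F] V)
    (f : V →ₗ[F] V') (t : R ⊗[B] N) :
    f.baseChange R (extend hDE R β t) = extend hDE R (f ∘ₗ β) t := by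
  induction t using TensorProduct.induction_on with
  | zero => simp only [map_zero]
  | tmul r n => rw [extend_tmul, extend_tmul, LinearMap.baseChange_tmul, LinearMap.comp_apply]
  | add x y hx hy => simp only [map_add, hx, hy]

theorem tensorComparison_tmul {N N' : Obj D} (r : R) (n : N) (n' : N') :
    tensorComparison N N' R (r ⊗ₜ[B] pureTensor n n') = (r ⊗ₜ[B] n) ⊗ₜ[R] ((1 : R) ⊗ₜ[B] n') := rfl

theorem tensorComparison_extend {N N' : Obj D} {V V' : Obj E} (β : N.baseChange hDE →ₗ[F] V)
    (β' : N'.baseChange hDE →ₗ[F] V') (γ : (N.tensor N').baseChange hDE →ₗ[F] V.tensor V')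
    (hγ : ∀ n n', γ (inc hDE _ (pureTensor n n')) =
      pureTensor (β (inc hDE N n)) (β' (inc hDE N' n')))
    (t : R ⊗[B] (N.tensor N')) :
    tensorComparison V V' R (extend hDE R γ t) =
      TensorProduct.map (extend hDE R β) (extend hDE R β') (tensorComparison N N' R t) := by
  induction t using TensorProduct.induction_on with
  | zero => simp only [map_zero]
  | tmul r x =>
    induction x using tensor_induction with
    | zero => simp only [TensorProduct.tmul_zero, map_zero]
    | tmul n n' =>
      rw [extend_tmul, hγ, tensorComparison_tmul, tensorComparison_tmul, TensorProduct.map_tmul,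
        extend_tmul, extend_tmul]
    | add x y hx hy => simp only [TensorProduct.tmul_add, map_add, hx, hy]
  | add x y hx hy => simp only [map_add, hx, hy]

theorem prolComparison_extend {N : Obj D} {V : Obj E} (β : N.baseChange hDE →ₗ[F] V)
    (γ : N.prol.baseChange hDE →ₗ[F] V.prol)
    (hγ : ∀ a b, γ (inc hDE N.prol (Prol.mk D.der a b)) =
      Prol.mk E.der (β (inc hDE N a)) (β (inc hDE N b)))
    (dR : Derivation ℤ R R) (hd : ∀ c, dR (algebraMap F R c) = algebraMap F R (E.der c))
    (t : R ⊗[B] N.prol) :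
    prolComparison V R dR hd (extend hDE R γ t) =
      Prol.map dR (extend hDE R β) (prolComparison N R dR (der_compat hDE hd) t) := by
  induction t using TensorProduct.induction_on with
  | zero => simp only [map_zero]
  | tmul r x =>
    have hN : prolComparison N R dR (der_compat hDE hd) (r ⊗ₜ x) =
        Prol.mk dR (r ⊗ₜ x.1 - dR r ⊗ₜ x.2) (r ⊗ₜ x.2) := Prol.comparison_tmul _ r x
    have hV := Prol.comparison_tmul hd r (Prol.mk E.der (β (inc hDE N x.1)) (β (inc hDE N x.2)))
    rw [hN, Prol.map_mk, map_sub, extend_tmul, extend_tmul, extend_tmul, extend_tmul]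
    exact (congrArg (fun y => prolComparison V R dR hd (r ⊗ₜ y)) (hγ x.1 x.2)).trans hV
  | add x y hx hy => simp only [map_add, hx, hy]

theorem rTensor_extend {R} {R' : Type w} [CommRing R] [Algebra B R] [Algebra F R]
    [IsScalarTower B F R] [CommRing R'] [Algebra B R'] [Algebra F R']
    [IsScalarTower B F R'] (f : R →ₐ[F] R') {N : Obj D} {V : Obj E}
    (β : N.baseChange hDE →ₗ[F] V) (t : R ⊗[B] N) :
    f.toLinearMap.rTensor V (extend hDE R β t) =
      extend hDE R' β ((f.restrictScalars B).toLinearMap.rTensor N t) := by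
  induction t using TensorProduct.induction_on with
  | zero => simp only [map_zero]
  | tmul r n => rfl
  | add x y hx hy => simp only [map_add, hx, hy]

end Obj

section Compat

open Obj

section

variable {B : Type u} [CommRing B] {D : GenDiffRing B} {F : Type u} [Field F] [Algebra B F]
  {E : GenDiffRing F} (hDE : D.IsMor E)
  {R : Type w} [CommRing R] [Algebra B R] [Algebra F R] [IsScalarTower B F R]
  {C : Obj D → Prop} {C' : Obj E → Prop}

/-- The families `g` over `B` and `g'` over `F` are intertwined by the morphisms `F ⊗ N → V`. -/
def Compat (g : AutFamily C R) (g' : AutFamily C' R) : Prop :=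
  ∀ (N : Obj D) (hN : C N) (V : Obj E) (hV : C' V) (β : N.baseChange hDE →ₗ[F] V),
    IsHom _ _ β → ∀ t, extend hDE R β (g ⟨N, hN⟩ t) = g' ⟨V, hV⟩ (extend hDE R β t)

variable {hDE} {g : AutFamily C R} {g' : AutFamily C' R}

theorem Compat.mul {k : AutFamily C R} {k' : AutFamily C' R} (h : Compat hDE g g')
    (h' : Compat hDE k k') : Compat hDE (g * k) (g' * k') := by
  intro N hN V hV β hβ t
  change extend hDE R β (g ⟨N, hN⟩ (k ⟨N, hN⟩ t)) = g' ⟨V, hV⟩ (k' ⟨V, hV⟩ (extend hDE R β t))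
  rw [h N hN V hV β hβ, h' N hN V hV β hβ]

theorem Compat.unique_left (hbase : ∀ N, C N → C' (N.baseChange hDE)) {k : AutFamily C R}
    (h : Compat hDE g g') (h' : Compat hDE k g') : g = k := by
  funext ⟨N, hN⟩
  ext1 t
  apply (extend_bijective hDE R (β := LinearMap.id) Function.bijective_id).1
  rw [h N hN _ (hbase N hN) _ (isHom_id _), h' N hN _ (hbase N hN) _ (isHom_id _)]

theorem Compat.unique_right (himg : ∀ V, C' V → baseChangeImage hDE C V) {k' : AutFamily C' R}
    (h : Compat hDE g g') (h' : Compat hDE g k') : g' = k' := by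
  funext ⟨V, hV⟩
  ext1 t
  obtain ⟨N, hN, α, hα⟩ := himg V hV
  obtain ⟨t, rfl⟩ := (extend_bijective hDE R (β := α.toLinearMap) α.bijective).2 t
  rw [← h N hN V hV _ hα, ← h' N hN V hV _ hα]

theorem Compat.isImage (himg : ∀ V, C' V → baseChangeImage hDE C V) {R' : Type w} [CommRing R']
    [Algebra B R'] [Algebra F R'] [IsScalarTower B F R'] {k : AutFamily C R'}
    {k' : AutFamily C' R'} (h : Compat hDE g g') (h' : Compat hDE k k') (f : R →ₐ[F] R')
    (him : IsImage (f.restrictScalars B) g k) : IsImage f g' k' := by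
  intro V hV t
  obtain ⟨N, hN, α, hα⟩ := himg V hV
  obtain ⟨t, rfl⟩ := (extend_bijective hDE R (β := α.toLinearMap) α.bijective).2 t
  rw [← h N hN V hV _ hα, rTensor_extend, rTensor_extend, ← h' N hN V hV _ hα, him]

theorem cancelBaseChange_of_compat (h : Compat hDE g g') {N : Obj D} (hN : C N)
    (hN' : C' (N.baseChange hDE)) (t : R ⊗[F] (F ⊗[B] N)) :
    AlgebraTensorModule.cancelBaseChange B F R R N (g' ⟨N.baseChange hDE, hN'⟩ t) =
      g ⟨N, hN⟩ (AlgebraTensorModule.cancelBaseChange B F R R N t) := by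
  have hid : ∀ s, extend hDE R (N := N) LinearMap.id s =
      (AlgebraTensorModule.cancelBaseChange B F R R N).symm s := fun s => by
    induction s using TensorProduct.induction_on with
    | zero => simp only [map_zero]; rfl
    | tmul r n => rfl
    | add x y hx hy =>
      rw [map_add, map_add, hx, hy]
      rfl
  have := h N hN _ hN' _ (isHom_id _) (AlgebraTensorModule.cancelBaseChange B F R R N t)
  rw [hid, hid, LinearEquiv.symm_apply_apply] at this
  rw [← this]
  exact LinearEquiv.apply_symm_apply _ _

theorem Compat.tensor_iff (h : Compat hDE g g') {N N' : Obj D} {V V' : Obj E} (hN : C N)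
    (hN' : C N') (hNN' : C (N.tensor N')) (hV : C' V) (hV' : C' V') (hVV' : C' (V.tensor V'))
    (α : N.baseChange hDE ≃ₗ[F] V) (α' : N'.baseChange hDE ≃ₗ[F] V')
    (hα : IsHom _ _ α.toLinearMap) (hα' : IsHom _ _ α'.toLinearMap) :
    (∀ t, tensorComparison N N' R (g ⟨N.tensor N', hNN'⟩ t) =
      TensorProduct.congr (g ⟨N, hN⟩) (g ⟨N', hN'⟩) (tensorComparison N N' R t)) ↔
    (∀ t, tensorComparison V V' R (g' ⟨V.tensor V', hVV'⟩ t) =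
      TensorProduct.congr (g' ⟨V, hV⟩) (g' ⟨V', hV'⟩) (tensorComparison V V' R t)) := by
  let γ : (N.tensor N').baseChange hDE ≃ₗ[F] V.tensor V' :=
    (tensorIso hDE N N').trans (TensorProduct.congr α α')
  have hγ : IsHom _ _ γ.toLinearMap := (hα.tensor hα').comp (isHom_tensorIso hDE N N')
  have hγ_inc : ∀ n n', γ.toLinearMap (inc hDE _ (pureTensor n n')) =
      pureTensor (α.toLinearMap (inc hDE N n)) (α'.toLinearMap (inc hDE N' n')) := fun n n' =>
    congrArg (TensorProduct.congr α α') (tensorIso_inc hDE n n')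
  have hθ := extend_bijective hDE R (β := α.toLinearMap) α.bijective
  have hθ' := extend_bijective hDE R (β := α'.toLinearMap) α'.bijective
  have hγ_bij := extend_bijective hDE R (β := γ.toLinearMap) γ.bijective
  have hinj : Function.Injective
      (TensorProduct.map (extend hDE R α.toLinearMap) (extend hDE R α'.toLinearMap)) :=
    (TensorProduct.congr (LinearEquiv.ofBijective _ hθ) (LinearEquiv.ofBijective _ hθ')).injective
  have hcong : ∀ x, TensorProduct.congr (g' ⟨V, hV⟩) (g' ⟨V', hV'⟩)
      (TensorProduct.map (extend hDE R α.toLinearMap) (extend hDE R α'.toLinearMap) x) =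
      TensorProduct.map (extend hDE R α.toLinearMap) (extend hDE R α'.toLinearMap)
        (TensorProduct.congr (g ⟨N, hN⟩) (g ⟨N', hN'⟩) x) := by
    intro x
    induction x using TensorProduct.induction_on with
    | zero => simp only [map_zero]
    | tmul a b =>
      simp only [TensorProduct.map_tmul, TensorProduct.congr_tmul, h N hN V hV _ hα,
        h N' hN' V' hV' _ hα']
    | add x y hx hy => simp only [map_add, hx, hy]
  refine (forall_congr' fun t => ?_).trans hγ_bij.2.forall.symm
  rw [← h _ hNN' _ hVV' _ hγ, tensorComparison_extend hDE R _ _ _ hγ_inc,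
    tensorComparison_extend hDE R _ _ _ hγ_inc, hcong, hinj.eq_iff]

theorem Compat.prol_iff (h : Compat hDE g g') {N : Obj D} {V : Obj E} (hN : C N)
    (hNp : C N.prol) (hV : C' V) (hVp : C' V.prol)
    (α : N.baseChange hDE ≃ₗ[F] V) (hα : IsHom _ _ α.toLinearMap)
    (dR : Derivation ℤ R R) (hd : ∀ c, dR (algebraMap F R c) = algebraMap F R (E.der c)) :
    (∀ t, prolComparison N R dR (der_compat hDE hd) (g ⟨N.prol, hNp⟩ t) =
      Prol.map dR (g ⟨N, hN⟩).toLinearMap (prolComparison N R dR (der_compat hDE hd) t)) ↔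
    (∀ t, prolComparison V R dR hd (g' ⟨V.prol, hVp⟩ t) =
      Prol.map dR (g' ⟨V, hV⟩).toLinearMap (prolComparison V R dR hd t)) := by
  let γ : N.prol.baseChange hDE →ₗ[F] V.prol :=
    Prol.map E.der α.toLinearMap ∘ₗ (prolIso hDE N).toLinearMap
  have hγ : IsHom _ _ γ := hα.prol.comp (isHom_prolIso hDE N)
  have hγ_inc : ∀ a b, γ (inc hDE N.prol (Prol.mk D.der a b)) =
      Prol.mk E.der (α.toLinearMap (inc hDE N a)) (α.toLinearMap (inc hDE N b)) := fun a b =>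
    congrArg (Prol.map E.der α.toLinearMap) (prolIso_inc hDE a b)
  have hθ := extend_bijective hDE R (β := α.toLinearMap) α.bijective
  have hγ_bij := extend_bijective hDE R (β := γ)
    ((Function.Bijective.prodMap α.bijective α.bijective).comp (prolIso hDE N).bijective)
  have hinj : Function.Injective (Prol.map dR (extend hDE R α.toLinearMap)) :=
    Function.Injective.prodMap hθ.1 hθ.1
  have hcong : ∀ x, Prol.map dR (g' ⟨V, hV⟩).toLinearMap
      (Prol.map dR (extend hDE R α.toLinearMap) x) =
      Prol.map dR (extend hDE R α.toLinearMap) (Prol.map dR (g ⟨N, hN⟩).toLinearMap x) := fun x =>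
    Prod.ext (h N hN V hV _ hα x.1).symm (h N hN V hV _ hα x.2).symm
  refine (forall_congr' fun t => ?_).trans hγ_bij.2.forall.symm
  rw [← h _ hNp _ hVp _ hγ, prolComparison_extend hDE R _ _ hγ_inc,
    prolComparison_extend hDE R _ _ hγ_inc, hcong, hinj.eq_iff]

theorem Compat.mem_tensorAut_iff (h : Compat hDE g g') (hC : IsTannakian C)
    (hbase : ∀ N, C N → C' (N.baseChange hDE)) (hC' : IsTannakian C')
    (himg : ∀ V, C' V → baseChangeImage hDE C V) : g ∈ TensorAut C R ↔ g' ∈ TensorAut C' R := by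
  have hunit : ∀ t, extend hDE R (unitIso hDE).toLinearMap (g ⟨_, hC.unit⟩ t) =
      g' ⟨_, hC'.unit⟩ (extend hDE R (unitIso hDE).toLinearMap t) :=
    h _ hC.unit _ hC'.unit _ (isHom_unitIso hDE)
  have hub := extend_bijective hDE R (β := (unitIso hDE).toLinearMap) (unitIso hDE).bijective
  constructor
  · rintro ⟨-, hu, ht⟩
    refine ⟨fun V V' hV hV' f hf t => ?_, fun _ t => ?_, fun V V' hV hV' hVV' => ?_⟩
    · obtain ⟨N, hN, α, hα⟩ := himg V hV
      obtain ⟨t, rfl⟩ := (extend_bijective hDE R (β := α.toLinearMap) α.bijective).2 t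
      rw [← h N hN V hV _ hα, baseChange_extend, baseChange_extend,
        h N hN V' hV' _ (hf.comp hα)]
    · obtain ⟨t, rfl⟩ := hub.2 t
      rw [← hunit, hu]
    · obtain ⟨N, hN, α, hα⟩ := himg V hV
      obtain ⟨N', hN', α', hα'⟩ := himg V' hV'
      exact (h.tensor_iff hN hN' (hC.tensor _ _ hN hN') hV hV' hVV' α α' hα hα').1
        (ht N N' hN hN' _)
  · rintro ⟨-, hu, ht⟩
    refine ⟨fun N N' hN hN' f hf t => ?_, fun _ t => ?_, fun N N' hN hN' hNN' => ?_⟩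
    · apply (extend_bijective hDE R (β := LinearMap.id) Function.bijective_id).1
      rw [extend_baseChange,
        h N hN _ (hbase N' hN') _ ((isHom_id _).comp (isHom_baseChangeMap hDE hf)),
        h N' hN' _ (hbase N' hN') _ (isHom_id _), extend_baseChange]
    · apply hub.1
      rw [hunit, hu]
    · exact (h.tensor_iff hN hN' hNN' (hbase N hN) (hbase N' hN')
        (hC'.tensor _ _ (hbase N hN) (hbase N' hN')) (LinearEquiv.refl F _) (LinearEquiv.refl F _)
        (isHom_id _) (isHom_id _)).2 (ht _ _ (hbase N hN) (hbase N' hN') _)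

theorem Compat.mem_diffTensorAut_iff (h : Compat hDE g g') (hC : IsDiffTannakian C)
    (hbase : ∀ N, C N → C' (N.baseChange hDE)) (hC' : IsDiffTannakian C')
    (himg : ∀ V, C' V → baseChangeImage hDE C V)
    (dR : Derivation ℤ R R) (hd : ∀ c, dR (algebraMap F R c) = algebraMap F R (E.der c)) :
    g ∈ DiffTensorAut C R dR (der_compat hDE hd) ↔ g' ∈ DiffTensorAut C' R dR hd := by
  refine and_congr (h.mem_tensorAut_iff hC.toIsTannakian hbase hC'.toIsTannakian himg) ⟨?_, ?_⟩
  · intro hp V hV hVp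
    obtain ⟨N, hN, α, hα⟩ := himg V hV
    exact (h.prol_iff hN (hC.prol N hN) hV hVp α hα dR hd).1 (hp N hN _)
  · intro hp N hN hNp
    exact (h.prol_iff hN hNp (hbase N hN) (hC'.prol _ (hbase N hN)) (LinearEquiv.refl F _)
      (isHom_id _) dR hd).2 (hp _ (hbase N hN) _)

theorem exists_compat_left (hbase : ∀ N, C N → C' (N.baseChange hDE)) (hg' : g' ∈ TensorAut C' R) :
    ∃ g : AutFamily C R, Compat hDE g g' := by
  let θ : ∀ N : Obj D, R ⊗[B] N ≃ₗ[R] R ⊗[F] N.baseChange hDE := fun N =>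
    LinearEquiv.ofBijective _ (extend_bijective hDE R (β := LinearMap.id) Function.bijective_id)
  have hθ : ∀ (N : Obj D) t, θ N t = extend hDE R LinearMap.id t := fun _ _ => rfl
  refine ⟨fun N => (θ N.1).trans ((g' ⟨_, hbase N.1 N.2⟩).trans (θ N.1).symm),
    fun N hN V hV β hβ t => ?_⟩
  have hcomp : ∀ t, extend hDE R β t = β.baseChange R (θ N t) := fun t => by
    rw [hθ, baseChange_extend, LinearMap.comp_id]
  rw [hcomp, hcomp, ← hg'.1 _ _ (hbase N hN) hV β hβ]
  simp only [LinearEquiv.trans_apply, LinearEquiv.apply_symm_apply]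

end

section

variable {B : Type u} [CommRing B] [IsDomain B] [IsNoetherianRing B] {D : GenDiffRing B}
  {F : Type u} [Field F] [Algebra B F] [IsFractionRing B F]
  {E : GenDiffRing F} (hDE : D.IsMor E)

/-- Take for `L` the lattice in the graph of `ψ`. -/
theorem exists_correspondence (hlat : HasLattices D) {N N' : Obj D}
    {ψ : N.baseChange hDE →ₗ[F] N'.baseChange hDE} (hψ : IsHom _ _ ψ) :
    ∃ (L : Obj D) (i : L →ₗ[B] N.prod N') (a : L →ₗ[B] N) (b : L →ₗ[B] N'),
      IsHom _ _ i ∧ Function.Injective i ∧ IsHom _ _ a ∧ IsHom _ _ b ∧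
      Function.Bijective (baseChangeMap hDE a) ∧
      baseChangeMap hDE b = ψ ∘ₗ baseChangeMap hDE a := by
  let graph : N.baseChange hDE →ₗ[F] (N.baseChange hDE).prod (N'.baseChange hDE) :=
    LinearMap.prod LinearMap.id ψ
  have hgraph : IsHom _ _ graph := fun z => Prod.ext rfl (hψ z)
  have hgraph_inj : Function.Injective graph := fun x y hxy => congrArg Prod.fst hxy
  obtain ⟨L, i, e, hi, hi_inj, -, hie⟩ := exists_subobject_baseChange_equiv hDE hlat
    (j := (prodIso hDE N N').symm.toLinearMap ∘ₗ graph)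
    ((isHom_prodIso hDE N N').symm.comp hgraph)
    ((prodIso hDE N N').symm.injective.comp hgraph_inj)
  have hgraph_inc : ∀ l, graph (e (inc hDE L l)) = prodIso hDE N N' (inc hDE _ (i l)) := fun l => by
    rw [← baseChangeMap_inc, ← hie]
    exact ((prodIso hDE N N').apply_symm_apply _).symm
  have hfst : baseChangeMap hDE (LinearMap.fst B N N' ∘ₗ i) = e.toLinearMap :=
    baseChange_ext hDE fun l => by
      rw [baseChangeMap_inc]
      exact (congrArg Prod.fst (hgraph_inc l)).symm
  have hsnd : baseChangeMap hDE (LinearMap.snd B N N' ∘ₗ i) = ψ ∘ₗ e.toLinearMap :=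
    baseChange_ext hDE fun l => by
      rw [baseChangeMap_inc]
      exact (congrArg Prod.snd (hgraph_inc l)).symm
  exact ⟨L, i, _, _, hi, hi_inj, (isHom_fst N N').comp hi, (isHom_snd N N').comp hi,
    hfst ▸ e.bijective, hsnd.trans (congrArg (ψ ∘ₗ ·) hfst.symm)⟩

variable {hDE} {R : Type w} [CommRing R] [Algebra B R] [Algebra F R] [IsScalarTower B F R]
  {C : Obj D → Prop} {C' : Obj E → Prop}

theorem exists_compat_right (hlat : HasLattices D) (hC : IsTannakian C)
    (himg : ∀ V, C' V → baseChangeImage hDE C V) {g : AutFamily C R} (hg : g ∈ TensorAut C R) :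
    ∃ g' : AutFamily C' R, Compat hDE g g' := by
  choose X hX α hα using himg
  let θ : ∀ (V : Obj E) (hV : C' V), R ⊗[B] X V hV ≃ₗ[R] R ⊗[F] V := fun V hV =>
    LinearEquiv.ofBijective _
      (extend_bijective hDE R (β := (α V hV).toLinearMap) (α V hV).bijective)
  have hθ : ∀ (V : Obj E) (hV : C' V) t, θ V hV t = extend hDE R (α V hV).toLinearMap t :=
    fun _ _ _ => rfl
  refine ⟨fun V => (θ V.1 V.2).symm.trans ((g ⟨X V.1 V.2, hX V.1 V.2⟩).trans (θ V.1 V.2)),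
    fun N hN V hV β hβ t => ?_⟩
  obtain ⟨L, i, a, b, hi, hi_inj, ha, hb, ha_bij, hba⟩ := exists_correspondence hDE hlat
    ((hα V hV).symm.comp hβ)
  have hL : C L := hC.sub _ _ i (hC.prod _ _ hN (hX V hV)) hi hi_inj
  have hβa : β ∘ₗ baseChangeMap hDE a = (α V hV).toLinearMap ∘ₗ baseChangeMap hDE b := by
    rw [hba]
    ext z
    exact ((α V hV).apply_symm_apply _).symm
  have hsurj : Function.Surjective (a.baseChange R) := by
    intro y
    obtain ⟨s, hs⟩ := (extend_bijective hDE R ha_bij).2 (extend hDE R LinearMap.id y)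
    refine ⟨s, (extend_bijective hDE R (β := LinearMap.id) Function.bijective_id).1 ?_⟩
    rw [← hs, extend_baseChange, LinearMap.id_comp]
  obtain ⟨s, rfl⟩ := hsurj t
  rw [← hg.1 _ _ hL hN a ha, extend_baseChange, extend_baseChange, hβa, ← extend_baseChange,
    ← extend_baseChange, hg.1 _ _ hL (hX V hV) b hb, ← hθ, ← hθ]
  simp only [LinearEquiv.trans_apply, LinearEquiv.symm_apply_apply]

theorem exists_mulEquiv_compat (hlat : HasLattices D) (hC : IsTannakian C)
    (hbase : ∀ N, C N → C' (N.baseChange hDE)) (himg : ∀ V, C' V → baseChangeImage hDE C V)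
    (S : Subgroup (AutFamily C R)) (S' : Subgroup (AutFamily C' R)) (hS : S ≤ TensorAut C R)
    (hS' : S' ≤ TensorAut C' R)
    (hSS' : ∀ g g', Compat hDE g g' → (g ∈ S ↔ g' ∈ S')) :
    ∃ e : S ≃* S', ∀ g, Compat hDE g.1 (e g).1 := by
  have hex : ∀ g : S, ∃ g' : S', Compat hDE g.1 g'.1 := fun g =>
    let ⟨g', hg'⟩ := exists_compat_right hlat hC himg (hS g.2)
    ⟨⟨g', (hSS' _ _ hg').1 g.2⟩, hg'⟩
  choose e he using hex
  refine ⟨MulEquiv.ofBijective (MonoidHom.mk' e fun g k => Subtype.ext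
    ((he (g * k)).unique_right himg ((he g).mul (he k)))) ⟨fun g k hgk => ?_, fun g' => ?_⟩, he⟩
  · have hgk' : e g = e k := hgk
    refine Subtype.ext ((he g).unique_left hbase ?_)
    rw [hgk']
    exact he k
  · obtain ⟨g, hg⟩ := exists_compat_left hbase (hS' g'.2)
    exact ⟨⟨g, (hSS' _ _ hg).2 g'.2⟩, Subtype.ext ((he _).unique_right himg hg)⟩

variable (hDE)

theorem galLoc_of_hasLattices (hlat : HasLattices D) (M : Obj D) : GalLoc.{u, w} hDE M := by
  have himg : ∀ V, Gen (M.baseChange hDE) V → baseChangeImage hDE (Gen M) V :=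
    fun _ => baseChangeImage_gen hDE hlat
  have hex (R : Type w) [CommRing R] [Algebra B R] [Algebra F R] [IsScalarTower B F R] :
      ∃ e : Gal M R ≃* Gal (M.baseChange hDE) R, ∀ g, Compat hDE g.1 (e g).1 :=
    exists_mulEquiv_compat hlat (isTannakian_gen M) (fun _ => gen_baseChange hDE) himg _ _
      le_rfl le_rfl fun g g' h => h.mem_tensorAut_iff (isTannakian_gen M)
        (fun _ => gen_baseChange hDE) (isTannakian_gen _) himg
  choose e he using hex
  exact ⟨fun R _ _ _ _ => e R, fun R R' _ _ _ _ _ _ _ _ f g g' h =>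
      (he R g).isImage himg (he R' g') f h,
    fun R _ _ _ _ g t => cancelBaseChange_of_compat (he R g) _ _ t⟩

theorem galDiffLoc_of_hasLattices (hlat : HasLattices D) (M : Obj D) :
    GalDiffLoc.{u, w} hDE M := by
  have himg : ∀ V, GenDiff (M.baseChange hDE) V → baseChangeImage hDE (GenDiff M) V :=
    fun _ => baseChangeImage_genDiff hDE hlat
  have hex (R : Type w) [CommRing R] [Algebra B R] [Algebra F R] [IsScalarTower B F R]
      (dR : Derivation ℤ R R) (hd : ∀ c, dR (algebraMap F R c) = algebraMap F R (E.der c)) :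
      ∃ e : GalDiff M R dR (der_compat hDE hd) ≃* GalDiff (M.baseChange hDE) R dR hd,
        ∀ g, Compat hDE g.1 (e g).1 :=
    exists_mulEquiv_compat hlat (isDiffTannakian_genDiff M).toIsTannakian
      (fun _ => genDiff_baseChange hDE) himg _ _ inf_le_left inf_le_left fun g g' h =>
        h.mem_diffTensorAut_iff (isDiffTannakian_genDiff M) (fun _ => genDiff_baseChange hDE)
          (isDiffTannakian_genDiff _) himg dR hd
  choose e he using hex
  exact ⟨fun R _ _ _ _ dR hd => e R dR hd,
    fun R R' _ _ _ _ _ _ _ _ dR hd dR' hd' f _ g g' h =>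
      (he R dR hd g).isImage himg (he R' dR' hd' g') f h,
    fun R _ _ _ _ dR hd g t => cancelBaseChange_of_compat (he R dR hd g) _ _ t⟩

end

end Compat

/-! ### Localization at the generic point -/

section FractionField

variable {O κ : Type u} [CommRing O] [CommRing κ] [IsDomain κ] [Algebra O κ] {q : O} {P : O[X]}
  (hq : algebraMap O κ q ≠ 0) (hP : P.map (algebraMap O κ) ≠ 0)

theorem toRat_algebraMap (p : O[X]) :
    toRat (algebraMap O κ) q P hq hP (algebraMap O[X] (QAlg q P) p) =
      algebraMap κ[X] (RatFunc κ) (p.map (algebraMap O κ)) :=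
  locMap_algebraMap _ _ _ _ _ _ p

variable [IsFractionRing O κ]

variable (O κ) in
theorem isFractionRing_polynomial_ratFunc :
    letI := Polynomial.algebra O κ
    IsFractionRing O[X] (RatFunc κ) := by
  let _ := Polynomial.algebra O κ
  have : IsDomain O := (IsFractionRing.injective O κ).isDomain
  have := Polynomial.isLocalization (nonZeroDivisors O) κ
  have hcomap : (nonZeroDivisors κ[X]).comap (algebraMap O[X] κ[X]) = nonZeroDivisors O[X] := by
    ext p
    rw [Submonoid.mem_comap, mem_nonZeroDivisors_iff_ne_zero, mem_nonZeroDivisors_iff_ne_zero]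
    exact Polynomial.map_ne_zero_iff (IsFractionRing.injective O κ)
  rw [IsFractionRing, ← hcomap]
  exact IsLocalization.localization_localization_isLocalization_of_has_all_units
    ((nonZeroDivisors O).map C) _ _ fun _ => IsUnit.mem_nonZeroDivisors

theorem isFractionRing_toRat :
    letI := (toRat (algebraMap O κ) q P hq hP).toAlgebra
    IsFractionRing (QAlg q P) (RatFunc κ) := by
  let _ := (toRat (algebraMap O κ) q P hq hP).toAlgebra
  let _ := Polynomial.algebra O κ
  have : IsDomain O := (IsFractionRing.injective O κ).isDomain
  have := isFractionRing_polynomial_ratFunc O κ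
  have : IsScalarTower O[X] (QAlg q P) (RatFunc κ) := .of_algebraMap_eq fun p =>
    (IsScalarTower.algebraMap_apply O[X] κ[X] (RatFunc κ) p).trans (toRat_algebraMap hq hP p).symm
  exact IsFractionRing.isFractionRing_of_isDomain_of_isLocalization (denoms q P) _ _

theorem galLoc_and_galDiffLoc_toRat [IsDedekindDomain O] {D : GenDiffRing (QAlg q P)}
    (hD : D.sig = QAlg.sig q P) {E : GenDiffRing (RatFunc κ)} (M : Obj D) :
    letI := (toRat (algebraMap O κ) q P hq hP).toAlgebra
    ∀ hDE : D.IsMor E, GalLoc.{u, w} hDE M ∧ GalDiffLoc.{u, w} hDE M := by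
  let _ := (toRat (algebraMap O κ) q P hq hP).toAlgebra
  intro hDE
  have := isFractionRing_toRat hq hP
  have hq₀ : q ≠ 0 := ne_zero_of_map hq
  have hP₀ : P ≠ 0 := ne_zero_of_map (f := mapRingHom (algebraMap O κ)) hP
  have := QAlg.isDomain hq₀ hP₀
  have := QAlg.isNoetherianRing q P
  have hlat : HasLattices D := hasLattices_of_isDedekindDomain hD hq₀ hP₀
  exact ⟨galLoc_of_hasLattices hDE hlat M, galDiffLoc_of_hasLattices hDE hlat M⟩

theorem diffGalLoc_and_diffGalDiffLoc [IsDedekindDomain O] (M : Obj (QAlg.diffRing q P)) :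
    DiffGalLoc.{u, w} (algebraMap O κ) q P hq hP M ∧
      DiffGalDiffLoc.{u, w} (algebraMap O κ) q P hq hP M :=
  galLoc_and_galDiffLoc_toRat hq hP rfl M _

theorem connGalLoc_and_connGalDiffLoc [IsDedekindDomain O] (M : Obj (QAlg.connRing q P)) :
    ConnGalLoc.{u, w} (algebraMap O κ) q P hq hP M ∧
      ConnGalDiffLoc.{u, w} (algebraMap O κ) q P hq hP M :=
  galLoc_and_galDiffLoc_toRat hq hP rfl M _

end FractionField

section Spec

variable {O : Type u} [CommRing O] {q : O} {P : O[X]} {v : Ideal O} [v.IsMaximal]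
  (hq : Ideal.Quotient.mk v q ≠ 0) (hP : P.map (Ideal.Quotient.mk v) ≠ 0)

theorem isFractionRing_quotient_self (v : Ideal O) [v.IsMaximal] :
    IsFractionRing (O ⧸ v) (O ⧸ v) := by
  let _ := Ideal.Quotient.field v
  infer_instance

theorem isDedekindDomain_quotient (v : Ideal O) [v.IsMaximal] : IsDedekindDomain (O ⧸ v) := by
  let _ := Ideal.Quotient.field v
  infer_instance

theorem specDiffGalLoc_and_specDiffGalDiffLoc (M : Obj (QAlg.diffRing q P)) :
    SpecDiffGalLoc.{u, w} q P v hq hP M ∧ SpecDiffGalDiffLoc.{u, w} q P v hq hP M := by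
  have := isFractionRing_quotient_self v
  have := isDedekindDomain_quotient v
  exact diffGalLoc_and_diffGalDiffLoc (κ := O ⧸ v) _ _ _

theorem specConnGalLoc_and_specConnGalDiffLoc (M : Obj (QAlg.connRing q P)) :
    SpecConnGalLoc.{u, w} q P v hq hP M ∧ SpecConnGalDiffLoc.{u, w} q P v hq hP M := by
  have := isFractionRing_quotient_self v
  have := isDedekindDomain_quotient v
  exact connGalLoc_and_connGalDiffLoc (κ := O ⧸ v) _ _ _

end Spec

end

end QDiff

theorem mainTheorem10_general {O K : Type u} [CommRing O] [IsDedekindDomain O] [Field K]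
    [Algebra O K] [IsFractionRing O K] {q : O} {P : O[X]} (hq : algebraMap O K q ≠ 0)
    (hP : P.map (algebraMap O K) ≠ 0) :
    (∀ M : QDiff.Obj (QDiff.QAlg.diffRing q P),
      QDiff.DiffGalLoc.{u, w} (algebraMap O K) q P hq hP M ∧
      QDiff.DiffGalDiffLoc.{u, w} (algebraMap O K) q P hq hP M ∧
      ∀ (v : Ideal O) [v.IsMaximal] (hqv : Ideal.Quotient.mk v q ≠ 0)
        (hPv : P.map (Ideal.Quotient.mk v) ≠ 0),
        QDiff.SpecDiffGalLoc.{u, w} q P v hqv hPv M ∧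
        QDiff.SpecDiffGalDiffLoc.{u, w} q P v hqv hPv M) ∧
    (∀ M : QDiff.Obj (QDiff.QAlg.connRing q P),
      QDiff.ConnGalLoc.{u, w} (algebraMap O K) q P hq hP M ∧
      QDiff.ConnGalDiffLoc.{u, w} (algebraMap O K) q P hq hP M ∧
      ∀ (v : Ideal O) [v.IsMaximal] (hqv : Ideal.Quotient.mk v q ≠ 0)
        (hPv : P.map (Ideal.Quotient.mk v) ≠ 0),
        QDiff.SpecConnGalLoc.{u, w} q P v hqv hPv M ∧
        QDiff.SpecConnGalDiffLoc.{u, w} q P v hqv hPv M) := by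
  refine ⟨fun M => ?_, fun M => ?_⟩
  · obtain ⟨hGal, hGalDiff⟩ := QDiff.diffGalLoc_and_diffGalDiffLoc.{u, w} hq hP M
    exact ⟨hGal, hGalDiff, fun v _ hqv hPv =>
      QDiff.specDiffGalLoc_and_specDiffGalDiffLoc.{u, w} hqv hPv M⟩
  · obtain ⟨hGal, hGalDiff⟩ := QDiff.connGalLoc_and_connGalDiffLoc.{u, w} hq hP M
    exact ⟨hGal, hGalDiff, fun v _ hqv hPv =>
      QDiff.specConnGalLoc_and_specConnGalDiffLoc.{u, w} hqv hPv M⟩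

theorem mainTheorem10 {k : Type v} {K : Type u} [Field k] [Field K] [Algebra k[X] K]
    [Algebra (RatFunc k) K] [IsScalarTower k[X] (RatFunc k) K] [FunctionField k K]
    (P : (QDiff.OK k K)[X]) (hP : P ≠ 0) :
    -- `q`-difference modules `(M, Σ)` over `A = O_K[x, 1/P(x), 1/P(qx), …]`
    (∀ (M : Type u) [AddCommGroup M] [Module (QDiff.QAlg (QDiff.qOK k K) P) M]
      [Module.Finite (QDiff.QAlg (QDiff.qOK k K) P) M]
      [Module.Projective (QDiff.QAlg (QDiff.qOK k K) P) M]
      (S : M →ₛₗ[QDiff.QAlg.sig (QDiff.qOK k K) P] M)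
      (hS : Submodule.span (QDiff.QAlg (QDiff.qOK k K) P) (Set.range S) = ⊤),
      QDiff.DiffGalLoc.{u, w} (algebraMap (QDiff.OK k K) K) (QDiff.qOK k K) P
        (QDiff.qOK_ne_zero k K) (QDiff.map_ne_zero_of_ne_zero k K hP)
        (QDiff.QAlg.ofSemilinear (QDiff.qOK k K) P M S hS) ∧
      QDiff.DiffGalDiffLoc.{u, w} (algebraMap (QDiff.OK k K) K) (QDiff.qOK k K) P
        (QDiff.qOK_ne_zero k K) (QDiff.map_ne_zero_of_ne_zero k K hP)
        (QDiff.QAlg.ofSemilinear (QDiff.qOK k K) P M S hS) ∧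
      ∀ (v : Ideal (QDiff.OK k K)) [v.IsMaximal]
        (hq : Ideal.Quotient.mk v (QDiff.qOK k K) ≠ 0)
        (_ : Ideal.Quotient.mk v (QDiff.qOK k K) ≠ 1)
        (hPv : P.map (Ideal.Quotient.mk v) ≠ 0),
        QDiff.SpecDiffGalLoc.{u, w} (QDiff.qOK k K) P v hq hPv
          (QDiff.QAlg.ofSemilinear (QDiff.qOK k K) P M S hS) ∧
        QDiff.SpecDiffGalDiffLoc.{u, w} (QDiff.qOK k K) P v hq hPv
          (QDiff.QAlg.ofSemilinear (QDiff.qOK k K) P M S hS)) ∧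
    -- modules with connection `(M, Δ_q)` over `(A, δ_q)`; here `v` may be a place with `q_v = 1`
    (∀ M : QDiff.Obj (QDiff.QAlg.connRing (QDiff.qOK k K) P),
      QDiff.ConnGalLoc.{u, w} (algebraMap (QDiff.OK k K) K) (QDiff.qOK k K) P
        (QDiff.qOK_ne_zero k K) (QDiff.map_ne_zero_of_ne_zero k K hP) M ∧
      QDiff.ConnGalDiffLoc.{u, w} (algebraMap (QDiff.OK k K) K) (QDiff.qOK k K) P
        (QDiff.qOK_ne_zero k K) (QDiff.map_ne_zero_of_ne_zero k K hP) M ∧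
      ∀ (v : Ideal (QDiff.OK k K)) [v.IsMaximal]
        (hq : Ideal.Quotient.mk v (QDiff.qOK k K) ≠ 0)
        (hPv : P.map (Ideal.Quotient.mk v) ≠ 0),
        QDiff.SpecConnGalLoc.{u, w} (QDiff.qOK k K) P v hq hPv M ∧
        QDiff.SpecConnGalDiffLoc.{u, w} (QDiff.qOK k K) P v hq hPv M) := by
  have := QDiff.isDedekindDomain_OK k K
  obtain ⟨hDiff, hConn⟩ := mainTheorem10_general.{u, w} (QDiff.qOK_ne_zero k K)
    (QDiff.map_ne_zero_of_ne_zero k K hP)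
  exact ⟨fun M _ _ _ _ S hS => (hDiff _).imp_right fun h => h.imp_right fun h v _ hq _ => h v hq,
    hConn⟩
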